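/- **Conventions.** A *unitary set-operad* $\mathcal P$ is a symmetric operad in the category of sets (sets $\mathcal P(n)$, $n\ge 0$, with right actions of the symmetric groups $\mathfrak S_n$, a unit $1\in\mathcal P(1)$ and associative, unital and equivariant composition maps $\gamma:\mathcal P(n)\times\mathcal P(m_1)\times\cdots\times\mathcal P(m_n)\to\mathcal P(m_1+\cdots+m_n)$) such that $\mathcal P(0)$ is a one-element set $\{0_{\mathcal P}\}$. Write $\underline n=\{1,\dots,n\}$ and $[n]=\{0,1,\dots,n\}$, pointed by $0$. *The category $\Gamma(\mathcal P)$* has the objects $[n]$, $n\ge0$; a morphism $[n]\to[m]$ is a pair $(f,\omega^f)$ of a pointed map $f:[n]\to[m]$ and a family $\omega^f\in\prod_{y\in[m],\,y\neq0}\mathcal P(|f^{-1}(y)|)$. *The category $\Omega(\mathcal P)$* has the objects $\underline n$, $n\ge 0$; a morphism $\underline n\to\underline m$ is a pair $(f,\omega^f)$ of a surjective map $f:\underline n\to\underline m$ and a family $\omega^f\in\prod_{y\in\underline m}\mathcal P(|f^{-1}(y)|)$. In both, $(g,\omega^g)\circ(f,\omega^f)=(g\circ f,\omega^{g\circ f})$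 with $$\omega^{g\circ f}_i=\gamma(\omega^g_i;\omega^f_{j_1},\dots,\omega^f_{j_s})\cdot\sigma_i ,\qquad g^{-1}(i)=\{j_1<\dots<j_s\},$$ where, if $x_1<x_2<\cdots$ are the elements of $(g\circ f)^{-1}(i)$ in increasing order and $y_1,y_2,\dots$ are the same elements listed as those of $f^{-1}(j_1)$ in increasing order, followed by those of $f^{-1}(j_2)$ in increasing order, and so on, the permutation $\sigma_i$ is given by $\sigma_i(k)=l$ for $y_l=x_k$. The identities are decorated by $1\in\mathcal P(1)$. A morphism $(f,\omega^f)$ of $\Omega(\mathcal P)$ extends to the morphism $(f_+,\omega^{f_+})$ of $\Gamma(\mathcal P)$ with $f_+(0)=0$ and the same decorations. If $(g,\omega^g):[n]\to[m]$ is a morphism of $\Gamma(\mathcal P)$ and $\mu\subset\underline n$ satisfies $0\notin g(\mu)$, then $(g_{|\mu},\omega^{g_{|\mu}}):\underline{|\mu|}\to\underline{|g(\mu)|}$ denotes the morphism of $\Omega(\mathcal P)$ obtained by composing $g$ with the inclusion $[|\mu|]\cong\{0\}\cup\mu\subset[n]$ (decorated by $1\in\mathcal P(1)$ and $0_{\mathcal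 P}$) and identifying $\mu$ and $g(\mu)$ with $\underline{|\mu|}$ and $\underline{|g(\mu)|}$ by the increasing bijections. $\Gamma(\mathcal P)$ has the null object $[0]$ and the wedge $[n]\vee[m]=[n+m]$, with inclusions of and retractions onto the summands, decorated by $1\in\mathcal P(1)$ and $0_{\mathcal P}$. For $1\le k\le n$ let $r_k:[n]\to[n-1]$ be the retraction that sends $k$ to $0$ and is increasing on the other elements. $Ab$ is the category of abelian groups. The *cross-effects* of $F:\Gamma(\mathcal P)\to Ab$ are defined by $cr_0F=F([0])$, $cr_1F(X)=\ker(F(X)\to F([0]))$, $cr_2F(X_1,X_2)=\ker(F(X_1\vee X_2)\to F(X_1)\oplus F(X_2))$ (the map induced by the retractions) and $cr_nF(X_1,\dots,X_n)=cr_2(cr_{n-1}F(-,X_3,\dots,X_n))(X_1,X_2)$ for $n\ge3$; thus $cr_nF(X_1,\dots,X_n)\subset F(X_1\vee\dots\vee X_n)$. The cross-effects $\widetilde{cr}_nG$ of a contravariant functor $G:\Gamma(\mathcal P)^{op}\to Ab$ are defined by the same formulas, with the inclusions $0\to X$ and $X_i\to X_1\vee X_2$ in place of the retractions. **Theorem.**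 Let $\mathcal P$ be a unitary set-operad. The following functors are well defined, and they are mutually inverse equivalences of categories $$cr:Func(\Gamma(\mathcal P),Ab)\rightleftarrows Func(\Omega(\mathcal P),Ab):i_!\,,\qquad \widetilde{cr}:Func(\Gamma(\mathcal P)^{op},Ab)\rightleftarrows Func(\Omega(\mathcal P)^{op},Ab):i_*\,.$$ 1. $cr(F)(\underline n)=cr_nF([1],\dots,[1])\subset F([n])$, and for a morphism $(f,\omega^f)$ of $\Omega(\mathcal P)$ the map $cr(F)(f,\omega^f)$ is the restriction of $F(f_+,\omega^{f_+})$. 2. $\widetilde{cr}(G)(\underline n)=\widetilde{cr}_nG([1],\dots,[1])\subset G([n])$. This subgroup is a complement of $R_n=\sum_{k=1}^n\operatorname{Im}G(r_k)$ in $G([n])$, so that it is identified with $G([n])/R_n$. For a morphism $(f,\omega^f):\underline n\to\underline m$ of $\Omega(\mathcal P)$ the map $G(f_+,\omega^{f_+}):G([m])\to G([n])$ sends $R_m$ into $R_n$, and $\widetilde{cr}(G)(f,\omega^f):\widetilde{cr}(G)(\underline m)\to\widetilde{cr}(G)(\underline n)$ is the map that it induces on these quotients. 3. $i_!(G)([n])=\bigoplus_{\mu\subset\underline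 n}G(\underline{|\mu|})$, and for a morphism $(g,\omega^g):[n]\to[m]$ of $\Gamma(\mathcal P)$ the restriction of $i_!(G)(g,\omega^g)$ to the summand $G(\underline{|\mu|})$ is $0$ if $0\in g(\mu)$, and otherwise it is $G(g_{|\mu},\omega^{g_{|\mu}}):G(\underline{|\mu|})\to G(\underline{|g(\mu)|})$ followed by the inclusion of the summand indexed by $g(\mu)$. 4. $i_*(G)([n])=\bigoplus_{\mu\subset\underline n}G(\underline{|\mu|})$, and for a morphism $(h,\omega^h):[n]\to[m]$ of $\Gamma(\mathcal P)$, the component of $i_*(G)(h,\omega^h):i_*(G)([m])\to i_*(G)([n])$ from the summand indexed by $\mu\subset\underline m$ to the one indexed by $\nu\subset\underline n$ is $G(h_{|\nu},\omega^{h_{|\nu}})$ if $h(\nu)=\mu$, and $0$ otherwise. These equivalences are natural in $\mathcal P$: if $\alpha:\mathcal P\to\mathcal Q$ is a morphism of unitary set-operads, then each of the functors $cr$, $i_!$, $\widetilde{cr}$ and $i_*$ for $\mathcal P$ and for $\mathcal Q$ commutes (strictly) with the precomposition with the functors $\Gamma(\mathcal P)\to\Gamma(\mathcal Q)$ and $\Omega(\mathcal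 P)\to\Omega(\mathcal Q)$ induced by $\alpha$. -/

import Mathlib

open CategoryTheory

universe u w v

namespace DoldKan

/-! ### Symmetric set-operads -/

/-- Sets `P(n)`, `n ≥ 0`, with right actions of the symmetric groups. -/
structure SymmetricSequence where
  obj : ℕ → Type u
  act : ∀ {n : ℕ}, obj n → Equiv.Perm (Fin n) → obj n
  act_one : ∀ {n : ℕ} (x : obj n), act x 1 = x
  act_mul : ∀ {n : ℕ} (x : obj n) (σ τ : Equiv.Perm (Fin n)), act x (σ * τ) = act (act x σ) τ

namespace SymmetricSequence

variable (S : SymmetricSequence.{u})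

/-- Transport along an equality of arities. -/
def cast {n m : ℕ} (h : n = m) (x : S.obj n) : S.obj m := h ▸ x

theorem eq_of_equiv {n m : ℕ} (e : Fin n ≃ Fin m) : n = m := by
  simpa using Fintype.card_congr e

/-- The map `P(n) → P(m)` induced by a bijection `h : {1,…,n} ≃ {1,…,m}` (so that `n = m`):
`ω ↦ ω · h⁻¹`. -/
def reindex {n m : ℕ} (h : Fin n ≃ Fin m) (x : S.obj n) : S.obj m :=
  S.cast (eq_of_equiv h) (S.act x ((finCongr (eq_of_equiv h)).trans h.symm))

theorem reindex_perm {n : ℕ} (h : Fin n ≃ Fin n) (x : S.obj n) :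
    S.reindex h x = S.act x h⁻¹ := rfl

theorem reindex_refl {n : ℕ} (x : S.obj n) : S.reindex (Equiv.refl _) x = x :=
  S.act_one x

theorem reindex_finCongr {n m : ℕ} (h : n = m) (x : S.obj n) :
    S.reindex (finCongr h) x = S.cast h x := by
  subst h
  exact S.act_one x

theorem reindex_trans {n m k : ℕ} (e : Fin n ≃ Fin m) (f : Fin m ≃ Fin k) (x : S.obj n) :
    S.reindex (e.trans f) x = S.reindex f (S.reindex e x) := by
  obtain rfl := eq_of_equiv e
  obtain rfl := eq_of_equiv f
  rw [reindex_perm, reindex_perm, reindex_perm, ← S.act_mul]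
  rfl

end SymmetricSequence

/-- The permutation of blocks: the bijection sending the `i`-th block identically onto the
block with index `σ i`. -/
def blockEquiv {n : ℕ} (σ : Equiv.Perm (Fin n)) (m : Fin n → ℕ) :
    Fin (∑ i, m (σ i)) ≃ Fin (∑ i, m i) :=
  (finSigmaFinEquiv.symm.trans (Equiv.sigmaCongrLeft (β := fun i => Fin (m i)) σ)).trans
    finSigmaFinEquiv

/-- The block sum `τ₁ ⊕ … ⊕ τₙ` of permutations. -/
def sumPerm {n : ℕ} {m : Fin n → ℕ} (τ : ∀ i, Equiv.Perm (Fin (m i))) :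
    Equiv.Perm (Fin (∑ i, m i)) :=
  (finSigmaFinEquiv.symm.trans (Equiv.sigmaCongrRight τ)).trans finSigmaFinEquiv

theorem sum_assoc {n : ℕ} (m : Fin n → ℕ) (k : ∀ i, Fin (m i) → ℕ) :
    (∑ l : Fin (∑ i, m i), k (finSigmaFinEquiv.symm l).1 (finSigmaFinEquiv.symm l).2) =
      ∑ i, ∑ j, k i j := by
  rw [Equiv.sum_comp finSigmaFinEquiv.symm (fun p : (i : Fin n) × Fin (m i) => k p.1 p.2),
    Fintype.sum_sigma]

/-- A symmetric operad in the category of sets. The bijection `finSigmaFinEquiv` between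
pairs `(i, j)` and `Fin (∑ i, m i)` is the lexicographic one. -/
structure SetOperad extends SymmetricSequence.{u} where
  one : obj 1
  γ : ∀ {n : ℕ} (_ : obj n) {m : Fin n → ℕ} (_ : ∀ i, obj (m i)), obj (∑ i, m i)
  one_γ : ∀ {n : ℕ} (x : obj n),
    γ one (m := fun _ : Fin 1 => n) (fun _ => x) = toSymmetricSequence.cast (by simp) x
  γ_one : ∀ {n : ℕ} (x : obj n),
    γ x (m := fun _ : Fin n => 1) (fun _ => one) = toSymmetricSequence.cast (by simp) x
  γ_assoc : ∀ {n : ℕ} (x : obj n) {m : Fin n → ℕ} (y : ∀ i, obj (m i))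
    {k : ∀ i, Fin (m i) → ℕ} (z : ∀ i j, obj (k i j)),
    toSymmetricSequence.cast (sum_assoc m k)
      (γ (γ x y) (fun l => z (finSigmaFinEquiv.symm l).1 (finSigmaFinEquiv.symm l).2)) =
      γ x (fun i => γ (y i) (z i))
  γ_act_left : ∀ {n : ℕ} (x : obj n) (σ : Equiv.Perm (Fin n)) {m : Fin n → ℕ}
    (y : ∀ i, obj (m i)),
    γ (act x σ) y =
      toSymmetricSequence.reindex (blockEquiv σ⁻¹ m) (γ x (fun i => y (σ⁻¹ i)))
  γ_act_right : ∀ {n : ℕ} (x : obj n) {m : Fin n → ℕ} (y : ∀ i, obj (m i))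
    (τ : ∀ i, Equiv.Perm (Fin (m i))),
    γ x (fun i => act (y i) (τ i)) = act (γ x y) (sumPerm τ)

/-- A unitary set-operad: `P(0)` consists of a single element. -/
structure UnitaryOperad extends SetOperad.{u} where
  zero : obj 0
  eq_zero : ∀ x : obj 0, x = zero

/-- A morphism of (unitary) set-operads. -/
structure OperadHom (P : UnitaryOperad.{u}) (Q : UnitaryOperad.{w}) where
  app : ∀ {n : ℕ}, P.obj n → Q.obj n
  app_act : ∀ {n : ℕ} (x : P.obj n) (σ : Equiv.Perm (Fin n)), app (P.act x σ) = Q.act (app x) σ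
  app_one : app P.one = Q.one
  app_γ : ∀ {n : ℕ} (x : P.obj n) {m : Fin n → ℕ} (y : ∀ i, P.obj (m i)),
    app (P.γ x y) = Q.γ (app x) (fun i => app (y i))

/-! ### Operations indexed by finite linearly ordered sets -/

/-- The increasing enumeration of a finite linearly ordered set. -/
noncomputable def enum (X : Type) [Finite X] [LinearOrder X] : Fin (Nat.card X) ≃ X :=
  haveI := Fintype.ofFinite X
  (monoEquivOfFin X Nat.card_eq_fintype_card.symm).toEquiv

theorem finSigma_lt_iff {n : ℕ} {m : Fin n → ℕ} (a b : (i : Fin n) × Fin (m i)) :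
    finSigmaFinEquiv a < finSigmaFinEquiv b ↔
      a.1 < b.1 ∨ (a.1 = b.1 ∧ (a.2 : ℕ) < b.2) := by
  have key : ∀ a b : (i : Fin n) × Fin (m i), a.1 < b.1 →
      finSigmaFinEquiv a < finSigmaFinEquiv b := by
    intro a b h
    rw [Fin.lt_def, finSigmaFinEquiv_apply, finSigmaFinEquiv_apply]
    have h1 : (∑ i : Fin a.1, m (Fin.castLE a.1.2.le i)) =
        ∑ i ∈ Finset.univ.filter (fun i : Fin n => i < a.1), m i := by
      refine Finset.sum_bij (fun i _ => Fin.castLE a.1.2.le i) ?_ ?_ ?_ ?_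
      · intro i _
        exact Finset.mem_filter.2 ⟨Finset.mem_univ _, i.2⟩
      · intro i _ j _ h; simpa using h
      · intro i hi
        simp only [Finset.mem_filter, Finset.mem_univ, true_and] at hi
        exact ⟨⟨i, hi⟩, Finset.mem_univ _, rfl⟩
      · intros; rfl
    have h2 : (∑ i : Fin b.1, m (Fin.castLE b.1.2.le i)) =
        ∑ i ∈ Finset.univ.filter (fun i : Fin n => i < b.1), m i := by
      refine Finset.sum_bij (fun i _ => Fin.castLE b.1.2.le i) ?_ ?_ ?_ ?_
      · intro i _
        exact Finset.mem_filter.2 ⟨Finset.mem_univ _, i.2⟩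
      · intro i _ j _ h; simpa using h
      · intro i hi
        simp only [Finset.mem_filter, Finset.mem_univ, true_and] at hi
        exact ⟨⟨i, hi⟩, Finset.mem_univ _, rfl⟩
      · intros; rfl
    rw [h1, h2]
    have h3 : insert a.1 (Finset.univ.filter (fun i : Fin n => i < a.1)) ⊆
        Finset.univ.filter (fun i : Fin n => i < b.1) := by
      intro i hi
      simp only [Finset.mem_insert, Finset.mem_filter, Finset.mem_univ, true_and] at hi ⊢
      rcases hi with rfl | hi
      · exact h
      · exact hi.trans h
    have h4 := Finset.sum_le_sum_of_subset (f := m) h3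
    rw [Finset.sum_insert (by simp)] at h4
    have := a.2.2
    omega
  constructor
  · intro h
    rcases lt_trichotomy a.1 b.1 with h1 | h1 | h1
    · exact Or.inl h1
    · refine Or.inr ⟨h1, ?_⟩
      obtain ⟨a1, a2⟩ := a
      obtain ⟨b1, b2⟩ := b
      obtain rfl : a1 = b1 := h1
      rw [Fin.lt_def, finSigmaFinEquiv_apply, finSigmaFinEquiv_apply] at h
      simpa using h
    · exact absurd (key _ _ h1) (not_lt.2 h.le)
  · rintro (h | ⟨h1, h2⟩)
    · exact key _ _ h
    · obtain ⟨a1, a2⟩ := a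
      obtain ⟨b1, b2⟩ := b
      obtain rfl : a1 = b1 := h1
      rw [Fin.lt_def, finSigmaFinEquiv_apply, finSigmaFinEquiv_apply]
      simpa using h2

theorem finSigma_assoc {n : ℕ} (m : Fin n → ℕ) (k : ∀ i, Fin (m i) → ℕ)
    (l : Fin (∑ i, m i))
    (r : Fin (k (finSigmaFinEquiv.symm l).1 (finSigmaFinEquiv.symm l).2)) :
    Fin.cast (sum_assoc m k) (finSigmaFinEquiv ⟨l, r⟩) =
      finSigmaFinEquiv (n := fun i => ∑ j, k i j)
        ⟨(finSigmaFinEquiv.symm l).1, finSigmaFinEquiv ⟨(finSigmaFinEquiv.symm l).2, r⟩⟩ := by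
  let K : Fin (∑ i, m i) → ℕ := fun l => k (finSigmaFinEquiv.symm l).1 (finSigmaFinEquiv.symm l).2
  let A : ((l : Fin (∑ i, m i)) × Fin (K l)) ≃ ((i : Fin n) × Fin (∑ j, k i j)) :=
    ((Equiv.sigmaCongrLeft (β := fun p : (i : Fin n) × Fin (m i) => Fin (k p.1 p.2))
      finSigmaFinEquiv.symm).trans (Equiv.sigmaAssoc fun i j => Fin (k i j))).trans
      (Equiv.sigmaCongrRight fun i => finSigmaFinEquiv)
  let e : Fin (∑ l, K l) ≃ Fin (∑ i, ∑ j, k i j) :=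
    (finSigmaFinEquiv.symm.trans A).trans finSigmaFinEquiv
  have he : ∀ p, e (finSigmaFinEquiv p) = finSigmaFinEquiv (A p) := fun p => by
    simp [e]
  have key : ∀ (p q : (i : Fin n) × Fin (m i)) (r : Fin (k p.1 p.2)) (r' : Fin (k q.1 q.2)),
      ((p.1 < q.1 ∨ (p.1 = q.1 ∧
        ((finSigmaFinEquiv (⟨p.2, r⟩ : (j : Fin (m _)) × Fin (k _ j)) : Fin _) : ℕ) <
          (finSigmaFinEquiv (⟨q.2, r'⟩ : (j : Fin (m _)) × Fin (k _ j)) : Fin _))) ↔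
      ((p.1 < q.1 ∨ (p.1 = q.1 ∧ (p.2 : ℕ) < q.2)) ∨ (p = q ∧ (r : ℕ) < r'))) := by
    rintro ⟨i, j⟩ ⟨i', j'⟩ r r'
    by_cases h : i = i'
    · subst h
      have := finSigma_lt_iff (m := k i) ⟨j, r⟩ ⟨j', r'⟩
      rw [Fin.lt_def] at this
      simp only [lt_self_iff_false, true_and, false_or, Sigma.mk.injEq, heq_eq_eq]
      rw [this]
      simp only [Fin.lt_def]
    · have : ¬ ((⟨i, j⟩ : (i : Fin n) × Fin (m i)) = ⟨i', j'⟩) := by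
        intro h'
        exact h (congrArg Sigma.fst h')
      simp [h, this]
  have hlt : ∀ a b, e a < e b ↔ a < b := by
    intro a b
    obtain ⟨p, rfl⟩ := finSigmaFinEquiv.surjective a
    obtain ⟨q, rfl⟩ := finSigmaFinEquiv.surjective b
    obtain ⟨l, r⟩ := p
    obtain ⟨l', r'⟩ := q
    rw [he, he, finSigma_lt_iff, finSigma_lt_iff]
    have hl := finSigma_lt_iff (finSigmaFinEquiv.symm l) (finSigmaFinEquiv.symm l')
    rw [Equiv.apply_symm_apply, Equiv.apply_symm_apply] at hl
    have hl2 : l = l' ↔ finSigmaFinEquiv.symm l = finSigmaFinEquiv.symm l' := by simp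
    rw [hl, hl2]
    exact key (finSigmaFinEquiv.symm l) (finSigmaFinEquiv.symm l') r r'
  have h1 := Fin.coe_orderIso_apply (⟨e, by
    intro a b
    rw [← not_lt, ← not_lt]
    exact not_congr (hlt b a)⟩ : Fin (∑ l, K l) ≃o Fin (∑ i, ∑ j, k i j)) (finSigmaFinEquiv ⟨l, r⟩)
  apply Fin.ext
  rw [Fin.val_cast]
  refine h1.symm.trans ?_
  exact congrArg Fin.val (he ⟨l, r⟩)

theorem finSigma_symm_assoc {n : ℕ} (m : Fin n → ℕ) (k : ∀ i, Fin (m i) → ℕ)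
    (t : Fin (∑ l : Fin (∑ i, m i),
      k (finSigmaFinEquiv.symm l).1 (finSigmaFinEquiv.symm l).2))
    (t' : Fin (∑ i, ∑ j, k i j)) (ht : t' = Fin.cast (sum_assoc m k) t) :
    (⟨finSigmaFinEquiv.symm (finSigmaFinEquiv.symm t).1, (finSigmaFinEquiv.symm t).2⟩ :
        Σ p : (i : Fin n) × Fin (m i), Fin (k p.1 p.2)) =
      ⟨⟨(finSigmaFinEquiv.symm t').1, (finSigmaFinEquiv.symm (finSigmaFinEquiv.symm t').2).1⟩,
        (finSigmaFinEquiv.symm (finSigmaFinEquiv.symm t').2).2⟩ := by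
  obtain ⟨⟨l, r⟩, rfl⟩ := finSigmaFinEquiv.surjective t
  rw [finSigma_assoc] at ht
  subst ht
  let T := Σ p : (i : Fin n) × Fin (m i), Fin (k p.1 p.2)
  let F₁ : (Σ l : Fin (∑ i, m i),
      Fin (k (finSigmaFinEquiv.symm l).1 (finSigmaFinEquiv.symm l).2)) → T :=
    fun u => ⟨finSigmaFinEquiv.symm u.1, u.2⟩
  let F₂ : (Σ i, Fin (∑ j, k i j)) → T := fun u =>
    ⟨⟨u.1, (finSigmaFinEquiv.symm u.2).1⟩, (finSigmaFinEquiv.symm u.2).2⟩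
  let F₃ : ∀ i, (Σ j, Fin (k i j)) → T := fun i v => ⟨⟨i, v.1⟩, v.2⟩
  refine (congrArg F₁ (finSigmaFinEquiv.symm_apply_apply _)).trans ?_
  refine Eq.trans ?_ (congrArg F₂ (finSigmaFinEquiv.symm_apply_apply _)).symm
  exact (congrArg (F₃ (finSigmaFinEquiv.symm l).1) (finSigmaFinEquiv.symm_apply_apply
    (⟨(finSigmaFinEquiv.symm l).2, r⟩ : Σ j, Fin (k (finSigmaFinEquiv.symm l).1 j)))).symm

namespace UnitaryOperad

variable (P : UnitaryOperad.{u})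

/-- Transport of operations along the map `P(n) → P(m)`, `ω ↦ ω · h⁻¹`. -/
abbrev re {n m : ℕ} (h : Fin n ≃ Fin m) (x : P.obj n) : P.obj m :=
  P.toSymmetricSequence.reindex h x

/-- For a finite linearly ordered set `X`, the set `P(|X|)`; its elements are regarded as
operations whose inputs are the elements of `X`, in increasing order. -/
abbrev on (X : Type) [Finite X] : Type u := P.obj (Nat.card X)

section

variable {X Y Z : Type} [Finite X] [LinearOrder X] [Finite Y] [LinearOrder Y]
  [Finite Z] [LinearOrder Z]

/-- An operation with inputs labelled by `e 1, …, e n`, written with its inputs in the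
natural order. -/
noncomputable def label {n : ℕ} (e : Fin n ≃ X) (x : P.obj n) : P.on X := P.re (e.trans (enum X).symm) x

/-- The bijection `P(|X|) → P(|Y|)` induced by a bijection `X ≃ Y`. -/
noncomputable def transport (e : X ≃ Y) (x : P.on X) : P.on Y := P.label ((enum X).trans e) x

/-- The operadic composite of an operation `ω` with inputs `i ∈ I` and operations `ω' i` with
inputs `X i`. The ordered disjoint union of the `X i` is identified with `Z` by `h`, and the
inputs of the composite are put in the natural order of `Z`. -/
noncomputable def glue {I : Type} [Finite I] [LinearOrder I] {X : I → Type} [∀ i, Finite (X i)]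
    [∀ i, LinearOrder (X i)] (h : (Σ i, X i) ≃ Z) (ω : P.on I) (ω' : ∀ i, P.on (X i)) : P.on Z :=
  P.label ((finSigmaFinEquiv.symm.trans (Equiv.sigmaCongr (enum I) fun k => enum (X (enum I k)))).trans
    h) (P.γ ω fun k => ω' (enum I k))

theorem sigma_apply {Z I : Type} {X : I → Type} {n : ℕ} (a : Fin n ≃ I) {m : Fin n → ℕ}
    (b : ∀ k, Fin (m k) ≃ X (a k)) (h : (Σ i, X i) ≃ Z) (k : Fin n) (r : Fin (m k)) :
    ((finSigmaFinEquiv.symm.trans (Equiv.sigmaCongr a b)).trans h) (finSigmaFinEquiv ⟨k, r⟩) =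
      h ⟨a k, b k r⟩ := by
  simp [Equiv.sigmaCongr, Equiv.sigmaCongrLeft]

theorem label_enum (x : P.on X) : P.label (enum X) x = x := by
  have : (enum X).trans (enum X).symm = Equiv.refl _ := by ext; simp
  rw [label, re, this, SymmetricSequence.reindex_refl]

theorem label_re {n m : ℕ} (s : Fin n ≃ Fin m) (e : Fin m ≃ X) (x : P.obj n) :
    P.label e (P.re s x) = P.label (s.trans e) x := by
  rw [label, label, re, re, ← SymmetricSequence.reindex_trans]
  rfl

theorem transport_label {n : ℕ} (e : Fin n ≃ X) (f : X ≃ Y) (x : P.obj n) :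
    P.transport f (P.label e x) = P.label (e.trans f) x := by
  change P.label ((enum X).trans f) (P.re (e.trans (enum X).symm) x) = _
  rw [label_re]
  congr 1
  ext; simp

theorem transport_refl (x : P.on X) : P.transport (Equiv.refl X) x = x := P.label_enum x

theorem transport_trans (e : X ≃ Y) (f : Y ≃ Z) (x : P.on X) :
    P.transport f (P.transport e x) = P.transport (e.trans f) x := by
  change P.transport f (P.label ((enum X).trans e) x) = _
  rw [transport_label]
  rfl

theorem transport_eq_self (e : X ≃ X) (he : ∀ a, e a = a) (x : P.on X) :
    P.transport e x = x := by
  have : e = Equiv.refl X := Equiv.ext he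
  rw [this, transport_refl]

theorem γ_re_left {n n' : ℕ} (x : P.obj n) (σ : Fin n ≃ Fin n') {m : Fin n' → ℕ}
    (y : ∀ i, P.obj (m i)) :
    P.γ (P.re σ x) y =
      P.re ((finSigmaFinEquiv.symm.trans
        (Equiv.sigmaCongrLeft (β := fun i => Fin (m i)) σ)).trans finSigmaFinEquiv)
        (P.γ x fun i => y (σ i)) := by
  obtain rfl := SymmetricSequence.eq_of_equiv σ
  have h : P.re σ x = P.act x (σ⁻¹ : Equiv.Perm (Fin n)) := rfl
  rw [h, P.γ_act_left]
  rfl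

theorem γ_re_right {n : ℕ} (x : P.obj n) {m m' : Fin n → ℕ} (y : ∀ i, P.obj (m i))
    (τ : ∀ i, Fin (m i) ≃ Fin (m' i)) :
    P.γ x (fun i => P.re (τ i) (y i)) =
      P.re ((finSigmaFinEquiv.symm.trans (Equiv.sigmaCongrRight τ)).trans finSigmaFinEquiv)
        (P.γ x y) := by
  obtain rfl : m = m' := funext fun i => SymmetricSequence.eq_of_equiv (τ i)
  have h : ∀ i, P.re (τ i) (y i) = P.act (y i) ((τ i)⁻¹ : Equiv.Perm (Fin (m i))) :=
    fun i => rfl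
  simp only [h]
  rw [P.γ_act_right]
  rfl

variable {I : Type} [Finite I] [LinearOrder I] {X : I → Type} [∀ i, Finite (X i)]
    [∀ i, LinearOrder (X i)]

theorem glue_label (h : (Σ i, X i) ≃ Z) {n : ℕ} (a : Fin n ≃ I) (x : P.obj n) {m : I → ℕ}
    (b : ∀ i, Fin (m i) ≃ X i) (y : ∀ i, P.obj (m i)) :
    P.glue h (P.label a x) (fun i => P.label (b i) (y i)) =
      P.label ((finSigmaFinEquiv.symm.trans (Equiv.sigmaCongr a fun k => b (a k))).trans h)
        (P.γ x fun k => y (a k)) := by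
  have main : ∀ {n' : ℕ} (c : Fin n' ≃ I) (s : Fin n ≃ Fin n'),
      P.label ((finSigmaFinEquiv.symm.trans (Equiv.sigmaCongr c fun k => enum (X (c k)))).trans h)
        (P.γ (P.re s x) fun k => P.label (b (c k)) (y (c k))) =
      P.label ((finSigmaFinEquiv.symm.trans
          (Equiv.sigmaCongr (s.trans c) fun k => b ((s.trans c) k))).trans h)
        (P.γ x fun k => y ((s.trans c) k)) := by
    intro n' c s
    have e1 := P.γ_re_right (P.re s x) (fun k => y (c k))
      (fun k => (b (c k)).trans (enum (X (c k))).symm)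
    have e2 : (P.γ (P.re s x) fun k => P.label (b (c k)) (y (c k))) = _ := e1
    rw [e2, γ_re_left, label_re, label_re]
    refine congrArg (fun e => P.label e _) ?_
    apply Equiv.ext
    intro t
    obtain ⟨⟨k, r⟩, rfl⟩ := finSigmaFinEquiv.surjective t
    simp [Equiv.sigmaCongr, Equiv.sigmaCongrLeft]
  have := main (enum I) (a.trans (enum I).symm)
  have ha : (a.trans (enum I).symm).trans (enum I) = a := by ext; simp
  rw [ha] at this
  exact this

theorem transport_glue {Z' : Type} [Finite Z'] [LinearOrder Z'] (h : (Σ i, X i) ≃ Z) (e : Z ≃ Z')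
    (ω : P.on I) (ω' : ∀ i, P.on (X i)) :
    P.transport e (P.glue h ω ω') = P.glue (h.trans e) ω ω' := by
  rw [glue, transport_label]
  rfl

theorem glue_transport_right {X' : I → Type} [∀ i, Finite (X' i)] [∀ i, LinearOrder (X' i)]
    (h : (Σ i, X' i) ≃ Z) (e : ∀ i, X i ≃ X' i) (ω : P.on I) (ω' : ∀ i, P.on (X i)) :
    P.glue h ω (fun i => P.transport (e i) (ω' i)) =
      P.glue ((Equiv.sigmaCongrRight e).trans h) ω ω' := by
  have h1 := P.glue_label h (enum I) ω (fun i => (enum (X i)).trans (e i)) ω'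
  rw [label_enum] at h1
  refine h1.trans ?_
  rw [glue]
  refine congrArg (fun e => P.label e _) ?_
  apply Equiv.ext
  intro t
  obtain ⟨⟨k, r⟩, rfl⟩ := finSigmaFinEquiv.surjective t
  simp [Equiv.sigmaCongr, Equiv.sigmaCongrLeft]

theorem glue_transport_left {I' : Type} [Finite I'] [LinearOrder I'] {X' : I' → Type}
    [∀ i, Finite (X' i)] [∀ i, LinearOrder (X' i)]
    (h : (Σ i, X' i) ≃ Z) (e : I ≃ I') (ω : P.on I) (ω' : ∀ i, P.on (X' i)) :
    P.glue h (P.transport e ω) ω' =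
      P.glue ((Equiv.sigmaCongrLeft (β := X') e).trans h) ω (fun i => ω' (e i)) := by
  have h1 := P.glue_label h ((enum I).trans e) ω (fun i => enum (X' i)) ω'
  have h2 : (fun i => P.label (enum (X' i)) (ω' i)) = ω' := funext fun i => P.label_enum _
  rw [h2] at h1
  refine h1.trans ?_
  rw [glue]
  refine congrArg (fun e => P.label e _) ?_
  apply Equiv.ext
  intro t
  obtain ⟨⟨k, r⟩, rfl⟩ := finSigmaFinEquiv.surjective t
  refine (sigma_apply _ _ _ _ _).trans ?_
  exact (sigma_apply (enum I) (fun k => enum (X' (e (enum I k))))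
    ((Equiv.sigmaCongrLeft (β := X') e).trans h) k r).symm

theorem assoc_equiv {I Z V : Type} {X W : I → Type} {Y : Z → Type}
    (h₁ : (Σ i, X i) ≃ Z) (h₂ : (Σ z, Y z) ≃ V) (k : ∀ i, (Σ t : X i, Y (h₁ ⟨i, t⟩)) ≃ W i)
    (h₃ : (Σ i, W i) ≃ V)
    (H : ∀ i t y, h₃ ⟨i, k i ⟨t, y⟩⟩ = h₂ ⟨h₁ ⟨i, t⟩, y⟩)
    {n : ℕ} (a : Fin n ≃ I) {m : I → ℕ} (b : ∀ i, Fin (m i) ≃ X i) {q : Z → ℕ}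
    (c : ∀ z, Fin (q z) ≃ Y z) :
    (finSigmaFinEquiv.symm.trans (Equiv.sigmaCongr
        ((finSigmaFinEquiv.symm.trans (Equiv.sigmaCongr a fun k => b (a k))).trans h₁)
        (fun _ => c _))).trans h₂ =
      (finCongr (sum_assoc (fun i => m (a i)) fun i j => q (h₁ ⟨a i, b (a i) j⟩))).trans
        ((finSigmaFinEquiv.symm.trans (Equiv.sigmaCongr a fun i =>
          (finSigmaFinEquiv.symm.trans (Equiv.sigmaCongr (b (a i))
            fun t => c (h₁ ⟨a i, b (a i) t⟩))).trans (k (a i)))).trans h₃) := by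
  apply Equiv.ext
  intro t
  have h := finSigma_symm_assoc (fun i => m (a i)) (fun i j => q (h₁ ⟨a i, b (a i) j⟩)) t _ rfl
  refine (congrArg (fun p : (Σ p : (i : Fin n) × Fin (m (a i)), Fin (q (h₁ ⟨a p.1, b _ p.2⟩))) =>
    h₂ ⟨h₁ ⟨a p.1.1, b _ p.1.2⟩, c _ p.2⟩) h).trans ?_
  exact (H _ _ _).symm

theorem glue_assoc {V : Type} [Finite V] [LinearOrder V] {Y : Z → Type} [∀ z, Finite (Y z)]
    [∀ z, LinearOrder (Y z)] {W : I → Type} [∀ i, Finite (W i)] [∀ i, LinearOrder (W i)]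
    (h₁ : (Σ i, X i) ≃ Z) (h₂ : (Σ z, Y z) ≃ V) (k : ∀ i, (Σ t : X i, Y (h₁ ⟨i, t⟩)) ≃ W i)
    (h₃ : (Σ i, W i) ≃ V)
    (H : ∀ i t y, h₃ ⟨i, k i ⟨t, y⟩⟩ = h₂ ⟨h₁ ⟨i, t⟩, y⟩)
    (ω : P.on I) (ω' : ∀ i, P.on (X i)) (ω'' : ∀ z, P.on (Y z)) :
    P.glue h₂ (P.glue h₁ ω ω') ω'' =
      P.glue h₃ ω (fun i => P.glue (k i) (ω' i) (fun t => ω'' (h₁ ⟨i, t⟩))) := by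
  have e1 := P.glue_label h₂
    ((finSigmaFinEquiv.symm.trans (Equiv.sigmaCongr (enum I) fun k => enum (X (enum I k)))).trans
      h₁) (P.γ ω fun k => ω' (enum I k)) (fun z => enum (Y z)) ω''
  have h2 : (fun z => P.label (enum (Y z)) (ω'' z)) = ω'' := funext fun i => P.label_enum _
  rw [h2] at e1
  refine e1.trans ?_
  have e3 := P.glue_label h₃ (enum I) ω
    (fun i => (finSigmaFinEquiv.symm.trans
      (Equiv.sigmaCongr (enum (X i)) fun t => enum (Y (h₁ ⟨i, enum (X i) t⟩)))).trans (k i))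
    (fun i => P.γ (ω' i) fun t => ω'' (h₁ ⟨i, enum (X i) t⟩))
  rw [label_enum] at e3
  refine Eq.trans ?_ e3.symm
  have e4 := P.γ_assoc ω (fun k => ω' (enum I k))
    (fun i j => ω'' (h₁ ⟨enum I i, enum (X (enum I i)) j⟩))
  rw [← e4, ← SymmetricSequence.reindex_finCongr, label_re]
  rw [← assoc_equiv h₁ h₂ k h₃ H (enum I) (fun i => enum (X i)) (fun z => enum (Y z))]
  rfl

/-- The unit `1 ∈ P(1)` or the element `0 ∈ P(0)`. -/
def ptNat : ∀ n : ℕ, n ≤ 1 → P.obj n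
  | 0, _ => P.zero
  | 1, _ => P.one
  | (n + 2), h => absurd h (by omega)

end

section

variable {X Y Z : Type} [Finite X] [LinearOrder X] [Finite Y] [LinearOrder Y]
  [Finite Z] [LinearOrder Z]

/-- For a set `X` with at most one element: `1 ∈ P(1)` if `|X| = 1`, and `0 ∈ P(0)` if `|X| = 0`. -/
noncomputable def pt (X : Type) [Finite X] [Subsingleton X] : P.on X :=
  P.ptNat (Nat.card X) (Finite.card_le_one_iff_subsingleton.2 inferInstance)

theorem eq_of_isEmpty {X : Type} [Finite X] [IsEmpty X] (x y : P.on X) : x = y := by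
  have h : Nat.card X = 0 := Nat.card_of_isEmpty
  have : ∀ n, n = 0 → ∀ x y : P.obj n, x = y := by
    rintro n rfl x y
    rw [P.eq_zero x, P.eq_zero y]
  exact this _ h x y

theorem pt_eq_label [Subsingleton X] (e : Fin 1 ≃ X) : P.pt X = P.label e P.one := by
  have : ∀ (n : ℕ) (hn : n ≤ 1) (s : Fin 1 ≃ Fin n), P.ptNat n hn = P.re s P.one := by
    intro n hn s
    obtain rfl := SymmetricSequence.eq_of_equiv s
    have : s = Equiv.refl _ := Subsingleton.elim _ _
    rw [this, re, SymmetricSequence.reindex_refl]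
    rfl
  exact this _ _ _

theorem transport_pt [Subsingleton X] [Subsingleton Y] (e : X ≃ Y) :
    P.transport e (P.pt X) = P.pt Y := by
  by_cases h : Nonempty X
  · obtain ⟨a⟩ := h
    have f : Fin 1 ≃ X := ⟨fun _ => a, fun _ => 0, fun _ => Subsingleton.elim _ _,
      fun _ => Subsingleton.elim _ _⟩
    rw [P.pt_eq_label f, transport_label, ← pt_eq_label]
  · rw [not_nonempty_iff] at h
    have : IsEmpty Y := e.symm.isEmpty
    exact P.eq_of_isEmpty _ _

variable {I : Type} [Finite I] [LinearOrder I] {X : I → Type} [∀ i, Finite (X i)]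
    [∀ i, LinearOrder (X i)]

theorem glue_pt_left [Subsingleton I] (h : (Σ i, X i) ≃ Z) (i : I) (e : X i ≃ Z)
    (he : ∀ x, e x = h ⟨i, x⟩) (ω' : ∀ i, P.on (X i)) :
    P.glue h (P.pt I) ω' = P.transport e (ω' i) := by
  let f : Fin 1 ≃ I := ⟨fun _ => i, fun _ => 0, fun _ => Subsingleton.elim _ _,
    fun _ => Subsingleton.elim _ _⟩
  have h1 := P.glue_label h f P.one (fun i => enum (X i)) ω'
  have h2 : (fun i => P.label (enum (X i)) (ω' i)) = ω' := funext fun i => P.label_enum _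
  rw [h2, ← pt_eq_label] at h1
  refine h1.trans ?_
  have h3 := P.one_γ (ω' i)
  rw [← SymmetricSequence.reindex_finCongr] at h3
  change P.label _ (P.γ P.one fun _ => ω' i) = _
  rw [h3, label_re, transport]
  refine congrArg (fun e => P.label e _) ?_
  apply Equiv.ext
  intro t
  have h4 : (finCongr (by simp)) t = finSigmaFinEquiv (⟨0, t⟩ : (_ : Fin 1) × Fin (Nat.card (X i))) := by
    apply Fin.ext
    rw [finSigmaFinEquiv_one]
    rfl
  simp only [Equiv.trans_apply]
  erw [h4, Equiv.symm_apply_apply]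
  exact (he _).symm

theorem glue_pt_right [∀ i, Subsingleton (X i)] (h : (Σ i, X i) ≃ Z) (e : I ≃ Z) (s : ∀ i, X i)
    (he : ∀ i, e i = h ⟨i, s i⟩) (ω : P.on I) :
    P.glue h ω (fun i => P.pt (X i)) = P.transport e ω := by
  let f : ∀ i, Fin 1 ≃ X i := fun i => ⟨fun _ => s i, fun _ => 0, fun _ => Subsingleton.elim _ _,
    fun _ => Subsingleton.elim _ _⟩
  have h1 := P.glue_label h (enum I) ω f (fun _ => P.one)
  have h2 : (fun i => P.label (f i) P.one) = fun i => P.pt (X i) :=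
    funext fun i => (P.pt_eq_label (f i)).symm
  rw [h2, label_enum] at h1
  refine h1.trans ?_
  have h3 := P.γ_one ω
  rw [← SymmetricSequence.reindex_finCongr] at h3
  rw [h3, label_re, transport]
  refine congrArg (fun e => P.label e _) ?_
  apply Equiv.ext
  intro t
  have h4 : (finCongr (by simp)) t =
      finSigmaFinEquiv (⟨t, 0⟩ : (_ : Fin (Nat.card I)) × Fin 1) := by
    apply Fin.ext
    rw [finSigmaFinEquiv_apply]
    simp
  simp only [Equiv.trans_apply]
  erw [h4, Equiv.symm_apply_apply]
  exact (he _).symm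

theorem glue_pt_pt [Subsingleton I] [∀ i, Subsingleton (X i)] [Subsingleton Z]
    (h : (Σ i, X i) ≃ Z) : P.glue h (P.pt I) (fun i => P.pt (X i)) = P.pt Z := by
  by_cases hI : Nonempty I
  · obtain ⟨i⟩ := hI
    let e : X i ≃ Z := Equiv.ofBijective (fun x => h ⟨i, x⟩)
      ⟨fun _ _ _ => Subsingleton.elim _ _, fun z => by
        obtain ⟨⟨j, x⟩, rfl⟩ := h.surjective z
        obtain rfl := Subsingleton.elim i j
        exact ⟨x, rfl⟩⟩
    rw [P.glue_pt_left h i e (fun _ => rfl), transport_pt]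
  · rw [not_nonempty_iff] at hI
    have : IsEmpty Z := h.symm.isEmpty
    exact P.eq_of_isEmpty _ _

end

end UnitaryOperad

namespace OperadHom

variable {P : UnitaryOperad.{u}} {Q : UnitaryOperad.{w}} (φ : OperadHom P Q)

theorem app_re {n m : ℕ} (h : Fin n ≃ Fin m) (x : P.obj n) :
    φ.app (P.re h x) = Q.re h (φ.app x) := by
  obtain rfl := SymmetricSequence.eq_of_equiv h
  exact φ.app_act _ _

theorem app_transport {X Y : Type} [Finite X] [LinearOrder X] [Finite Y] [LinearOrder Y]
    (e : X ≃ Y) (x : P.on X) : φ.app (P.transport e x) = Q.transport e (φ.app x) :=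
  φ.app_re _ _

theorem app_glue {I Z : Type} [Finite I] [LinearOrder I] {X : I → Type} [∀ i, Finite (X i)]
    [∀ i, LinearOrder (X i)] [Finite Z] [LinearOrder Z]
    (h : (Σ i, X i) ≃ Z) (ω : P.on I) (ω' : ∀ i, P.on (X i)) :
    φ.app (P.glue h ω ω') = Q.glue h (φ.app ω) (fun i => φ.app (ω' i)) := by
  refine (φ.app_re _ _).trans ?_
  rw [φ.app_γ]
  rfl

theorem app_pt (X : Type) [Finite X] [Subsingleton X] : φ.app (P.pt X) = Q.pt X := by
  have : ∀ (n : ℕ) (hn : n ≤ 1), φ.app (P.ptNat n hn) = Q.ptNat n hn := by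
    intro n hn
    match n, hn with
    | 0, _ => exact Q.eq_zero _
    | 1, _ => exact φ.app_one
  exact this _ _

end OperadHom

/-! ### The categories `Γ(P)` and `Ω(P)` -/

/-- The decomposition `(g ∘ f)⁻¹(c) = ⨿_{g(b) = c} f⁻¹(b)`. -/
def fiberSigma {α β γ : Type} (f : α → β) (g : β → γ) (c : γ) :
    (Σ j : {b // g b = c}, {a // f a = j.1}) ≃ {a // g (f a) = c} where
  toFun p := ⟨p.2.1, by rw [p.2.2, p.1.2]⟩
  invFun a := ⟨⟨f a.1, a.2⟩, ⟨a.1, rfl⟩⟩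
  left_inv := by
    rintro ⟨⟨b, hb⟩, ⟨a, ha⟩⟩
    obtain rfl : f a = b := ha
    rfl
  right_inv _ := rfl

theorem UnitaryOperad.transport_congr (P : UnitaryOperad.{u}) {X Y : Type} [Finite X]
    [LinearOrder X] [Finite Y] [LinearOrder Y] (e e' : X ≃ Y) (h : ∀ a, e a = e' a)
    (x : P.on X) : P.transport e x = P.transport e' x := by
  rw [Equiv.ext h]

section Gamma

variable (P : UnitaryOperad.{u})

/-- A morphism `[n] → [m]` of `Γ(P)`: a pointed map `f : {0,…,n} → {0,…,m}` with an element
of `P(|f⁻¹(y)|)` for every `y ≠ 0`. -/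
structure GammaHom (n m : ℕ) where
  toFun : Fin (n + 1) → Fin (m + 1)
  map_zero : toFun 0 = 0
  dec : ∀ y : Fin (m + 1), y ≠ 0 → P.on {x // toFun x = y}

variable {P}

namespace GammaHom

theorem ext' {n m : ℕ} {f g : GammaHom P n m} (h : ∀ x, f.toFun x = g.toFun x)
    (hd : ∀ y hy (e : {x // f.toFun x = y} ≃ {x // g.toFun x = y}), (∀ x, (e x).1 = x.1) →
      P.transport e (f.dec y hy) = g.dec y hy) : f = g := by
  obtain ⟨f, f0, fd⟩ := f
  obtain ⟨g, g0, gd⟩ := g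
  obtain rfl : f = g := funext h
  congr 1
  funext y hy
  have := hd y hy (Equiv.refl _) (fun _ => rfl)
  rwa [UnitaryOperad.transport_refl] at this

theorem transport_dec {n m : ℕ} (f : GammaHom P n m) {Z : Type} [Finite Z] [LinearOrder Z]
    {y y' : Fin (m + 1)} (h : y = y') (hy : y ≠ 0) (hy' : y' ≠ 0) (e : {x // f.toFun x = y} ≃ Z)
    (e' : {x // f.toFun x = y'} ≃ Z) (he : ∀ x hx hx', e ⟨x, hx⟩ = e' ⟨x, hx'⟩) :
    P.transport e (f.dec y hy) = P.transport e' (f.dec y' hy') := by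
  subst h
  exact P.transport_congr _ _ (fun a => he a.1 a.2 a.2) _

theorem ne_zero {n m : ℕ} (g : GammaHom P n m) {i : Fin (m + 1)} (hi : i ≠ 0)
    (j : {b // g.toFun b = i}) : j.1 ≠ 0 := by
  obtain ⟨j, hj⟩ := j
  rintro rfl
  exact hi (hj ▸ g.map_zero)

/-- Pointed maps whose fibres over non-zero elements have at most one element, decorated by
`1 ∈ P(1)` and `0 ∈ P(0)`. -/
noncomputable def ofInj {n m : ℕ} (f : Fin (n + 1) → Fin (m + 1)) (h0 : f 0 = 0)
    (hf : ∀ y, y ≠ 0 → Subsingleton {x // f x = y}) : GammaHom P n m where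
  toFun := f
  map_zero := h0
  dec y hy := haveI := hf y hy; P.pt {x // f x = y}

/-- The identity of `[n]`. -/
noncomputable def id (n : ℕ) : GammaHom P n n :=
  ofInj (fun x => x) rfl (fun _ _ => ⟨fun a b => Subtype.ext (a.2.trans b.2.symm)⟩)

/-- The composite `g ∘ f`: the decoration at `i` is `γ(ω^g_i; ω^f_{j₁}, …, ω^f_{jₛ})`, where
`g⁻¹(i) = {j₁ < … < jₛ}`, with its inputs permuted to the natural order of `(g ∘ f)⁻¹(i)`. -/
noncomputable def comp {n m k : ℕ} (f : GammaHom P n m) (g : GammaHom P m k) : GammaHom P n k where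
  toFun x := g.toFun (f.toFun x)
  map_zero := by rw [f.map_zero, g.map_zero]
  dec i hi := P.glue (fiberSigma f.toFun g.toFun i) (g.dec i hi)
    (fun j => f.dec j.1 (g.ne_zero hi j))

theorem comp_ofInj_dec {n m k : ℕ} (f : GammaHom P n m) (p : Fin (m + 1) → Fin (k + 1)) (h0 hp)
    (y : Fin (k + 1)) (hy : y ≠ 0) (j : Fin (m + 1)) (hj : p j = y) (hj0 : j ≠ 0)
    (e : {x // f.toFun x = j} ≃ {x // p (f.toFun x) = y}) (he : ∀ x, (e x).1 = x.1) :
    (f.comp (ofInj p h0 hp)).dec y hy = P.transport e (f.dec j hj0) := by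
  have := hp y hy
  exact P.glue_pt_left (fiberSigma f.toFun p y) ⟨j, hj⟩ e (fun x => Subtype.ext (he x))
    (fun j => f.dec j.1 _)

theorem ofInj_comp_dec {n m k : ℕ} (p : Fin (n + 1) → Fin (m + 1)) (h0 hp) (f : GammaHom P m k)
    (y : Fin (k + 1)) (hy : y ≠ 0)
    (e : {b // f.toFun b = y} ≃ {a // f.toFun (p a) = y}) (he : ∀ b, p (e b).1 = b.1) :
    ((ofInj p h0 hp).comp f).dec y hy = P.transport e (f.dec y hy) := by
  have : ∀ j : {b // f.toFun b = y}, Subsingleton {a // p a = j.1} :=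
    fun j => hp j.1 (f.ne_zero hy j)
  exact P.glue_pt_right (fiberSigma p f.toFun y) e (fun j => ⟨(e j).1, he j⟩)
    (fun j => rfl) (f.dec y hy)

theorem ofInj_comp_ofInj {n m k : ℕ} (p : Fin (n + 1) → Fin (m + 1)) (h0 hp)
    (q : Fin (m + 1) → Fin (k + 1)) (h0' hq) (r : Fin (n + 1) → Fin (k + 1)) (h0'' hr)
    (h : ∀ x, r x = q (p x)) :
    (ofInj p h0 hp : GammaHom P n m).comp (ofInj q h0' hq) = ofInj r h0'' hr := by
  obtain rfl : r = fun x => q (p x) := funext h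
  refine ext' (fun _ => rfl) (fun y hy e he => ?_)
  have := hr y hy
  have := hq y hy
  have : ∀ j : {b // q b = y}, Subsingleton {a // p a = j.1} :=
    fun j => hp j.1 (fun h => hy (by rw [← j.2, h, h0']))
  refine (congrArg (P.transport e) (P.glue_pt_pt (fiberSigma p q y))).trans ?_
  exact P.transport_pt (X := {x // q (p x) = y}) (Y := {x // q (p x) = y}) e

theorem id_comp {n m : ℕ} (f : GammaHom P n m) : (id n).comp f = f := by
  refine ext' (fun _ => rfl) (fun y hy e he => ?_)
  have := ofInj_comp_dec (fun x => x) rfl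
    (fun _ _ => ⟨fun a b => Subtype.ext (a.2.trans b.2.symm)⟩) f y hy (Equiv.refl _) (fun _ => rfl)
  refine (congrArg (P.transport e) this).trans ?_
  refine (P.transport_trans _ _ _).trans ?_
  exact P.transport_eq_self _ (fun a => Subtype.ext (he a)) _

theorem comp_id {n m : ℕ} (f : GammaHom P n m) : f.comp (id m) = f := by
  refine ext' (fun _ => rfl) (fun y hy e he => ?_)
  have := comp_ofInj_dec f (fun x => x) rfl
    (fun _ _ => ⟨fun a b => Subtype.ext (a.2.trans b.2.symm)⟩) y hy y rfl hy (Equiv.refl _)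
    (fun _ => rfl)
  refine (congrArg (P.transport e) this).trans ?_
  refine (P.transport_trans _ _ _).trans ?_
  exact P.transport_eq_self _ (fun a => Subtype.ext (he a)) _

theorem comp_assoc {n m k l : ℕ} (f : GammaHom P n m) (g : GammaHom P m k) (h : GammaHom P k l) :
    (f.comp g).comp h = f.comp (g.comp h) := by
  change GammaHom.mk _ _ _ = GammaHom.mk _ _ _
  congr 1
  funext y hy
  exact (P.glue_assoc (fiberSigma g.toFun h.toFun y)
    (fiberSigma f.toFun (fun x => h.toFun (g.toFun x)) y)
    (fun j => fiberSigma f.toFun g.toFun j.1)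
    (fiberSigma (fun x => g.toFun (f.toFun x)) h.toFun y) (fun _ _ _ => rfl)
    (h.dec y hy) (fun j => g.dec j.1 (h.ne_zero hy j))
    (fun j => f.dec j.1 ((g.comp h).ne_zero hy j))).symm

end GammaHom

end Gamma

/-- The category `Γ(P)`, with objects `[n] = {0,…,n}`. -/
structure Gamma (P : UnitaryOperad.{u}) where
  /-- the object `[n]` -/
  ob ::
  n : ℕ

noncomputable instance (P : UnitaryOperad.{u}) : Category.{u} (Gamma P) where
  Hom X Y := GammaHom P X.n Y.n
  id X := GammaHom.id X.n
  comp f g := GammaHom.comp f g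
  id_comp := GammaHom.id_comp
  comp_id := GammaHom.comp_id
  assoc := GammaHom.comp_assoc

section Omega

variable (P : UnitaryOperad.{u})

/-- A morphism `{1,…,n} → {1,…,m}` of `Ω(P)`: a surjection `f` with an element of
`P(|f⁻¹(y)|)` for every `y`. -/
structure OmegaHom (n m : ℕ) where
  toFun : Fin n → Fin m
  surj : Function.Surjective toFun
  dec : ∀ y : Fin m, P.on {x // toFun x = y}

variable {P}

namespace OmegaHom

theorem ext' {n m : ℕ} {f g : OmegaHom P n m} (h : ∀ x, f.toFun x = g.toFun x)
    (hd : ∀ y (e : {x // f.toFun x = y} ≃ {x // g.toFun x = y}), (∀ x, (e x).1 = x.1) →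
      P.transport e (f.dec y) = g.dec y) : f = g := by
  obtain ⟨f, f0, fd⟩ := f
  obtain ⟨g, g0, gd⟩ := g
  obtain rfl : f = g := funext h
  congr 1
  funext y
  have := hd y (Equiv.refl _) (fun _ => rfl)
  rwa [UnitaryOperad.transport_refl] at this

theorem transport_dec {n m : ℕ} (f : OmegaHom P n m) {Z : Type} [Finite Z] [LinearOrder Z]
    {y y' : Fin m} (h : y = y') (e : {x // f.toFun x = y} ≃ Z)
    (e' : {x // f.toFun x = y'} ≃ Z) (he : ∀ x hx hx', e ⟨x, hx⟩ = e' ⟨x, hx'⟩) :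
    P.transport e (f.dec y) = P.transport e' (f.dec y') := by
  subst h
  exact P.transport_congr _ _ (fun a => he a.1 a.2 a.2) _

theorem subsingleton_fiber_id {n : ℕ} (y : Fin n) : Subsingleton {x : Fin n // x = y} :=
  ⟨fun a b => Subtype.ext (a.2.trans b.2.symm)⟩

/-- The identity, decorated by `1 ∈ P(1)`. -/
noncomputable def id (n : ℕ) : OmegaHom P n n where
  toFun x := x
  surj := Function.surjective_id
  dec y := haveI := subsingleton_fiber_id y; P.pt {x : Fin n // x = y}

/-- The composite `g ∘ f`: the decoration at `i` is `γ(ω^g_i; ω^f_{j₁}, …, ω^f_{jₛ})`, where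
`g⁻¹(i) = {j₁ < … < jₛ}`, with its inputs permuted to the natural order of `(g ∘ f)⁻¹(i)`. -/
noncomputable def comp {n m k : ℕ} (f : OmegaHom P n m) (g : OmegaHom P m k) : OmegaHom P n k where
  toFun x := g.toFun (f.toFun x)
  surj := g.surj.comp f.surj
  dec i := P.glue (fiberSigma f.toFun g.toFun i) (g.dec i) (fun j => f.dec j.1)

theorem id_comp {n m : ℕ} (f : OmegaHom P n m) : (id n).comp f = f := by
  refine ext' (fun _ => rfl) (fun y e he => ?_)
  have : ∀ j : {b // f.toFun b = y}, Subsingleton {a // a = j.1} :=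
    fun j => subsingleton_fiber_id j.1
  refine (congrArg (P.transport e) (P.glue_pt_right (fiberSigma (fun x => x) f.toFun y)
    (Equiv.refl _) (fun j => ⟨j.1, rfl⟩) (fun _ => rfl) (f.dec y))).trans ?_
  refine (P.transport_trans _ _ _).trans ?_
  exact P.transport_eq_self _ (fun a => Subtype.ext (he a)) _

theorem comp_id {n m : ℕ} (f : OmegaHom P n m) : f.comp (id m) = f := by
  refine ext' (fun _ => rfl) (fun y e he => ?_)
  have := subsingleton_fiber_id y
  refine (congrArg (P.transport e) (P.glue_pt_left (fiberSigma f.toFun (fun x => x) y) ⟨y, rfl⟩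
    (Equiv.refl _) (fun _ => rfl) (fun j => f.dec j.1))).trans ?_
  refine (P.transport_trans _ _ _).trans ?_
  exact P.transport_eq_self _ (fun a => Subtype.ext (he a)) _

theorem comp_assoc {n m k l : ℕ} (f : OmegaHom P n m) (g : OmegaHom P m k) (h : OmegaHom P k l) :
    (f.comp g).comp h = f.comp (g.comp h) := by
  change OmegaHom.mk _ _ _ = OmegaHom.mk _ _ _
  congr 1
  funext y
  exact (P.glue_assoc (fiberSigma g.toFun h.toFun y)
    (fiberSigma f.toFun (fun x => h.toFun (g.toFun x)) y)
    (fun j => fiberSigma f.toFun g.toFun j.1)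
    (fiberSigma (fun x => g.toFun (f.toFun x)) h.toFun y) (fun _ _ _ => rfl)
    (h.dec y) (fun j => g.dec j.1) (fun j => f.dec j.1)).symm

end OmegaHom

end Omega

/-- The category `Ω(P)`, with objects `{1,…,n}`. -/
structure Omega (P : UnitaryOperad.{u}) where
  /-- the object `{1,…,n}` -/
  ob ::
  n : ℕ

noncomputable instance (P : UnitaryOperad.{u}) : Category.{u} (Omega P) where
  Hom X Y := OmegaHom P X.n Y.n
  id X := OmegaHom.id X.n
  comp f g := OmegaHom.comp f g
  id_comp := OmegaHom.id_comp
  comp_id := OmegaHom.comp_id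
  assoc := OmegaHom.comp_assoc

/-! ### Functoriality in the operad -/

section Functoriality

variable {P : UnitaryOperad.{u}} {Q : UnitaryOperad.{w}} (φ : OperadHom P Q)

/-- The functor `Γ(φ) : Γ(P) ⥤ Γ(Q)`. -/
noncomputable def gammaMap : Gamma P ⥤ Gamma Q where
  obj X := Gamma.ob X.n
  map {X Y} f := (GammaHom.mk (GammaHom.toFun f) (GammaHom.map_zero f)
    (fun y hy => φ.app (GammaHom.dec f y hy)) : GammaHom Q X.n Y.n)
  map_id X := by
    change GammaHom.mk _ _ _ = GammaHom.mk _ _ _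
    congr 1
    funext y hy
    exact @OperadHom.app_pt _ _ φ {x : Fin (X.n + 1) // x = y} _ _
  map_comp f g := by
    change GammaHom.mk _ _ _ = GammaHom.mk _ _ _
    congr 1
    funext y hy
    exact φ.app_glue (fiberSigma (GammaHom.toFun f) (GammaHom.toFun g) y) (GammaHom.dec g y hy)
      (fun j => GammaHom.dec f j.1 (GammaHom.ne_zero g hy j))

/-- The functor `Ω(φ) : Ω(P) ⥤ Ω(Q)`. -/
noncomputable def omegaMap : Omega P ⥤ Omega Q where
  obj X := Omega.ob X.n
  map {X Y} f := (OmegaHom.mk (OmegaHom.toFun f) (OmegaHom.surj f)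
    (fun y => φ.app (OmegaHom.dec f y)) : OmegaHom Q X.n Y.n)
  map_id X := by
    change OmegaHom.mk _ _ _ = OmegaHom.mk _ _ _
    congr 1
    funext y
    exact @OperadHom.app_pt _ _ φ {x : Fin X.n // x = y} _ _
  map_comp f g := by
    change OmegaHom.mk _ _ _ = OmegaHom.mk _ _ _
    congr 1
    funext y
    exact φ.app_glue (fiberSigma (OmegaHom.toFun f) (OmegaHom.toFun g) y) (OmegaHom.dec g y)
      (fun j => OmegaHom.dec f j.1)

end Functoriality

/-! ### Adding a base point, inclusions, retractions and restrictions -/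

section Plus

variable {P : UnitaryOperad.{u}}

theorem GammaHom.dec_of_eq {n m : ℕ} {f g : GammaHom P n m} (h : f = g) {y : Fin (m + 1)}
    (hy : y ≠ 0) (e : {x // f.toFun x = y} ≃ {x // g.toFun x = y}) (he : ∀ x, (e x).1 = x.1) :
    P.transport e (f.dec y hy) = g.dec y hy := by
  subst h
  exact P.transport_eq_self _ (fun a => Subtype.ext (he a)) _

/-- The extension `f₊ : {0,…,n} → {0,…,m}` of a map `f : {1,…,n} → {1,…,m}`. -/
def plusFun {n m : ℕ} (f : Fin n → Fin m) : Fin (n + 1) → Fin (m + 1) :=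
  Fin.cases 0 (fun a => (f a).succ)

theorem plusFun_succ {n m : ℕ} (f : Fin n → Fin m) (a : Fin n) :
    plusFun f a.succ = (f a).succ := rfl

/-- The identification `f⁻¹(y) = f₊⁻¹(y)` for `y ≠ 0`. -/
noncomputable def plusFiber {n m : ℕ} (f : Fin n → Fin m) (y : Fin (m + 1)) (hy : y ≠ 0) :
    {a // f a = y.pred hy} ≃ {x // plusFun f x = y} :=
  Equiv.ofBijective
    (fun a => ⟨a.1.succ, by rw [plusFun_succ, a.2, Fin.succ_pred]⟩)
    ⟨fun a b h => Subtype.ext (Fin.succ_injective _ (congrArg Subtype.val h)), by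
      rintro ⟨x, hx⟩
      induction x using Fin.cases with
      | zero => exact absurd hx.symm hy
      | succ a =>
        refine ⟨⟨a, ?_⟩, rfl⟩
        subst hx
        simp [plusFun_succ]⟩

/-- The identification `f⁻¹(y) = f₊⁻¹(y)` for `y ≠ 0`. -/
noncomputable def succFiber {n m : ℕ} (f : Fin n → Fin m) (y : Fin m) :
    {a // f a = y} ≃ {x // plusFun f x = y.succ} :=
  Equiv.ofBijective
    (fun a => ⟨a.1.succ, by rw [plusFun_succ, a.2]⟩)
    ⟨fun a b h => Subtype.ext (Fin.succ_injective _ (congrArg Subtype.val h)), by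
      rintro ⟨x, hx⟩
      induction x using Fin.cases with
      | zero => exact absurd hx.symm (Fin.succ_ne_zero _)
      | succ a => exact ⟨⟨a, Fin.succ_injective _ hx⟩, rfl⟩⟩

/-- The extension `(f₊, ω^{f₊}) : [n] → [m]` of a morphism `(f, ω^f)` of `Ω(P)`. -/
noncomputable def OmegaHom.plus {n m : ℕ} (f : OmegaHom P n m) : GammaHom P n m where
  toFun := plusFun f.toFun
  map_zero := rfl
  dec y hy := P.transport (plusFiber f.toFun y hy) (f.dec (y.pred hy))

theorem OmegaHom.plus_id (n : ℕ) : (OmegaHom.id n : OmegaHom P n n).plus = GammaHom.id n := by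
  refine GammaHom.ext' (fun x => ?_) (fun y hy e he => ?_)
  · induction x using Fin.cases with
    | zero => rfl
    | succ a => rfl
  · have := OmegaHom.subsingleton_fiber_id (y.pred hy)
    have : Subsingleton {x : Fin (n + 1) // x = y} := OmegaHom.subsingleton_fiber_id y
    have : Subsingleton {x : Fin (n + 1) // plusFun (fun x : Fin n => x) x = y} :=
      (plusFiber (fun x : Fin n => x) y hy).symm.injective.subsingleton
    have key := P.transport_pt (plusFiber (fun x : Fin n => x) y hy)
    refine (congrArg (P.transport e) key).trans ?_
    exact P.transport_pt (X := {x : Fin (n + 1) // plusFun (fun x : Fin n => x) x = y})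
      (Y := {x : Fin (n + 1) // x = y}) e

theorem OmegaHom.plus_comp {n m k : ℕ} (f : OmegaHom P n m) (g : OmegaHom P m k) :
    (f.comp g).plus = f.plus.comp g.plus := by
  refine GammaHom.ext' (fun x => ?_) (fun y hy e he => ?_)
  · induction x using Fin.cases with
    | zero => rfl
    | succ a => rfl
  · have h1 := P.transport_glue (fiberSigma f.toFun g.toFun (y.pred hy))
      (plusFiber (fun x => g.toFun (f.toFun x)) y hy) (g.dec (y.pred hy)) (fun j => f.dec j.1)
    have h2 := P.transport_glue ((fiberSigma f.toFun g.toFun (y.pred hy)).trans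
      (plusFiber (fun x => g.toFun (f.toFun x)) y hy)) e (g.dec (y.pred hy)) (fun j => f.dec j.1)
    have h3 := P.glue_transport_left
      (fiberSigma (plusFun f.toFun) (plusFun g.toFun) y) (plusFiber g.toFun y hy)
      (g.dec (y.pred hy)) (fun j => f.plus.dec j.1 (g.plus.ne_zero hy j))
    have h4 : ∀ j : {b // g.toFun b = y.pred hy},
        f.plus.dec (plusFiber g.toFun y hy j).1 (g.plus.ne_zero hy (plusFiber g.toFun y hy j)) =
        P.transport (Y := {x // plusFun f.toFun x = (plusFiber g.toFun y hy j).1})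
          (succFiber f.toFun j.1) (f.dec j.1) := by
      intro j
      refine OmegaHom.transport_dec f ?_ _ _ (fun x hx hx' => rfl)
      exact Fin.pred_succ _
    have h5 := P.glue_transport_right
      ((Equiv.sigmaCongrLeft (β := fun j => {x // plusFun f.toFun x = j.1})
        (plusFiber g.toFun y hy)).trans (fiberSigma (plusFun f.toFun) (plusFun g.toFun) y))
      (fun j => succFiber f.toFun j.1) (g.dec (y.pred hy)) (fun j => f.dec j.1)
    refine (congrArg (P.transport e) h1).trans (h2.trans ?_)
    refine Eq.trans ?_ (h3.trans ((congrArg _ (funext h4)).trans h5)).symm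
    refine congrArg (fun t => P.glue t _ _) (Equiv.ext ?_)
    rintro ⟨j, a⟩
    exact Subtype.ext (he _)

/-- The functor `Ω(P) ⥤ Γ(P)`, `(f, ω^f) ↦ (f₊, ω^{f₊})`. -/
noncomputable def plus (P : UnitaryOperad.{u}) : Omega P ⥤ Gamma P where
  obj X := Gamma.ob X.n
  map f := OmegaHom.plus f
  map_id X := OmegaHom.plus_id X.n
  map_comp f g := OmegaHom.plus_comp f g

theorem OmegaHom.plus_dec_succ {n m : ℕ} (f : OmegaHom P n m) (y : Fin m) :
    f.plus.dec y.succ (Fin.succ_ne_zero y) = P.transport (succFiber f.toFun y) (f.dec y) :=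
  OmegaHom.transport_dec f (Fin.pred_succ y) _ _ (fun _ _ _ => rfl)

theorem OmegaHom.plus_injective {n m : ℕ} {f g : OmegaHom P n m} (h : f.plus = g.plus) :
    f = g := by
  have h0 : ∀ x, f.toFun x = g.toFun x := fun x => by
    have := congrFun (congrArg GammaHom.toFun h) x.succ
    exact Fin.succ_injective _ this
  refine OmegaHom.ext' h0 (fun y e he => ?_)
  let E : {x // plusFun f.toFun x = y.succ} ≃ {x // plusFun g.toFun x = y.succ} :=
    Equiv.subtypeEquivRight (fun x => by rw [show f.toFun = g.toFun from funext h0])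
  have h1 := GammaHom.dec_of_eq h (Fin.succ_ne_zero y) E (fun _ => rfl)
  rw [g.plus_dec_succ] at h1
  have h2 : P.transport E (f.plus.dec y.succ (Fin.succ_ne_zero y)) =
      P.transport E (P.transport (succFiber f.toFun y) (f.dec y)) :=
    congrArg (P.transport E) (f.plus_dec_succ y)
  rw [UnitaryOperad.transport_trans] at h2
  have h3 := congrArg (P.transport (succFiber g.toFun y).symm) (h2.symm.trans h1)
  rw [UnitaryOperad.transport_trans, UnitaryOperad.transport_trans] at h3
  refine Eq.trans ?_ (h3.trans (P.transport_eq_self _ (fun a => by simp) _))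
  refine P.transport_congr _ _ (fun a => ?_) _
  apply (succFiber g.toFun y).injective
  apply Subtype.ext
  simp only [Equiv.trans_apply, Equiv.apply_symm_apply]
  exact congrArg Fin.succ (he a)

end Plus

section Restriction

variable {P : UnitaryOperad.{u}}

/-- The `k`-th element of a subset `μ ⊂ {1,…,n}`. -/
def emb {n : ℕ} (μ : Finset (Fin n)) : Fin μ.card → Fin n := μ.orderEmbOfFin rfl

theorem emb_mem {n : ℕ} (μ : Finset (Fin n)) (k : Fin μ.card) : emb μ k ∈ μ :=
  μ.orderEmbOfFin_mem rfl k

theorem emb_injective {n : ℕ} (μ : Finset (Fin n)) : Function.Injective (emb μ) :=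
  (μ.orderEmbOfFin rfl).injective

theorem exists_emb {n : ℕ} {μ : Finset (Fin n)} {a : Fin n} (ha : a ∈ μ) : ∃ k, emb μ k = a := by
  have : a ∈ Set.range (μ.orderEmbOfFin rfl) := by rw [Finset.range_orderEmbOfFin]; exact ha
  exact this

theorem plusFun_fiber {n m : ℕ} {f : Fin n → Fin m} (hf : Function.Injective f)
    (y : Fin (m + 1)) (hy : y ≠ 0) : Subsingleton {x // plusFun f x = y} := by
  refine ⟨?_⟩
  rintro ⟨x, hx⟩ ⟨x', hx'⟩
  induction x using Fin.cases with
  | zero => exact absurd hx.symm hy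
  | succ a =>
    induction x' using Fin.cases with
    | zero => exact absurd hx'.symm hy
    | succ a' =>
      have h : (f a).succ = (f a').succ := hx.trans hx'.symm
      exact Subtype.ext (congrArg Fin.succ (hf (Fin.succ_injective _ h)))

/-- The inclusion `[|μ|] → [n]` given by a subset `μ ⊂ {1,…,n}`. -/
noncomputable def GammaHom.incl {n : ℕ} (μ : Finset (Fin n)) : GammaHom P μ.card n :=
  GammaHom.ofInj (plusFun (emb μ)) rfl (plusFun_fiber (emb_injective μ))

/-- The map `{0,…,n} → {0,…,|μ|}` sending the `k`-th element of `μ` to `k`, and everything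
else to `0`. -/
noncomputable def retrFun {n : ℕ} (μ : Finset (Fin n)) : Fin (n + 1) → Fin (μ.card + 1) :=
  Fin.cases 0 (fun a => if h : a ∈ μ then ((μ.orderIsoOfFin rfl).symm ⟨a, h⟩).succ else 0)

theorem retrFun_succ {n : ℕ} (μ : Finset (Fin n)) (a : Fin n) : retrFun μ a.succ =
    if h : a ∈ μ then ((μ.orderIsoOfFin rfl).symm ⟨a, h⟩).succ else 0 := rfl

theorem retrFun_emb {n : ℕ} (μ : Finset (Fin n)) (k : Fin μ.card) :
    retrFun μ (emb μ k).succ = k.succ := by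
  rw [retrFun_succ, dif_pos (emb_mem μ k)]
  congr 1
  rw [OrderIso.symm_apply_eq]
  rfl

theorem retrFun_notMem {n : ℕ} {μ : Finset (Fin n)} {a : Fin n} (ha : a ∉ μ) :
    retrFun μ a.succ = 0 := by
  rw [retrFun_succ, dif_neg ha]

theorem plusFun_retrFun {n : ℕ} (μ : Finset (Fin n)) (a : Fin n) :
    plusFun (emb μ) (retrFun μ a.succ) = if a ∈ μ then a.succ else 0 := by
  by_cases ha : a ∈ μ
  · obtain ⟨k, rfl⟩ := exists_emb ha
    rw [retrFun_emb, if_pos ha]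
    rfl
  · rw [retrFun_notMem ha, if_neg ha]
    rfl

/-- The retraction `[n] → [|μ|]` of `GammaHom.incl μ` sending the complement of `μ` to `0`. -/
noncomputable def GammaHom.retr {n : ℕ} (μ : Finset (Fin n)) : GammaHom P n μ.card :=
  GammaHom.ofInj (retrFun μ) rfl (by
    intro y hy
    refine ⟨?_⟩
    rintro ⟨x, hx⟩ ⟨x', hx'⟩
    induction x using Fin.cases with
    | zero => exact absurd hx.symm hy
    | succ a =>
      induction x' using Fin.cases with
      | zero => exact absurd hx'.symm hy
      | succ a' =>
        have h := plusFun_retrFun μ a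
        have h' := plusFun_retrFun μ a'
        have h0 : plusFun (emb μ) y ≠ 0 := by
          induction y using Fin.cases with
          | zero => exact absurd rfl hy
          | succ b => exact Fin.succ_ne_zero _
        rw [hx] at h
        rw [hx'] at h'
        apply Subtype.ext
        change a.succ = a'.succ
        split_ifs at h h'
        · rw [← h, ← h']
        · exact absurd h' h0
        · exact absurd h h0
        · exact absurd h h0)

theorem GammaHom.incl_comp_retr {n : ℕ} (μ : Finset (Fin n)) :
    (GammaHom.incl μ : GammaHom P μ.card n).comp (GammaHom.retr μ) = GammaHom.id μ.card := by
  refine GammaHom.ofInj_comp_ofInj _ _ _ _ _ _ _ _ _ (fun x => ?_)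
  induction x using Fin.cases with
  | zero => rfl
  | succ k => exact (retrFun_emb μ k).symm

/-- The map `{0,…,n} → {0,…,n}` which is the identity on `μ` and sends everything else
to `0`. -/
def idemFun {n : ℕ} (μ : Finset (Fin n)) : Fin (n + 1) → Fin (n + 1) :=
  Fin.cases 0 (fun a => if a ∈ μ then a.succ else 0)

theorem idemFun_fiber {n : ℕ} (μ : Finset (Fin n)) (y : Fin (n + 1)) (hy : y ≠ 0) :
    Subsingleton {x // idemFun μ x = y} := by
  refine ⟨?_⟩
  rintro ⟨x, hx⟩ ⟨x', hx'⟩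
  induction x using Fin.cases with
  | zero => exact absurd hx.symm hy
  | succ a =>
    induction x' using Fin.cases with
    | zero => exact absurd hx'.symm hy
    | succ a' =>
      apply Subtype.ext
      change ite _ _ _ = _ at hx
      change ite _ _ _ = _ at hx'
      change a.succ = a'.succ
      split_ifs at hx hx'
      · rw [hx, hx']
      · exact absurd hx'.symm hy
      · exact absurd hx.symm hy
      · exact absurd hx.symm hy

/-- The idempotent endomorphism of `[n]` which is the identity on `μ` and sends everything else
to `0`. -/
noncomputable def GammaHom.idem {n : ℕ} (μ : Finset (Fin n)) : GammaHom P n n :=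
  GammaHom.ofInj (idemFun μ) rfl (idemFun_fiber μ)

theorem GammaHom.retr_comp_incl {n : ℕ} (μ : Finset (Fin n)) :
    (GammaHom.retr μ : GammaHom P n μ.card).comp (GammaHom.incl μ) = GammaHom.idem μ := by
  refine GammaHom.ofInj_comp_ofInj _ _ _ _ _ _ _ _ _ (fun x => ?_)
  induction x using Fin.cases with
  | zero => rfl
  | succ a => exact (plusFun_retrFun μ a).symm

theorem GammaHom.idem_comp_idem {n : ℕ} (μ ν : Finset (Fin n)) :
    (GammaHom.idem μ : GammaHom P n n).comp (GammaHom.idem ν) = GammaHom.idem (μ ∩ ν) := by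
  refine GammaHom.ofInj_comp_ofInj _ _ _ _ _ _ _ _ _ (fun x => ?_)
  induction x using Fin.cases with
  | zero => rfl
  | succ a =>
    change ite _ _ _ = idemFun ν (ite _ _ _)
    by_cases h : a ∈ μ
    · rw [if_pos h]
      change _ = ite _ _ _
      simp [h]
    · rw [if_neg h, if_neg (by simp [h])]
      rfl

theorem GammaHom.idem_univ (n : ℕ) : (GammaHom.idem Finset.univ : GammaHom P n n) =
    GammaHom.id n := by
  refine GammaHom.ext' (fun x => ?_) (fun y hy e he => ?_)
  · induction x using Fin.cases with
    | zero => rfl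
    | succ a => exact if_pos (Finset.mem_univ a)
  · have := idemFun_fiber Finset.univ y hy
    have : Subsingleton {x : Fin (n + 1) // x = y} := OmegaHom.subsingleton_fiber_id y
    exact P.transport_pt (X := {x // idemFun Finset.univ x = y})
      (Y := {x : Fin (n + 1) // x = y}) e

/-- A morphism which sends the complement of `μ` to `0` factors through the idempotent of `μ`. -/
theorem GammaHom.idem_comp {n m : ℕ} (μ : Finset (Fin n)) (f : GammaHom P n m)
    (hf : ∀ a, a ∉ μ → f.toFun a.succ = 0) : (GammaHom.idem μ).comp f = f := by
  have h0 : ∀ x, f.toFun (idemFun μ x) = f.toFun x := by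
    intro x
    induction x using Fin.cases with
    | zero => rfl
    | succ a =>
      change f.toFun (ite _ _ _) = _
      by_cases h : a ∈ μ
      · rw [if_pos h]
      · rw [if_neg h, hf a h, f.map_zero]
  refine GammaHom.ext' h0 (fun y hy e he => ?_)
  have key := GammaHom.ofInj_comp_dec (idemFun μ) rfl (idemFun_fiber μ) f y hy
    (Equiv.subtypeEquivRight (fun x => by rw [h0])) (by
      rintro ⟨x, hx⟩
      change idemFun μ x = x
      induction x using Fin.cases with
      | zero => rfl
      | succ a =>
        change ite _ _ _ = _
        by_cases h : a ∈ μ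
        · rw [if_pos h]
        · exact absurd (hx.symm.trans (hf a h)) hy)
  refine (congrArg (P.transport e) key).trans ?_
  refine (P.transport_trans _ _ _).trans ?_
  exact P.transport_eq_self _ (fun a => Subtype.ext (he _)) _

/-- `g(μ) = ν`, for subsets `μ ⊂ {1,…,n}` and `ν ⊂ {1,…,m}`; in particular `0 ∉ g(μ)`. -/
def GammaHom.IsImage {n m : ℕ} (g : GammaHom P n m) (μ : Finset (Fin n)) (ν : Finset (Fin m)) :
    Prop :=
  g.toFun '' (Fin.succ '' (μ : Set (Fin n))) = Fin.succ '' (ν : Set (Fin m))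

section

variable {n m : ℕ} {g : GammaHom P n m} {μ : Finset (Fin n)} {ν : Finset (Fin m)}

theorem GammaHom.IsImage.exists (h : g.IsImage μ ν) (k : Fin μ.card) :
    ∃ l : Fin ν.card, g.toFun (emb μ k).succ = (emb ν l).succ := by
  have : g.toFun (emb μ k).succ ∈ Fin.succ '' (ν : Set (Fin m)) := by
    rw [← h]
    exact ⟨_, ⟨_, emb_mem μ k, rfl⟩, rfl⟩
  obtain ⟨b, hb, hb'⟩ := this
  obtain ⟨l, rfl⟩ := exists_emb hb
  exact ⟨l, hb'.symm⟩

theorem GammaHom.IsImage.exists' (h : g.IsImage μ ν) (l : Fin ν.card) :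
    ∃ k : Fin μ.card, g.toFun (emb μ k).succ = (emb ν l).succ := by
  have : (emb ν l).succ ∈ g.toFun '' (Fin.succ '' (μ : Set (Fin n))) := by
    rw [h]
    exact ⟨_, emb_mem ν l, rfl⟩
  obtain ⟨_, ⟨a, ha, rfl⟩, hb'⟩ := this
  obtain ⟨k, rfl⟩ := exists_emb ha
  exact ⟨k, hb'⟩

/-- The map underlying the restriction of `g` to `μ → ν`. -/
noncomputable def restrictFun (h : g.IsImage μ ν) (k : Fin μ.card) : Fin ν.card :=
  (h.exists k).choose

theorem restrictFun_spec (h : g.IsImage μ ν) (k : Fin μ.card) :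
    g.toFun (emb μ k).succ = (emb ν (restrictFun h k)).succ :=
  (h.exists k).choose_spec

theorem restrictFun_eq_iff (h : g.IsImage μ ν) (k : Fin μ.card) (l : Fin ν.card) :
    restrictFun h k = l ↔ g.toFun (emb μ k).succ = (emb ν l).succ := by
  rw [restrictFun_spec h k]
  constructor
  · intro h; rw [h]
  · intro h
    exact emb_injective ν (Fin.succ_injective _ h)

/-- The fibres of `g|_μ`, as fibres of the composite of the inclusion of `μ` with `g`. -/
noncomputable def restrictFiber (h : g.IsImage μ ν) (l : Fin ν.card) :
    {k // restrictFun h k = l} ≃ {x // g.toFun (plusFun (emb μ) x) = (emb ν l).succ} :=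
  Equiv.ofBijective (fun k => ⟨k.1.succ, (restrictFun_eq_iff h k.1 l).1 k.2⟩)
    ⟨fun a b h => Subtype.ext (Fin.succ_injective _ (congrArg Subtype.val h)), by
      rintro ⟨x, hx⟩
      induction x using Fin.cases with
      | zero =>
        have h0 : g.toFun (plusFun (emb μ) 0) = 0 := g.map_zero
        exact absurd (h0.symm.trans hx).symm (Fin.succ_ne_zero _)
      | succ a => exact ⟨⟨a, (restrictFun_eq_iff h a l).2 hx⟩, rfl⟩⟩

/-- The restriction `(g|_μ, ω^{g|_μ})` of a morphism `(g, ω^g) : [n] → [m]` to a subset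
`μ ⊂ {1,…,n}` with `g(μ) = ν ⊂ {1,…,m}`, as a morphism of `Ω(P)` between the sets
`{1,…,|μ|} ≅ μ` and `{1,…,|ν|} ≅ ν`. -/
noncomputable def GammaHom.restrict (g : GammaHom P n m) (μ : Finset (Fin n)) (ν : Finset (Fin m))
    (h : g.IsImage μ ν) : OmegaHom P μ.card ν.card where
  toFun := restrictFun h
  surj l := by
    obtain ⟨k, hk⟩ := h.exists' l
    exact ⟨k, (restrictFun_eq_iff h k l).2 hk⟩
  dec l := P.transport (restrictFiber h l).symm
    (((GammaHom.incl μ).comp g).dec (emb ν l).succ (Fin.succ_ne_zero _))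

theorem restrict_spec (h : g.IsImage μ ν) :
    (g.restrict μ ν h).plus.comp (GammaHom.incl ν) = (GammaHom.incl μ).comp g := by
  have h0 : ∀ x, plusFun (emb ν) (plusFun (restrictFun h) x) = g.toFun (plusFun (emb μ) x) := by
    intro x
    induction x using Fin.cases with
    | zero => exact g.map_zero.symm
    | succ k => exact (restrictFun_spec h k).symm
  refine GammaHom.ext' h0 (fun y hy e he => ?_)
  induction y using Fin.cases with
  | zero => exact absurd rfl hy
  | succ b =>
  by_cases hb : b ∈ ν
  · obtain ⟨l, rfl⟩ := exists_emb hb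
    let E : {x // plusFun (restrictFun h) x = l.succ} ≃
        {x // plusFun (emb ν) (plusFun (restrictFun h) x) = (emb ν l).succ} :=
      (succFiber (restrictFun h) l).symm.trans ((restrictFiber h l).trans e.symm)
    have hE : ∀ x, (E x).1 = x.1 := by
      intro x
      obtain ⟨k, rfl⟩ := (succFiber (restrictFun h) l).surjective x
      have h1 := (congrArg Subtype.val (e.apply_symm_apply (restrictFiber h l k))).symm.trans
        (he (e.symm (restrictFiber h l k)))
      have h2 : E (succFiber (restrictFun h) l k) = e.symm (restrictFiber h l k) := by
        change e.symm (restrictFiber h l ((succFiber (restrictFun h) l).symm _)) = _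
        rw [Equiv.symm_apply_apply]
      rw [h2]
      exact h1.symm
    have key := GammaHom.comp_ofInj_dec (g.restrict μ ν h).plus (plusFun (emb ν)) rfl
      (plusFun_fiber (emb_injective ν)) (emb ν l).succ hy l.succ rfl (Fin.succ_ne_zero _) E hE
    refine (congrArg (P.transport e) key).trans ?_
    refine (congrArg (fun t => P.transport e (P.transport E t))
      (OmegaHom.plus_dec_succ (g.restrict μ ν h) l)).trans ?_
    refine (congrArg (P.transport e) (P.transport_trans (succFiber (restrictFun h) l) E _)).trans ?_
    refine (P.transport_trans _ _ _).trans ?_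
    refine (P.transport_trans (restrictFiber h l).symm _ _).trans ?_
    refine P.transport_eq_self _ (fun a => ?_) _
    obtain ⟨k, rfl⟩ := (restrictFiber h l).surjective a
    change e (e.symm (restrictFiber h l ((succFiber (restrictFun h) l).symm (succFiber
      (restrictFun h) l ((restrictFiber h l).symm (restrictFiber h l k)))))) = _
    rw [Equiv.symm_apply_apply, Equiv.symm_apply_apply]
    exact e.apply_symm_apply (restrictFiber h l k)
  · have : IsEmpty {x // g.toFun (plusFun (emb μ) x) = b.succ} := by
      refine ⟨?_⟩
      rintro ⟨x, hx⟩
      rw [← h0] at hx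
      revert hx
      generalize plusFun (restrictFun h) x = z
      intro hx
      induction z using Fin.cases with
      | zero => exact absurd hx.symm hy
      | succ l =>
        have := Fin.succ_injective _ hx
        exact hb (this ▸ emb_mem ν l)
    exact P.eq_of_isEmpty (X := {x // g.toFun (plusFun (emb μ) x) = b.succ}) _ _

theorem restrict_unique (h : g.IsImage μ ν) (f : OmegaHom P μ.card ν.card)
    (hf : f.plus.comp (GammaHom.incl ν) = (GammaHom.incl μ).comp g) : f = g.restrict μ ν h := by
  apply OmegaHom.plus_injective
  have h1 := congrArg (fun t => GammaHom.comp t (GammaHom.retr ν)) (hf.trans (restrict_spec h).symm)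
  simp only [GammaHom.comp_assoc, GammaHom.incl_comp_retr, GammaHom.comp_id] at h1
  exact h1

end

theorem isImage_id {n : ℕ} (μ ν : Finset (Fin n)) :
    (GammaHom.id n : GammaHom P n n).IsImage μ ν ↔ μ = ν := by
  have : (GammaHom.id n : GammaHom P n n).toFun = fun x => x := rfl
  rw [GammaHom.IsImage, this, Set.image_id', Set.image_eq_image (Fin.succ_injective n),
    Finset.coe_inj]

theorem restrict_id {n : ℕ} (μ : Finset (Fin n)) (h) :
    (GammaHom.id n : GammaHom P n n).restrict μ μ h = OmegaHom.id μ.card := by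
  symm
  apply restrict_unique
  rw [OmegaHom.plus_id, GammaHom.id_comp, GammaHom.comp_id]

theorem GammaHom.IsImage.comp {n m k : ℕ} {f : GammaHom P n m} {g : GammaHom P m k}
    {μ : Finset (Fin n)} {ν : Finset (Fin m)} {ρ : Finset (Fin k)}
    (hf : f.IsImage μ ν) (hg : g.IsImage ν ρ) : (f.comp g).IsImage μ ρ := by
  rw [GammaHom.IsImage] at hf hg ⊢
  rw [← hg, ← hf, Set.image_image g.toFun f.toFun]
  rfl

theorem GammaHom.IsImage.unique {n m : ℕ} {f : GammaHom P n m}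
    {μ : Finset (Fin n)} {ν ν' : Finset (Fin m)} (h : f.IsImage μ ν) (h' : f.IsImage μ ν') :
    ν = ν' := by
  rw [GammaHom.IsImage] at h h'
  rw [h] at h'
  exact_mod_cast (Set.image_eq_image (Fin.succ_injective m)).1 h'

theorem exists_isImage {n m : ℕ} (f : GammaHom P n m) (μ : Finset (Fin n))
    (h : ∀ a ∈ μ, f.toFun a.succ ≠ 0) : ∃ ν, f.IsImage μ ν := by
  classical
  refine ⟨Finset.univ.filter (fun b => ∃ a ∈ μ, f.toFun a.succ = b.succ), ?_⟩
  ext y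
  constructor
  · rintro ⟨_, ⟨a, ha, rfl⟩, rfl⟩
    obtain ⟨b, hb⟩ := Fin.exists_succ_eq.2 (h a ha)
    exact ⟨b, by simpa using ⟨a, ha, hb.symm⟩, hb⟩
  · rintro ⟨b, hb, rfl⟩
    obtain ⟨a, ha, hab⟩ : ∃ a ∈ μ, f.toFun a.succ = b.succ := by simpa using hb
    exact ⟨_, ⟨a, ha, rfl⟩, hab⟩

theorem GammaHom.IsImage.ne_zero {n m : ℕ} {f : GammaHom P n m}
    {μ : Finset (Fin n)} {ν : Finset (Fin m)} (h : f.IsImage μ ν) (a : Fin n) (ha : a ∈ μ) :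
    f.toFun a.succ ≠ 0 := by
  have : f.toFun a.succ ∈ Fin.succ '' (ν : Set (Fin m)) := by
    rw [← h]
    exact ⟨_, ⟨_, ha, rfl⟩, rfl⟩
  obtain ⟨b, -, hb⟩ := this
  rw [← hb]
  exact Fin.succ_ne_zero b

/-- If `g(f(μ)) = ρ`, then `f(μ)` is defined, and its image under `g` is `ρ`. -/
theorem GammaHom.IsImage.of_comp {n m k : ℕ} {f : GammaHom P n m} {g : GammaHom P m k}
    {μ : Finset (Fin n)} {ρ : Finset (Fin k)} (h : (f.comp g).IsImage μ ρ) :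
    ∃ ν, f.IsImage μ ν ∧ g.IsImage ν ρ := by
  obtain ⟨ν, hν⟩ := exists_isImage f μ (fun a ha h0 => h.ne_zero a ha (by
    change g.toFun (f.toFun a.succ) = 0
    rw [h0, g.map_zero]))
  refine ⟨ν, hν, ?_⟩
  have h' := h
  rw [GammaHom.IsImage] at hν h' ⊢
  rw [← hν, ← h', Set.image_image g.toFun f.toFun]
  rfl

theorem restrict_comp {n m k : ℕ} {f : GammaHom P n m} {g : GammaHom P m k}
    {μ : Finset (Fin n)} {ν : Finset (Fin m)} {ρ : Finset (Fin k)}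
    (hf : f.IsImage μ ν) (hg : g.IsImage ν ρ) (h : (f.comp g).IsImage μ ρ) :
    (f.comp g).restrict μ ρ h = (f.restrict μ ν hf).comp (g.restrict ν ρ hg) := by
  symm
  apply restrict_unique
  rw [OmegaHom.plus_comp, GammaHom.comp_assoc, restrict_spec, ← GammaHom.comp_assoc,
    restrict_spec, GammaHom.comp_assoc]

end Restriction

/-! ### The functors `cr` and `i_!` -/

section Covariant

variable {P : UnitaryOperad.{u}}

/-- `F(r) x`, for the morphism `r : [n] → [m]` of `Γ(P)`. -/
noncomputable abbrev ev (F : Gamma P ⥤ AddCommGrpCat.{v}) {n m : ℕ} (f : GammaHom P n m) :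
    F.obj (Gamma.ob n) →+ F.obj (Gamma.ob m) :=
  (F.map (X := Gamma.ob n) (Y := Gamma.ob m) f).hom

theorem ev_comp (F : Gamma P ⥤ AddCommGrpCat.{v}) {n m k : ℕ} (f : GammaHom P n m)
    (g : GammaHom P m k) (x) : ev F (f.comp g) x = ev F g (ev F f x) := by
  have := F.map_comp (X := Gamma.ob n) (Y := Gamma.ob m) (Z := Gamma.ob k) f g
  exact congrArg (fun t => t.hom x) this

theorem ev_id (F : Gamma P ⥤ AddCommGrpCat.{v}) {n : ℕ} (x) : ev F (GammaHom.id n) x = x :=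
  congrArg (fun t => t.hom x) (F.map_id (Gamma.ob n))

/-- The `n`-th cross-effect of `F` at `([1],…,[1])`, as a subgroup of `F([n])`: the intersection
of the kernels of the maps `F([n]) → F([n-1])` induced by the retractions which send `k` to `0`. -/
noncomputable def crSub (F : Gamma P ⥤ AddCommGrpCat.{v}) (n : ℕ) :
    AddSubgroup (F.obj (Gamma.ob n)) :=
  ⨅ k : Fin n, (ev F (GammaHom.retr (Finset.univ.erase k))).ker

theorem mem_crSub {F : Gamma P ⥤ AddCommGrpCat.{v}} {n : ℕ} {x : F.obj (Gamma.ob n)} :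
    x ∈ crSub F n ↔ ∀ k, ev F (GammaHom.retr (Finset.univ.erase k)) x = 0 := by
  simp only [crSub, AddSubgroup.mem_iInf, AddMonoidHom.mem_ker]

theorem ev_eq_zero {F : Gamma P ⥤ AddCommGrpCat.{v}} {n m : ℕ} {x : F.obj (Gamma.ob n)}
    (hx : x ∈ crSub F n) (f : GammaHom P n m) (a : Fin n) (ha : f.toFun a.succ = 0) :
    ev F f x = 0 := by
  have h := f.idem_comp (Finset.univ.erase a) (fun b hb => by
    have : b = a := by simpa using hb
    rw [this, ha])
  rw [← h, ← GammaHom.retr_comp_incl, ev_comp, ev_comp, mem_crSub.1 hx a, map_zero, map_zero]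

theorem ev_plus_mem {F : Gamma P ⥤ AddCommGrpCat.{v}} {n m : ℕ} (f : OmegaHom P n m)
    {x : F.obj (Gamma.ob n)} (hx : x ∈ crSub F n) : ev F f.plus x ∈ crSub F m := by
  rw [mem_crSub]
  intro l
  obtain ⟨a, ha⟩ := f.surj l
  rw [← ev_comp]
  refine ev_eq_zero hx _ a ?_
  change retrFun _ (f.toFun a).succ = 0
  rw [ha]
  exact retrFun_notMem (by simp)

/-- The map `cr(F)(f, ω^f)`: the restriction of `F(f₊, ω^{f₊})`. -/
noncomputable def crMap (F : Gamma P ⥤ AddCommGrpCat.{v}) {n m : ℕ} (f : OmegaHom P n m) :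
    crSub F n →+ crSub F m :=
  ((ev F f.plus).comp (crSub F n).subtype).codRestrict (crSub F m) (fun x => ev_plus_mem f x.2)

/-- The functor `cr : Func(Γ(P), Ab) ⥤ Func(Ω(P), Ab)`. -/
noncomputable def cr (P : UnitaryOperad.{u}) :
    (Gamma P ⥤ AddCommGrpCat.{v}) ⥤ (Omega P ⥤ AddCommGrpCat.{v}) where
  obj F :=
    { obj := fun X => AddCommGrpCat.of (crSub F X.n)
      map := fun {X Y} f => AddCommGrpCat.ofHom (crMap (n := X.n) (m := Y.n) F f)
      map_id := fun X => by
        ext x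
        change ev F (OmegaHom.id X.n).plus x.1 = x.1
        rw [OmegaHom.plus_id, ev_id]
      map_comp := fun {X Y Z} f g => by
        ext x
        change ev F (OmegaHom.comp f g).plus x.1 =
          ev F (OmegaHom.plus g) (ev F (OmegaHom.plus f) x.1)
        rw [OmegaHom.plus_comp, ev_comp] }
  map {F F'} τ :=
    { app := fun X => AddCommGrpCat.ofHom
        (((τ.app (Gamma.ob X.n)).hom.comp (crSub F X.n).subtype).codRestrict (crSub F' X.n)
          (fun x => by
            rw [mem_crSub]
            intro k
            have := τ.naturality (X := Gamma.ob X.n) (Y := Gamma.ob (Finset.univ.erase k).card)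
              (GammaHom.retr (Finset.univ.erase k))
            have h := congrArg (fun t => t.hom x.1) this
            have h0 := mem_crSub.1 x.2 k
            refine h.symm.trans ?_
            change (τ.app _).hom (ev F (GammaHom.retr (Finset.univ.erase k)) x.1) = 0
            rw [h0, map_zero]))
      naturality := fun X Y f => by
        ext x
        have := τ.naturality (X := Gamma.ob X.n) (Y := Gamma.ob Y.n) (OmegaHom.plus f)
        exact congrArg (fun t => t.hom x.1) this }
  map_id F := rfl
  map_comp τ τ' := rfl

/-- `G(f) x`, for the morphism `f : {1,…,n} → {1,…,m}` of `Ω(P)`. -/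
noncomputable abbrev evΩ (G : Omega P ⥤ AddCommGrpCat.{v}) {n m : ℕ} (f : OmegaHom P n m) :
    G.obj (Omega.ob n) →+ G.obj (Omega.ob m) :=
  (G.map (X := Omega.ob n) (Y := Omega.ob m) f).hom

theorem evΩ_comp (G : Omega P ⥤ AddCommGrpCat.{v}) {n m k : ℕ} (f : OmegaHom P n m)
    (g : OmegaHom P m k) (x) : evΩ G (f.comp g) x = evΩ G g (evΩ G f x) := by
  have := G.map_comp (X := Omega.ob n) (Y := Omega.ob m) (Z := Omega.ob k) f g
  exact congrArg (fun t => t.hom x) this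

theorem evΩ_id (G : Omega P ⥤ AddCommGrpCat.{v}) {n : ℕ} (x) : evΩ G (OmegaHom.id n) x = x :=
  congrArg (fun t => t.hom x) (G.map_id (Omega.ob n))

/-- The group `⨁_{μ ⊂ {1,…,n}} G(|μ|)`. -/
abbrev IShriek (G : Omega P ⥤ AddCommGrpCat.{v}) (n : ℕ) : Type v :=
  DirectSum (Finset (Fin n)) fun μ => G.obj (Omega.ob μ.card)

/-- The inclusion of the summand `G(|μ|)`. -/
abbrev IShriek.ι (G : Omega P ⥤ AddCommGrpCat.{v}) {n : ℕ} (μ : Finset (Fin n)) :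
    G.obj (Omega.ob μ.card) →+ IShriek G n :=
  DirectSum.of (fun μ : Finset (Fin n) => G.obj (Omega.ob μ.card)) μ

open Classical in
/-- The restriction of `i_!(G)(g, ω^g)` to the summand `G(|μ|)`: it is `G(g|_μ, ω^{g|_μ})`
followed by the inclusion of the summand indexed by `g(μ)`, and `0` if `0 ∈ g(μ)`. -/
noncomputable def iShriekComp (G : Omega P ⥤ AddCommGrpCat.{v}) {n m : ℕ} (g : GammaHom P n m)
    (μ : Finset (Fin n)) : G.obj (Omega.ob μ.card) →+ IShriek G m :=
  if h : ∃ ν, g.IsImage μ ν then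
    (IShriek.ι G h.choose).comp (evΩ G (g.restrict μ h.choose h.choose_spec))
  else 0

theorem iShriekComp_of (G : Omega P ⥤ AddCommGrpCat.{v}) {n m : ℕ} (g : GammaHom P n m)
    {μ : Finset (Fin n)} {ν : Finset (Fin m)} (h : g.IsImage μ ν) :
    iShriekComp G g μ = (IShriek.ι G ν).comp (evΩ G (g.restrict μ ν h)) := by
  have h' : ∃ ν, g.IsImage μ ν := ⟨ν, h⟩
  obtain rfl := h'.choose_spec.unique h
  rw [iShriekComp, dif_pos h']

theorem iShriekComp_zero (G : Omega P ⥤ AddCommGrpCat.{v}) {n m : ℕ} (g : GammaHom P n m)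
    {μ : Finset (Fin n)} (h : ¬ ∃ ν, g.IsImage μ ν) : iShriekComp G g μ = 0 := by
  rw [iShriekComp, dif_neg h]

/-- The map `i_!(G)(g, ω^g)`. -/
noncomputable def iShriekMap (G : Omega P ⥤ AddCommGrpCat.{v}) {n m : ℕ} (g : GammaHom P n m) :
    IShriek G n →+ IShriek G m :=
  DirectSum.toAddMonoid (iShriekComp G g)

theorem iShriekMap_ι (G : Omega P ⥤ AddCommGrpCat.{v}) {n m : ℕ} (g : GammaHom P n m)
    (μ : Finset (Fin n)) (x) : iShriekMap G g (IShriek.ι G μ x) = iShriekComp G g μ x :=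
  DirectSum.toAddMonoid_of _ _ _

/-- The functor `i_! : Func(Ω(P), Ab) ⥤ Func(Γ(P), Ab)`. -/
noncomputable def iShriek (P : UnitaryOperad.{u}) :
    (Omega P ⥤ AddCommGrpCat.{v}) ⥤ (Gamma P ⥤ AddCommGrpCat.{v}) where
  obj G :=
    { obj := fun X => AddCommGrpCat.of (IShriek G X.n)
      map := fun {X Y} g => AddCommGrpCat.ofHom (iShriekMap (n := X.n) (m := Y.n) G g)
      map_id := fun X => by
        apply AddCommGrpCat.hom_ext
        apply DirectSum.addHom_ext
        intro μ x
        change iShriekMap G (GammaHom.id X.n) (IShriek.ι G μ x) = IShriek.ι G μ x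
        rw [iShriekMap_ι, iShriekComp_of G _ ((isImage_id μ μ).2 rfl), restrict_id]
        exact congrArg (IShriek.ι G μ) (evΩ_id G x)
      map_comp := fun {X Y Z} f g => by
        apply AddCommGrpCat.hom_ext
        apply DirectSum.addHom_ext
        intro μ x
        change iShriekMap G (GammaHom.comp f g) (IShriek.ι G μ x) =
          iShriekMap G g (iShriekMap G f (IShriek.ι G μ x))
        rw [iShriekMap_ι, iShriekMap_ι]
        by_cases h : ∃ ν, GammaHom.IsImage (GammaHom.comp f g) μ ν
        · obtain ⟨ρ, h⟩ := h
          obtain ⟨ν, hf, hg⟩ := h.of_comp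
          rw [iShriekComp_of G _ h, iShriekComp_of G _ hf]
          change _ = iShriekMap G g (IShriek.ι G ν _)
          rw [iShriekMap_ι, iShriekComp_of G _ hg, restrict_comp hf hg h]
          exact congrArg (IShriek.ι G ρ) (evΩ_comp G _ _ x)
        · rw [iShriekComp_zero G _ h]
          by_cases h' : ∃ ν, GammaHom.IsImage f μ ν
          · obtain ⟨ν, hf⟩ := h'
            rw [iShriekComp_of G _ hf]
            change _ = iShriekMap G g (IShriek.ι G ν _)
            rw [iShriekMap_ι, iShriekComp_zero G _ (fun ⟨ρ, hg⟩ => h ⟨ρ, hf.comp hg⟩)]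
            rfl
          · rw [iShriekComp_zero G _ h']
            exact (map_zero _).symm }
  map {G G'} τ :=
    { app := fun X => AddCommGrpCat.ofHom
        (DirectSum.map fun μ : Finset (Fin X.n) => (τ.app (Omega.ob μ.card)).hom)
      naturality := fun X Y g => by
        apply AddCommGrpCat.hom_ext
        apply DirectSum.addHom_ext
        intro μ x
        change DirectSum.map _ (iShriekMap G g (IShriek.ι G μ x)) =
          iShriekMap G' g (DirectSum.map _ (IShriek.ι G μ x))
        rw [iShriekMap_ι, DirectSum.map_of]
        refine Eq.trans ?_ (iShriekMap_ι G' g μ _).symm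
        by_cases h : ∃ ν, GammaHom.IsImage g μ ν
        · obtain ⟨ν, h⟩ := h
          rw [iShriekComp_of G _ h, iShriekComp_of G' _ h]
          refine (DirectSum.map_of _ _ _).trans ?_
          have := τ.naturality (X := Omega.ob μ.card) (Y := Omega.ob ν.card) (g.restrict μ ν h)
          exact congrArg _ (congrArg (fun t => t.hom x) this)
        · rw [iShriekComp_zero G _ h, iShriekComp_zero G' _ h]
          exact map_zero _ }
  map_id G := by
    apply NatTrans.ext
    funext X
    apply AddCommGrpCat.hom_ext
    apply DirectSum.addHom_ext
    intro μ x
    exact DirectSum.map_of _ _ _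
  map_comp := fun {G G' G''} τ τ' => by
    apply NatTrans.ext
    funext X
    apply AddCommGrpCat.hom_ext
    apply DirectSum.addHom_ext
    intro μ x
    refine (DirectSum.map_of _ _ _).trans ?_
    change _ = DirectSum.map _ (DirectSum.map _ (IShriek.ι G μ x))
    rw [DirectSum.map_of, DirectSum.map_of]
    rfl

end Covariant

/-! ### The functors `c̃r` and `i_*` -/

section Contravariant

variable {P : UnitaryOperad.{u}}

open Opposite

/-- The map `G(f) : G([m]) → G([n])` induced by the morphism `f : [n] → [m]` of `Γ(P)`. -/
noncomputable abbrev evOp (G : (Gamma P)ᵒᵖ ⥤ AddCommGrpCat.{v}) {n m : ℕ} (f : GammaHom P n m) :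
    G.obj (op (Gamma.ob m)) →+ G.obj (op (Gamma.ob n)) :=
  (G.map (Quiver.Hom.op (V := Gamma P) (X := Gamma.ob n) (Y := Gamma.ob m) f)).hom

theorem evOp_comp (G : (Gamma P)ᵒᵖ ⥤ AddCommGrpCat.{v}) {n m k : ℕ} (f : GammaHom P n m)
    (g : GammaHom P m k) (x) : evOp G (f.comp g) x = evOp G f (evOp G g x) := by
  have := G.map_comp (Quiver.Hom.op (V := Gamma P) (X := Gamma.ob m) (Y := Gamma.ob k) g)
    (Quiver.Hom.op (V := Gamma P) (X := Gamma.ob n) (Y := Gamma.ob m) f)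
  exact congrArg (fun t => t.hom x) this

theorem evOp_id (G : (Gamma P)ᵒᵖ ⥤ AddCommGrpCat.{v}) {n : ℕ} (x) :
    evOp G (GammaHom.id n) x = x :=
  congrArg (fun t => t.hom x) (G.map_id (op (Gamma.ob n)))

/-- The `n`-th cross-effect of a contravariant functor `G` at `([1],…,[1])`, as a subgroup of
`G([n])`: the intersection of the kernels of the maps `G([n]) → G([n-1])` induced by the
inclusions which omit `k`. -/
noncomputable def crOpSub (G : (Gamma P)ᵒᵖ ⥤ AddCommGrpCat.{v}) (n : ℕ) :
    AddSubgroup (G.obj (op (Gamma.ob n))) :=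
  ⨅ k : Fin n, (evOp G (GammaHom.incl (Finset.univ.erase k))).ker

theorem mem_crOpSub {G : (Gamma P)ᵒᵖ ⥤ AddCommGrpCat.{v}} {n : ℕ}
    {x : G.obj (op (Gamma.ob n))} :
    x ∈ crOpSub G n ↔ ∀ k, evOp G (GammaHom.incl (Finset.univ.erase k)) x = 0 := by
  simp only [crOpSub, AddSubgroup.mem_iInf, AddMonoidHom.mem_ker]

/-- The subgroup `∑_k Im G(r_k)` of `G([n])`, where `r_k : [n] → [n-1]` is the retraction which
sends `k` to `0`. -/
noncomputable def crOpRel (G : (Gamma P)ᵒᵖ ⥤ AddCommGrpCat.{v}) (n : ℕ) :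
    AddSubgroup (G.obj (op (Gamma.ob n))) :=
  ⨆ k : Fin n, (evOp G (GammaHom.retr (Finset.univ.erase k))).range

/-- The projection of `G([n])` onto `crOpSub G n` along `crOpRel G n`. -/
noncomputable def crOpProj (G : (Gamma P)ᵒᵖ ⥤ AddCommGrpCat.{v}) (n : ℕ) :
    G.obj (op (Gamma.ob n)) →+ G.obj (op (Gamma.ob n)) :=
  ∑ A : Finset (Fin n), (-1 : ℤ) ^ Aᶜ.card • evOp G (GammaHom.idem A)

theorem crOpProj_apply (G : (Gamma P)ᵒᵖ ⥤ AddCommGrpCat.{v}) (n : ℕ) (x) :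
    crOpProj G n x = ∑ A : Finset (Fin n), (-1 : ℤ) ^ Aᶜ.card • evOp G (GammaHom.idem A) x := by
  rw [crOpProj, AddMonoidHom.finsetSum_apply]
  rfl

theorem sum_compl_eq_zero {M : Type*} [AddCommGroup M] {n : ℕ} (k : Fin n)
    (φ : Finset (Fin n) → M) (h : ∀ A, φ (A.erase k) = φ A) :
    ∑ A : Finset (Fin n), (-1 : ℤ) ^ Aᶜ.card • φ A = 0 := by
  have key : ∀ A : Finset (Fin n), k ∈ A →
      (-1 : ℤ) ^ (A.erase k)ᶜ.card = - (-1 : ℤ) ^ Aᶜ.card := by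
    intro A hA
    have : (A.erase k)ᶜ = insert k Aᶜ := by
      ext b
      simp only [Finset.mem_compl, Finset.mem_erase, Finset.mem_insert]
      tauto
    rw [this, Finset.card_insert_of_notMem (by simpa using hA), pow_succ, mul_neg_one]
  refine Finset.sum_involution (fun A _ => if k ∈ A then A.erase k else insert k A) ?_ ?_ ?_ ?_
  · intro A _
    by_cases hA : k ∈ A
    · rw [if_pos hA, key A hA, h A, neg_smul, add_neg_cancel]
    · have h1 := key (insert k A) (Finset.mem_insert_self _ _)
      rw [Finset.erase_insert hA] at h1
      have h2 := h (insert k A)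
      rw [Finset.erase_insert hA] at h2
      rw [if_neg hA, h1, h2, neg_smul, neg_add_cancel]
  · intro A _ _
    by_cases hA : k ∈ A
    · rw [if_pos hA]
      intro h'
      rw [← h'] at hA
      simp at hA
    · rw [if_neg hA]
      intro h'
      exact hA (h' ▸ Finset.mem_insert_self _ _)
  · intro A _
    exact Finset.mem_univ _
  · intro A _
    by_cases hA : k ∈ A
    · simp [hA]
    · simp [hA]

theorem crOpProj_idem (G : (Gamma P)ᵒᵖ ⥤ AddCommGrpCat.{v}) {n : ℕ} (k : Fin n) (x) :
    crOpProj G n (evOp G (GammaHom.idem (Finset.univ.erase k)) x) = 0 := by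
  rw [crOpProj_apply]
  refine sum_compl_eq_zero k _ (fun A => ?_)
  rw [← evOp_comp, ← evOp_comp, GammaHom.idem_comp_idem, GammaHom.idem_comp_idem]
  congr 3
  ext b
  simp

theorem crOpProj_mem (G : (Gamma P)ᵒᵖ ⥤ AddCommGrpCat.{v}) (n : ℕ) (x) :
    crOpProj G n x ∈ crOpSub G n := by
  rw [mem_crOpSub]
  intro k
  rw [crOpProj_apply, map_sum]
  simp only [map_zsmul]
  refine sum_compl_eq_zero k _ (fun A => ?_)
  rw [← evOp_comp, ← evOp_comp]
  have h : ∀ B : Finset (Fin n), (GammaHom.incl (Finset.univ.erase k) : GammaHom P _ n).comp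
      (GammaHom.idem B) = (GammaHom.incl (Finset.univ.erase k)).comp
        (GammaHom.idem (B.erase k)) := by
    intro B
    have h1 : (GammaHom.incl (Finset.univ.erase k) : GammaHom P _ n).comp
        (GammaHom.idem (Finset.univ.erase k)) = GammaHom.incl (Finset.univ.erase k) := by
      rw [← GammaHom.retr_comp_incl, ← GammaHom.comp_assoc, GammaHom.incl_comp_retr,
        GammaHom.id_comp]
    rw [← h1, GammaHom.comp_assoc, GammaHom.comp_assoc, GammaHom.idem_comp_idem,
      GammaHom.idem_comp_idem]
    congr 2
    ext b
    simp
  rw [h A]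

theorem crOpProj_eq_self (G : (Gamma P)ᵒᵖ ⥤ AddCommGrpCat.{v}) {n : ℕ} {x}
    (hx : x ∈ crOpSub G n) : crOpProj G n x = x := by
  rw [crOpProj_apply, Finset.sum_eq_single Finset.univ]
  · rw [GammaHom.idem_univ, evOp_id]
    simp
  · intro A _ hA
    obtain ⟨a, ha⟩ : ∃ a, a ∉ A := by
      by_contra h
      push Not at h
      exact hA (Finset.eq_univ_iff_forall.2 h)
    have h1 : (GammaHom.idem A : GammaHom P n n) =
        (GammaHom.idem A).comp (GammaHom.idem (Finset.univ.erase a)) := by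
      rw [GammaHom.idem_comp_idem]
      congr 1
      ext b
      simp only [Finset.mem_inter, Finset.mem_erase, Finset.mem_univ, and_true]
      exact ⟨fun hb => ⟨hb, fun h => ha (h ▸ hb)⟩, fun hb => hb.1⟩
    rw [← GammaHom.retr_comp_incl (Finset.univ.erase a), ← GammaHom.comp_assoc] at h1
    rw [h1, evOp_comp, mem_crOpSub.1 hx a, map_zero, smul_zero]
  · intro h
    exact absurd (Finset.mem_univ _) h

theorem crOpProj_plus (G : (Gamma P)ᵒᵖ ⥤ AddCommGrpCat.{v}) {n m : ℕ} (f : OmegaHom P n m) (y) :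
    crOpProj G n (evOp G f.plus (crOpProj G m y)) = crOpProj G n (evOp G f.plus y) := by
  rw [crOpProj_apply G m, map_sum, map_sum, Finset.sum_eq_single Finset.univ]
  · rw [GammaHom.idem_univ, evOp_id]
    simp
  · intro A _ hA
    obtain ⟨b, hb⟩ : ∃ b, b ∉ A := by
      by_contra h
      push Not at h
      exact hA (Finset.eq_univ_iff_forall.2 h)
    obtain ⟨a, rfl⟩ := f.surj b
    rw [map_zsmul, map_zsmul, ← evOp_comp]
    have h := (f.plus.comp (GammaHom.idem A)).idem_comp (Finset.univ.erase a) (fun c hc => by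
      have hc' : c = a := by simpa using hc
      subst hc'
      exact if_neg hb)
    rw [← h, evOp_comp, crOpProj_idem, smul_zero]
  · intro h
    exact absurd (Finset.mem_univ _) h

/-- The map `c̃r(G)(f, ω^f)`: the map induced by `G(f₊, ω^{f₊})` on the quotients
`G([n]) / ∑_k Im G(r_k)`, these being identified with the subgroups `crOpSub G n`. -/
noncomputable def crOpMap (G : (Gamma P)ᵒᵖ ⥤ AddCommGrpCat.{v}) {n m : ℕ} (f : OmegaHom P n m) :
    crOpSub G m →+ crOpSub G n :=
  (((crOpProj G n).comp (evOp G f.plus)).comp (crOpSub G m).subtype).codRestrict (crOpSub G n)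
    (fun _ => crOpProj_mem G n _)

theorem natTrans_evOp {G G' : (Gamma P)ᵒᵖ ⥤ AddCommGrpCat.{v}} (τ : G ⟶ G') {n m : ℕ}
    (f : GammaHom P n m) (x) : (τ.app (op (Gamma.ob n))).hom (evOp G f x) =
      evOp G' f ((τ.app (op (Gamma.ob m))).hom x) := by
  have := τ.naturality (Quiver.Hom.op (V := Gamma P) (X := Gamma.ob n) (Y := Gamma.ob m) f)
  exact congrArg (fun t => t.hom x) this

theorem natTrans_crOpProj {G G' : (Gamma P)ᵒᵖ ⥤ AddCommGrpCat.{v}} (τ : G ⟶ G') {n : ℕ} (x) :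
    (τ.app (op (Gamma.ob n))).hom (crOpProj G n x) =
      crOpProj G' n ((τ.app (op (Gamma.ob n))).hom x) := by
  rw [crOpProj_apply, crOpProj_apply, map_sum]
  refine Finset.sum_congr rfl (fun A _ => ?_)
  rw [map_zsmul, natTrans_evOp]

/-- The functor `c̃r : Func(Γ(P)ᵒᵖ, Ab) ⥤ Func(Ω(P)ᵒᵖ, Ab)`. -/
noncomputable def crOp (P : UnitaryOperad.{u}) :
    ((Gamma P)ᵒᵖ ⥤ AddCommGrpCat.{v}) ⥤ ((Omega P)ᵒᵖ ⥤ AddCommGrpCat.{v}) where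
  obj G :=
    { obj := fun X => AddCommGrpCat.of (crOpSub G X.unop.n)
      map := fun {X Y} f => AddCommGrpCat.ofHom (crOpMap (n := Y.unop.n) (m := X.unop.n) G f.unop)
      map_id := fun X => by
        ext x
        change crOpProj G _ (evOp G (OmegaHom.id X.unop.n).plus x.1) = x.1
        rw [OmegaHom.plus_id, evOp_id, crOpProj_eq_self G x.2]
      map_comp := fun {X Y Z} f g => by
        ext x
        change crOpProj G _ (evOp G (OmegaHom.comp g.unop f.unop).plus x.1) =
          crOpProj G _ (evOp G (OmegaHom.plus g.unop)
            (crOpProj G _ (evOp G (OmegaHom.plus f.unop) x.1)))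
        rw [OmegaHom.plus_comp, evOp_comp, crOpProj_plus] }
  map {G G'} τ :=
    { app := fun X => AddCommGrpCat.ofHom
        (((τ.app (op (Gamma.ob X.unop.n))).hom.comp (crOpSub G X.unop.n).subtype).codRestrict
          (crOpSub G' X.unop.n) (fun x => by
            rw [mem_crOpSub]
            intro k
            have h0 := mem_crOpSub.1 x.2 k
            refine (natTrans_evOp τ _ _).symm.trans ?_
            change (τ.app _).hom (evOp G (GammaHom.incl (Finset.univ.erase k)) x.1) = 0
            rw [h0, map_zero]))
      naturality := fun X Y f => by
        ext x
        change (τ.app _).hom (crOpProj G _ (evOp G (OmegaHom.plus f.unop) x.1)) =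
          crOpProj G' _ (evOp G' (OmegaHom.plus f.unop) ((τ.app _).hom x.1))
        rw [natTrans_crOpProj, natTrans_evOp] }
  map_id G := rfl
  map_comp τ τ' := rfl

/-- The map `G(f) : G(m) → G(n)` induced by the morphism `f : {1,…,n} → {1,…,m}` of `Ω(P)`. -/
noncomputable abbrev evΩOp (G : (Omega P)ᵒᵖ ⥤ AddCommGrpCat.{v}) {n m : ℕ} (f : OmegaHom P n m) :
    G.obj (op (Omega.ob m)) →+ G.obj (op (Omega.ob n)) :=
  (G.map (Quiver.Hom.op (V := Omega P) (X := Omega.ob n) (Y := Omega.ob m) f)).hom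

theorem evΩOp_comp (G : (Omega P)ᵒᵖ ⥤ AddCommGrpCat.{v}) {n m k : ℕ} (f : OmegaHom P n m)
    (g : OmegaHom P m k) (x) : evΩOp G (f.comp g) x = evΩOp G f (evΩOp G g x) := by
  have := G.map_comp (Quiver.Hom.op (V := Omega P) (X := Omega.ob m) (Y := Omega.ob k) g)
    (Quiver.Hom.op (V := Omega P) (X := Omega.ob n) (Y := Omega.ob m) f)
  exact congrArg (fun t => t.hom x) this

theorem evΩOp_id (G : (Omega P)ᵒᵖ ⥤ AddCommGrpCat.{v}) {n : ℕ} (x) :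
    evΩOp G (OmegaHom.id n) x = x :=
  congrArg (fun t => t.hom x) (G.map_id (op (Omega.ob n)))

/-- The group `⨁_{μ ⊂ {1,…,n}} G(|μ|)`. -/
abbrev IStar (G : (Omega P)ᵒᵖ ⥤ AddCommGrpCat.{v}) (n : ℕ) : Type v :=
  DirectSum (Finset (Fin n)) fun μ => G.obj (op (Omega.ob μ.card))

/-- The inclusion of the summand `G(|μ|)`. -/
abbrev IStar.ι (G : (Omega P)ᵒᵖ ⥤ AddCommGrpCat.{v}) {n : ℕ} (μ : Finset (Fin n)) :
    G.obj (op (Omega.ob μ.card)) →+ IStar G n :=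
  DirectSum.of (fun μ : Finset (Fin n) => G.obj (op (Omega.ob μ.card))) μ

open Classical in
/-- The component `G(|μ|) → G(|ν|)` of `i_*(G)(h, ω^h)`: it is `G(h|_ν, ω^{h|_ν})` if `h(ν) = μ`,
and `0` otherwise. -/
noncomputable def iStarEntry (G : (Omega P)ᵒᵖ ⥤ AddCommGrpCat.{v}) {n m : ℕ} (h : GammaHom P n m)
    (μ : Finset (Fin m)) (ν : Finset (Fin n)) :
    G.obj (op (Omega.ob μ.card)) →+ G.obj (op (Omega.ob ν.card)) :=
  if H : h.IsImage ν μ then evΩOp G (h.restrict ν μ H) else 0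

theorem iStarEntry_of (G : (Omega P)ᵒᵖ ⥤ AddCommGrpCat.{v}) {n m : ℕ} {h : GammaHom P n m}
    {μ : Finset (Fin m)} {ν : Finset (Fin n)} (H : h.IsImage ν μ) :
    iStarEntry G h μ ν = evΩOp G (h.restrict ν μ H) := dif_pos H

theorem iStarEntry_zero (G : (Omega P)ᵒᵖ ⥤ AddCommGrpCat.{v}) {n m : ℕ} {h : GammaHom P n m}
    {μ : Finset (Fin m)} {ν : Finset (Fin n)} (H : ¬ h.IsImage ν μ) :
    iStarEntry G h μ ν = 0 := dif_neg H

/-- The map `i_*(G)(h, ω^h) : i_*(G)([m]) → i_*(G)([n])` induced by `(h, ω^h) : [n] → [m]`. -/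
noncomputable def iStarMap (G : (Omega P)ᵒᵖ ⥤ AddCommGrpCat.{v}) {n m : ℕ} (h : GammaHom P n m) :
    IStar G m →+ IStar G n :=
  DirectSum.toAddMonoid fun μ => ∑ ν, (IStar.ι G ν).comp (iStarEntry G h μ ν)

theorem iStarMap_ι (G : (Omega P)ᵒᵖ ⥤ AddCommGrpCat.{v}) {n m : ℕ} (h : GammaHom P n m)
    (μ : Finset (Fin m)) (x) :
    iStarMap G h (IStar.ι G μ x) = ∑ ν, IStar.ι G ν (iStarEntry G h μ ν x) := by
  refine (DirectSum.toAddMonoid_of _ _ _).trans ?_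
  rw [AddMonoidHom.finsetSum_apply]
  rfl

/-- The functor `i_* : Func(Ω(P)ᵒᵖ, Ab) ⥤ Func(Γ(P)ᵒᵖ, Ab)`. -/
noncomputable def iStar (P : UnitaryOperad.{u}) :
    ((Omega P)ᵒᵖ ⥤ AddCommGrpCat.{v}) ⥤ ((Gamma P)ᵒᵖ ⥤ AddCommGrpCat.{v}) where
  obj G :=
    { obj := fun X => AddCommGrpCat.of (IStar G X.unop.n)
      map := fun {X Y} h => AddCommGrpCat.ofHom (iStarMap (n := Y.unop.n) (m := X.unop.n) G h.unop)
      map_id := fun X => by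
        apply AddCommGrpCat.hom_ext
        apply DirectSum.addHom_ext
        intro μ x
        change iStarMap G (GammaHom.id X.unop.n) (IStar.ι G μ x) = IStar.ι G μ x
        rw [iStarMap_ι, Finset.sum_eq_single μ]
        · rw [iStarEntry_of G ((isImage_id μ μ).2 rfl), restrict_id, evΩOp_id]
        · intro ν _ hν
          rw [iStarEntry_zero G (fun H => hν ((isImage_id ν μ).1 H))]
          exact map_zero _
        · intro h
          exact absurd (Finset.mem_univ _) h
      map_comp := fun {X Y Z} f g => by
        apply AddCommGrpCat.hom_ext
        apply DirectSum.addHom_ext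
        intro ρ x
        change iStarMap G (GammaHom.comp g.unop f.unop) (IStar.ι G ρ x) =
          iStarMap G g.unop (iStarMap G f.unop (IStar.ι G ρ x))
        rw [iStarMap_ι, iStarMap_ι, map_sum]
        simp only [iStarMap_ι]
        rw [Finset.sum_comm]
        refine Finset.sum_congr rfl (fun ν _ => ?_)
        by_cases h : GammaHom.IsImage (GammaHom.comp g.unop f.unop) ν ρ
        · obtain ⟨μ, hg, hf⟩ := h.of_comp
          rw [Finset.sum_eq_single μ]
          · rw [iStarEntry_of G h, iStarEntry_of G hf, iStarEntry_of G hg, restrict_comp hg hf h,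
              evΩOp_comp]
          · intro μ' _ hμ'
            rw [iStarEntry_zero G (h := g.unop) (μ := μ') (fun H => hμ' (H.unique hg))]
            exact map_zero _
          · intro h
            exact absurd (Finset.mem_univ _) h
        · rw [iStarEntry_zero G h, Finset.sum_eq_zero]
          · exact map_zero _
          · intro μ _
            by_cases hg : GammaHom.IsImage g.unop ν μ
            · rw [iStarEntry_zero G (h := f.unop) (fun hf => h (hg.comp hf))]
              exact (congrArg _ (map_zero _)).trans (map_zero _)
            · rw [iStarEntry_zero G hg]
              exact map_zero _ }
  map {G G'} τ :=
    { app := fun X => AddCommGrpCat.ofHom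
        (DirectSum.map fun μ : Finset (Fin X.unop.n) => (τ.app (op (Omega.ob μ.card))).hom)
      naturality := fun X Y h => by
        apply AddCommGrpCat.hom_ext
        apply DirectSum.addHom_ext
        intro μ x
        change DirectSum.map _ (iStarMap G h.unop (IStar.ι G μ x)) =
          iStarMap G' h.unop (DirectSum.map _ (IStar.ι G μ x))
        rw [iStarMap_ι, DirectSum.map_of, map_sum]
        refine Eq.trans ?_ (iStarMap_ι G' h.unop μ _).symm
        refine Finset.sum_congr rfl (fun ν _ => ?_)
        refine (DirectSum.map_of _ _ _).trans ?_
        refine congrArg _ ?_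
        by_cases H : GammaHom.IsImage h.unop ν μ
        · rw [iStarEntry_of G H, iStarEntry_of G' H]
          have := τ.naturality (Quiver.Hom.op (V := Omega P) (X := Omega.ob ν.card)
            (Y := Omega.ob μ.card) (GammaHom.restrict h.unop ν μ H))
          exact congrArg (fun t => t.hom x) this
        · rw [iStarEntry_zero G H, iStarEntry_zero G' H]
          exact map_zero _ }
  map_id G := by
    apply NatTrans.ext
    funext X
    apply AddCommGrpCat.hom_ext
    apply DirectSum.addHom_ext
    intro μ x
    exact DirectSum.map_of _ _ _
  map_comp := fun {G G' G''} τ τ' => by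
    apply NatTrans.ext
    funext X
    apply AddCommGrpCat.hom_ext
    apply DirectSum.addHom_ext
    intro μ x
    refine (DirectSum.map_of _ _ _).trans ?_
    change _ = DirectSum.map _ (DirectSum.map _ (IStar.ι G μ x))
    rw [DirectSum.map_of, DirectSum.map_of]
    rfl

end Contravariant

/-! ### The wedge `[n] ∨ [k] = [n + k]` -/

section Wedge

variable {P : UnitaryOperad.{u}}

theorem GammaHom.eq_of_zero {n m : ℕ} {s t : GammaHom P n m} (hs : ∀ x, s.toFun x = 0)
    (ht : ∀ x, t.toFun x = 0) : s = t := by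
  refine GammaHom.ext' (fun x => (hs x).trans (ht x).symm) (fun y hy e he => ?_)
  have : IsEmpty {x // t.toFun x = y} := ⟨fun x => hy ((ht x.1).symm.trans x.2).symm⟩
  exact P.eq_of_isEmpty _ _

/-- The zero morphism `[n] → [m]`. -/
noncomputable def GammaHom.zero (n m : ℕ) : GammaHom P n m :=
  GammaHom.ofInj (fun _ => 0) rfl (fun _ hy => ⟨fun a => absurd a.2 (Ne.symm hy)⟩)

/-- The morphism `[n] → [m]` given by an injection `{1,…,n} → {1,…,m}`. -/
noncomputable def GammaHom.inj {n m : ℕ} (φ : Fin n → Fin m) (hφ : Function.Injective φ) :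
    GammaHom P n m :=
  GammaHom.ofInj (plusFun φ) rfl (plusFun_fiber hφ)

/-- The inclusion `[n] → [n] ∨ [k]`. -/
noncomputable def GammaHom.inl (n k : ℕ) : GammaHom P n (n + k) :=
  GammaHom.inj (Fin.castAdd k) (Fin.castAdd_injective n k)

/-- The inclusion `[k] → [n] ∨ [k]`. -/
noncomputable def GammaHom.inr (n k : ℕ) : GammaHom P k (n + k) :=
  GammaHom.inj (Fin.natAdd n) (Fin.natAdd_injective k n)

/-- The map underlying the retraction `[n] ∨ [k] → [n]`. -/
def fstFun (n k : ℕ) : Fin (n + k + 1) → Fin (n + 1) :=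
  Fin.cases 0 (Fin.addCases (fun a => a.succ) (fun _ => 0))

/-- The map underlying the retraction `[n] ∨ [k] → [k]`. -/
def sndFun (n k : ℕ) : Fin (n + k + 1) → Fin (k + 1) :=
  Fin.cases 0 (Fin.addCases (fun _ => 0) (fun b => b.succ))

theorem fstFun_left (n k : ℕ) (a : Fin n) : fstFun n k (Fin.castAdd k a).succ = a.succ := by
  rw [fstFun, Fin.cases_succ, Fin.addCases_left]

theorem fstFun_right (n k : ℕ) (b : Fin k) : fstFun n k (Fin.natAdd n b).succ = 0 := by
  rw [fstFun, Fin.cases_succ, Fin.addCases_right]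

theorem sndFun_left (n k : ℕ) (a : Fin n) : sndFun n k (Fin.castAdd k a).succ = 0 := by
  rw [sndFun, Fin.cases_succ, Fin.addCases_left]

theorem sndFun_right (n k : ℕ) (b : Fin k) : sndFun n k (Fin.natAdd n b).succ = b.succ := by
  rw [sndFun, Fin.cases_succ, Fin.addCases_right]

/-- An element of `[n] ∨ [k]` is the base point, an element of `[n]`, or an element of `[k]`. -/
theorem wedge_cases {n k : ℕ} {p : Fin (n + k + 1) → Prop} (h0 : p 0)
    (hl : ∀ a, p (Fin.castAdd k a).succ) (hr : ∀ b, p (Fin.natAdd n b).succ) (x) : p x := by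
  induction x using Fin.cases with
  | zero => exact h0
  | succ x =>
    induction x using Fin.addCases with
    | left a => exact hl a
    | right b => exact hr b

/-- The retraction `[n] ∨ [k] → [n]`. -/
noncomputable def GammaHom.fst (n k : ℕ) : GammaHom P (n + k) n :=
  GammaHom.ofInj (fstFun n k) rfl (by
    intro y hy
    have key : ∀ x, fstFun n k x = y → x = plusFun (Fin.castAdd k) y := by
      intro x
      induction x using wedge_cases with
      | h0 => exact fun h => absurd h.symm hy
      | hl a =>
        rw [fstFun_left]
        rintro rfl
        rfl
      | hr b =>
        rw [fstFun_right]
        exact fun h => absurd h.symm hy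
    exact ⟨fun a b => Subtype.ext ((key _ a.2).trans (key _ b.2).symm)⟩)

/-- The retraction `[n] ∨ [k] → [k]`. -/
noncomputable def GammaHom.snd (n k : ℕ) : GammaHom P (n + k) k :=
  GammaHom.ofInj (sndFun n k) rfl (by
    intro y hy
    have key : ∀ x, sndFun n k x = y → x = plusFun (Fin.natAdd n) y := by
      intro x
      induction x using wedge_cases with
      | h0 => exact fun h => absurd h.symm hy
      | hl a =>
        rw [sndFun_left]
        exact fun h => absurd h.symm hy
      | hr b =>
        rw [sndFun_right]
        rintro rfl
        rfl
    exact ⟨fun a b => Subtype.ext ((key _ a.2).trans (key _ b.2).symm)⟩)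

theorem dec_eq_of_inj {n N p : ℕ} (φ : Fin n → Fin N) (hφ : Function.Injective φ)
    {s t : GammaHom P N p} (h : (GammaHom.inj φ hφ).comp s = (GammaHom.inj φ hφ).comp t)
    (y : Fin (p + 1)) (hy : y ≠ 0) (hs : ∀ x, s.toFun x = y → ∃ a, x = plusFun φ a)
    (e : {x // s.toFun x = y} ≃ {x // t.toFun x = y}) (he : ∀ x, (e x).1 = x.1) :
    P.transport e (s.dec y hy) = t.dec y hy := by
  have hinj : Function.Injective (plusFun φ) := by
    intro a b hab
    induction a using Fin.cases with
    | zero =>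
      induction b using Fin.cases with
      | zero => rfl
      | succ b => exact absurd hab.symm (Fin.succ_ne_zero _)
    | succ a =>
      induction b using Fin.cases with
      | zero => exact absurd hab (Fin.succ_ne_zero _)
      | succ b => exact congrArg Fin.succ (hφ (Fin.succ_injective _ hab))
  have ht : ∀ x, t.toFun x = y → ∃ a, x = plusFun φ a := by
    intro x hx
    obtain ⟨x', hx'⟩ := e.surjective ⟨x, hx⟩
    obtain ⟨a, ha⟩ := hs x'.1 x'.2
    refine ⟨a, ha ▸ ?_⟩
    rw [← he, hx']
  let es : {x // s.toFun (plusFun φ x) = y} ≃ {x // s.toFun x = y} :=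
    Equiv.ofBijective (fun x => ⟨plusFun φ x.1, x.2⟩)
      ⟨fun a b hab => Subtype.ext (hinj (congrArg Subtype.val hab)), by
        rintro ⟨x, hx⟩
        obtain ⟨a, rfl⟩ := hs x hx
        exact ⟨⟨a, hx⟩, rfl⟩⟩
  let et : {x // t.toFun (plusFun φ x) = y} ≃ {x // t.toFun x = y} :=
    Equiv.ofBijective (fun x => ⟨plusFun φ x.1, x.2⟩)
      ⟨fun a b hab => Subtype.ext (hinj (congrArg Subtype.val hab)), by
        rintro ⟨x, hx⟩
        obtain ⟨a, rfl⟩ := ht x hx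
        exact ⟨⟨a, hx⟩, rfl⟩⟩
  have h1 := GammaHom.ofInj_comp_dec (plusFun φ) rfl (plusFun_fiber hφ) s y hy es.symm
    (fun b => congrArg Subtype.val (es.apply_symm_apply b))
  have h2 := GammaHom.ofInj_comp_dec (plusFun φ) rfl (plusFun_fiber hφ) t y hy et.symm
    (fun b => congrArg Subtype.val (et.apply_symm_apply b))
  let E : {x // s.toFun (plusFun φ x) = y} ≃ {x // t.toFun (plusFun φ x) = y} :=
    es.trans (e.trans et.symm)
  have hE : ∀ x, (E x).1 = x.1 := by
    intro x
    apply hinj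
    refine (congrArg Subtype.val (et.apply_symm_apply (e (es x)))).trans ?_
    exact he _
  have h3 := GammaHom.dec_of_eq h hy E hE
  have h4 : P.transport E (P.transport es.symm (s.dec y hy)) = P.transport et.symm (t.dec y hy) :=
    (congrArg (P.transport E) h1).symm.trans (h3.trans h2)
  have h5 := congrArg (P.transport et) h4
  rw [UnitaryOperad.transport_trans, UnitaryOperad.transport_trans,
    UnitaryOperad.transport_trans] at h5
  refine Eq.trans ?_ (h5.trans (P.transport_eq_self _ (fun a => by simp) _))
  exact P.transport_congr _ _ (fun a => by simp [E]) _

theorem GammaHom.wedge_ext {n k p : ℕ} {s t : GammaHom P (n + k) p}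
    (hl : (GammaHom.inl n k).comp s = (GammaHom.inl n k).comp t)
    (hr : (GammaHom.inr n k).comp s = (GammaHom.inr n k).comp t)
    (hs : ∀ y, y ≠ 0 → (∀ a, s.toFun (Fin.castAdd k a).succ ≠ y) ∨
      (∀ b, s.toFun (Fin.natAdd n b).succ ≠ y)) : s = t := by
  refine GammaHom.ext' (fun x => ?_) (fun y hy e he => ?_)
  · induction x using wedge_cases with
    | h0 => rw [s.map_zero, t.map_zero]
    | hl a => exact congrFun (congrArg GammaHom.toFun hl) a.succ
    | hr b => exact congrFun (congrArg GammaHom.toFun hr) b.succ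
  · rcases hs y hy with h | h
    · refine dec_eq_of_inj _ _ hr y hy (fun x => ?_) e he
      induction x using wedge_cases with
      | h0 => exact fun _ => ⟨0, rfl⟩
      | hl a => exact fun hx => absurd hx (h a)
      | hr b => exact fun _ => ⟨b.succ, rfl⟩
    · refine dec_eq_of_inj _ _ hl y hy (fun x => ?_) e he
      induction x using wedge_cases with
      | h0 => exact fun _ => ⟨0, rfl⟩
      | hl a => exact fun _ => ⟨a.succ, rfl⟩
      | hr b => exact fun hx => absurd hx (h b)

theorem GammaHom.inl_fst (n k : ℕ) :
    (GammaHom.inl n k : GammaHom P n _).comp (GammaHom.fst n k) = GammaHom.id n := by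
  refine GammaHom.ofInj_comp_ofInj _ _ _ _ _ _ _ _ _ (fun x => ?_)
  induction x using Fin.cases with
  | zero => rfl
  | succ a => exact (fstFun_left n k a).symm

theorem GammaHom.inr_snd (n k : ℕ) :
    (GammaHom.inr n k : GammaHom P k _).comp (GammaHom.snd n k) = GammaHom.id k := by
  refine GammaHom.ofInj_comp_ofInj _ _ _ _ _ _ _ _ _ (fun x => ?_)
  induction x using Fin.cases with
  | zero => rfl
  | succ a => exact (sndFun_right n k a).symm

/-- The map `f ∨ 1 : [n] ∨ [k] → [m] ∨ [k]`. -/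
def wedgeFun {n m : ℕ} (f : Fin (n + 1) → Fin (m + 1)) (k : ℕ) :
    Fin (n + k + 1) → Fin (m + k + 1) :=
  Fin.cases 0 (Fin.addCases (fun a => plusFun (Fin.castAdd k) (f a.succ))
    (fun b => (Fin.natAdd m b).succ))

theorem wedgeFun_left {n m : ℕ} (f : Fin (n + 1) → Fin (m + 1)) (k : ℕ) (a : Fin n) :
    wedgeFun f k (Fin.castAdd k a).succ = plusFun (Fin.castAdd k) (f a.succ) := by
  rw [wedgeFun, Fin.cases_succ, Fin.addCases_left]

theorem wedgeFun_right {n m : ℕ} (f : Fin (n + 1) → Fin (m + 1)) (k : ℕ) (b : Fin k) :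
    wedgeFun f k (Fin.natAdd n b).succ = (Fin.natAdd m b).succ := by
  rw [wedgeFun, Fin.cases_succ, Fin.addCases_right]

theorem plusFun_castAdd_ne {m k : ℕ} (z : Fin (m + 1)) (b : Fin k) :
    plusFun (Fin.castAdd k) z ≠ (Fin.natAdd m b).succ := by
  induction z using Fin.cases with
  | zero => exact (Fin.succ_ne_zero _).symm
  | succ a =>
    intro h
    have h : (Fin.castAdd k a).succ = (Fin.natAdd m b).succ := h
    have h' := congrArg Fin.val (Fin.succ_injective _ h)
    rw [Fin.val_castAdd, Fin.val_natAdd] at h'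
    omega

theorem plusFun_castAdd_eq_iff {m k : ℕ} (z : Fin (m + 1)) (b : Fin m) :
    plusFun (Fin.castAdd k) z = (Fin.castAdd k b).succ ↔ z = b.succ := by
  induction z using Fin.cases with
  | zero =>
    exact ⟨fun h => absurd h.symm (Fin.succ_ne_zero _), fun h => absurd h.symm (Fin.succ_ne_zero _)⟩
  | succ a =>
    constructor
    · intro h
      have h : (Fin.castAdd k a).succ = (Fin.castAdd k b).succ := h
      rw [Fin.castAdd_injective _ _ (Fin.succ_injective _ h)]
    · intro h
      rw [h]
      rfl

/-- The identification of `f⁻¹(b)` with `(f ∨ 1)⁻¹(b)`, for `b` a non-zero element of `[m]`. -/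
noncomputable def wedgeFiber {n m : ℕ} (f : Fin (n + 1) → Fin (m + 1)) (h0 : f 0 = 0) (k : ℕ)
    (b : Fin m) : {x // f x = b.succ} ≃ {x // wedgeFun f k x = (Fin.castAdd k b).succ} :=
  Equiv.ofBijective (fun x => ⟨plusFun (Fin.castAdd k) x.1, by
      obtain ⟨x, hx⟩ := x
      induction x using Fin.cases with
      | zero => exact absurd (h0.symm.trans hx).symm (Fin.succ_ne_zero _)
      | succ a =>
        rw [plusFun_succ, wedgeFun_left, hx]
        rfl⟩)
    ⟨by
      rintro ⟨x, hx⟩ ⟨x', hx'⟩ h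
      apply Subtype.ext
      have h := congrArg Subtype.val h
      induction x using Fin.cases with
      | zero => exact absurd (h0.symm.trans hx).symm (Fin.succ_ne_zero _)
      | succ a => exact ((plusFun_castAdd_eq_iff x' a).1 h.symm).symm, by
      rintro ⟨x, hx⟩
      induction x using wedge_cases with
      | h0 => exact absurd hx.symm (Fin.succ_ne_zero _)
      | hl a =>
        refine ⟨⟨a.succ, ?_⟩, rfl⟩
        rwa [wedgeFun_left, plusFun_castAdd_eq_iff] at hx
      | hr c =>
        rw [wedgeFun_right] at hx
        exact absurd hx.symm (plusFun_castAdd_ne b.succ c)⟩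

theorem wedgeFun_fiber {n m : ℕ} (f : Fin (n + 1) → Fin (m + 1)) (k : ℕ) (b : Fin k) :
    Subsingleton {x // wedgeFun f k x = (Fin.natAdd m b).succ} := by
  have key : ∀ x, wedgeFun f k x = (Fin.natAdd m b).succ → x = (Fin.natAdd n b).succ := by
    intro x
    induction x using wedge_cases with
    | h0 => exact fun h => absurd h.symm (Fin.succ_ne_zero _)
    | hl a =>
      rw [wedgeFun_left]
      exact fun h => absurd h (plusFun_castAdd_ne _ b)
    | hr c =>
      rw [wedgeFun_right]
      intro h
      rw [Fin.natAdd_injective _ _ (Fin.succ_injective _ h)]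
  exact ⟨fun x x' => Subtype.ext ((key _ x.2).trans (key _ x'.2).symm)⟩

/-- The morphism `f ∨ 1 : [n] ∨ [k] → [m] ∨ [k]`, decorated by `ω^f` on `[m]` and by `1` on
`[k]`. -/
noncomputable def GammaHom.wedge {n m : ℕ} (f : GammaHom P n m) (k : ℕ) :
    GammaHom P (n + k) (m + k) where
  toFun := wedgeFun f.toFun k
  map_zero := rfl
  dec := Fin.cases (fun h => absurd rfl h) (Fin.addCases
    (fun b _ => P.transport (wedgeFiber f.toFun f.map_zero k b) (f.dec b.succ (Fin.succ_ne_zero b)))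
    (fun b _ => haveI := wedgeFun_fiber f.toFun k b
      P.pt {x // wedgeFun f.toFun k x = (Fin.natAdd m b).succ}))

theorem GammaHom.wedge_dec_left {n m : ℕ} (f : GammaHom P n m) (k : ℕ) (b : Fin m) (hb) :
    (f.wedge k).dec (Fin.castAdd k b).succ hb =
      P.transport (wedgeFiber f.toFun f.map_zero k b) (f.dec b.succ (Fin.succ_ne_zero b)) := by
  have := Fin.addCases_left (motive := fun c : Fin (m + k) => c.succ ≠ 0 →
    P.on {x // wedgeFun f.toFun k x = c.succ})
    (left := fun b _ => P.transport (wedgeFiber f.toFun f.map_zero k b)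
      (f.dec b.succ (Fin.succ_ne_zero b)))
    (right := fun b _ => haveI := wedgeFun_fiber f.toFun k b
      P.pt {x // wedgeFun f.toFun k x = (Fin.natAdd m b).succ}) b
  exact congrFun this hb

theorem GammaHom.inl_wedge {n m : ℕ} (f : GammaHom P n m) (k : ℕ) :
    (GammaHom.inl n k).comp (f.wedge k) = f.comp (GammaHom.inl m k) := by
  have h0 : ∀ x, wedgeFun f.toFun k (plusFun (Fin.castAdd k) x) =
      plusFun (Fin.castAdd k) (f.toFun x) := by
    intro x
    induction x using Fin.cases with
    | zero =>
      rw [f.map_zero]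
      rfl
    | succ a => exact wedgeFun_left f.toFun k a
  refine GammaHom.ext' h0 (fun y hy e he => ?_)
  induction y using wedge_cases with
  | h0 => exact absurd rfl hy
  | hl b =>
    let e₁ : {x // wedgeFun f.toFun k x = (Fin.castAdd k b).succ} ≃
        {x // wedgeFun f.toFun k (plusFun (Fin.castAdd k) x) = (Fin.castAdd k b).succ} :=
      (wedgeFiber f.toFun f.map_zero k b).symm.trans (Equiv.subtypeEquivRight (fun x => by
        rw [h0, plusFun_castAdd_eq_iff]))
    have h1 := GammaHom.ofInj_comp_dec (plusFun (Fin.castAdd k)) rfl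
      (plusFun_fiber (Fin.castAdd_injective n k)) (f.wedge k) (Fin.castAdd k b).succ hy e₁ (by
        intro x
        exact congrArg Subtype.val ((wedgeFiber f.toFun f.map_zero k b).apply_symm_apply x))
    have h2 := GammaHom.comp_ofInj_dec f (plusFun (Fin.castAdd k)) rfl
      (plusFun_fiber (Fin.castAdd_injective m k)) (Fin.castAdd k b).succ hy b.succ rfl
      (Fin.succ_ne_zero _)
      (Equiv.subtypeEquivRight (fun x => (plusFun_castAdd_eq_iff (f.toFun x) b).symm))
      (fun _ => rfl)
    refine (congrArg (P.transport e) h1).trans ?_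
    refine Eq.trans ?_ h2.symm
    refine (congrArg (fun t => P.transport e (P.transport e₁ t)) (f.wedge_dec_left k b hy)).trans ?_
    refine (congrArg (P.transport e) (P.transport_trans _ _ _)).trans ?_
    refine (P.transport_trans _ _ _).trans ?_
    refine P.transport_congr _ _ (fun a => ?_) _
    apply Subtype.ext
    refine (he _).trans ?_
    change ((wedgeFiber f.toFun f.map_zero k b).symm (wedgeFiber f.toFun f.map_zero k b a)).1 = a.1
    rw [Equiv.symm_apply_apply]
  | hr b =>
    have : IsEmpty {x // plusFun (Fin.castAdd k) (f.toFun x) = (Fin.natAdd m b).succ} :=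
      ⟨fun x => plusFun_castAdd_ne _ _ x.2⟩
    exact P.eq_of_isEmpty
      (X := {x // plusFun (Fin.castAdd k) (f.toFun x) = (Fin.natAdd m b).succ}) _ _

theorem GammaHom.inr_wedge {n m : ℕ} (f : GammaHom P n m) (k : ℕ) :
    (GammaHom.inr n k).comp (f.wedge k) = GammaHom.inr m k := by
  have h0 : ∀ x, wedgeFun f.toFun k (plusFun (Fin.natAdd n) x) = plusFun (Fin.natAdd m) x := by
    intro x
    induction x using Fin.cases with
    | zero => rfl
    | succ a => exact wedgeFun_right f.toFun k a
  refine GammaHom.ext' h0 (fun y hy e he => ?_)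
  induction y using wedge_cases with
  | h0 => exact absurd rfl hy
  | hl b =>
    have : IsEmpty {x : Fin (k + 1) // plusFun (Fin.natAdd m) x = (Fin.castAdd k b).succ} := by
      refine ⟨?_⟩
      rintro ⟨x, hx⟩
      induction x using Fin.cases with
      | zero => exact absurd hx.symm (Fin.succ_ne_zero _)
      | succ c => exact plusFun_castAdd_ne b.succ c hx.symm
    exact P.eq_of_isEmpty (X := {x : Fin (k + 1) // plusFun (Fin.natAdd m) x =
      (Fin.castAdd k b).succ}) _ _
  | hr b =>
    have i1 := wedgeFun_fiber f.toFun k b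
    have i2 : Subsingleton {x : Fin (k + 1) // plusFun (Fin.natAdd m) x = (Fin.natAdd m b).succ} :=
      plusFun_fiber (Fin.natAdd_injective k m) _ (Fin.succ_ne_zero _)
    have i3 : Subsingleton {x : Fin (k + 1) //
        wedgeFun f.toFun k (plusFun (Fin.natAdd n) x) = (Fin.natAdd m b).succ} := by
      simp only [h0]
      exact i2
    let E : {x // wedgeFun f.toFun k x = (Fin.natAdd m b).succ} ≃ {x : Fin (k + 1) //
        wedgeFun f.toFun k (plusFun (Fin.natAdd n) x) = (Fin.natAdd m b).succ} :=
      { toFun := fun _ => ⟨b.succ, h0 b.succ⟩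
        invFun := fun _ => ⟨(Fin.natAdd n b).succ, wedgeFun_right f.toFun k b⟩
        left_inv := fun _ => Subsingleton.elim _ _
        right_inv := fun _ => Subsingleton.elim _ _ }
    have h1 := GammaHom.ofInj_comp_dec (plusFun (Fin.natAdd n)) rfl
      (plusFun_fiber (Fin.natAdd_injective k n)) (f.wedge k) (Fin.natAdd m b).succ hy E (by
        intro x
        exact congrArg Subtype.val (Subsingleton.elim
          (⟨(Fin.natAdd n b).succ, wedgeFun_right f.toFun k b⟩ :
            {x // wedgeFun f.toFun k x = (Fin.natAdd m b).succ}) x))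
    have h2 : (f.wedge k).dec (Fin.natAdd m b).succ hy =
        P.pt {x // wedgeFun f.toFun k x = (Fin.natAdd m b).succ} := by
      have := Fin.addCases_right (motive := fun c : Fin (m + k) => c.succ ≠ 0 →
        P.on {x // wedgeFun f.toFun k x = c.succ})
        (left := fun b _ => P.transport (wedgeFiber f.toFun f.map_zero k b)
          (f.dec b.succ (Fin.succ_ne_zero b)))
        (right := fun b _ => haveI := wedgeFun_fiber f.toFun k b
          P.pt {x // wedgeFun f.toFun k x = (Fin.natAdd m b).succ}) b
      exact congrFun this hy
    refine (congrArg (P.transport e) (h1.trans (congrArg (P.transport E) h2))).trans ?_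
    refine (congrArg (P.transport e) (P.transport_pt E)).trans ?_
    exact P.transport_pt (X := {x : Fin (k + 1) //
        wedgeFun f.toFun k (plusFun (Fin.natAdd n) x) = (Fin.natAdd m b).succ})
        (Y := {x : Fin (k + 1) // plusFun (Fin.natAdd m) x = (Fin.natAdd m b).succ}) e

theorem GammaHom.wedge_unique {n m k : ℕ} (f : GammaHom P n m) {t : GammaHom P (n + k) (m + k)}
    (hl : (GammaHom.inl n k).comp t = f.comp (GammaHom.inl m k))
    (hr : (GammaHom.inr n k).comp t = GammaHom.inr m k) : f.wedge k = t := by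
  refine GammaHom.wedge_ext ((f.inl_wedge k).trans hl.symm) ((f.inr_wedge k).trans hr.symm)
    (fun y hy => ?_)
  change (∀ a : Fin n, wedgeFun f.toFun k (Fin.castAdd k a).succ ≠ y) ∨
    (∀ b : Fin k, wedgeFun f.toFun k (Fin.natAdd n b).succ ≠ y)
  simp only [wedgeFun_left, wedgeFun_right]
  induction y using wedge_cases with
  | h0 => exact absurd rfl hy
  | hl b => exact Or.inr (fun c h => plusFun_castAdd_ne b.succ c h.symm)
  | hr b => exact Or.inl (fun a => plusFun_castAdd_ne _ b)

theorem GammaHom.wedge_id (n k : ℕ) :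
    (GammaHom.id n : GammaHom P n n).wedge k = GammaHom.id (n + k) := by
  apply GammaHom.wedge_unique
  · rw [GammaHom.id_comp, GammaHom.comp_id]
  · rw [GammaHom.comp_id]

theorem GammaHom.wedge_comp {n m l : ℕ} (f : GammaHom P n m) (g : GammaHom P m l) (k : ℕ) :
    (f.comp g).wedge k = (f.wedge k).comp (g.wedge k) := by
  apply GammaHom.wedge_unique
  · rw [← GammaHom.comp_assoc, GammaHom.inl_wedge, GammaHom.comp_assoc, GammaHom.inl_wedge,
      GammaHom.comp_assoc]
  · rw [← GammaHom.comp_assoc, GammaHom.inr_wedge, GammaHom.inr_wedge]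

theorem GammaHom.wedge_fst {n m : ℕ} (f : GammaHom P n m) (k : ℕ) :
    (f.wedge k).comp (GammaHom.fst m k) = (GammaHom.fst n k).comp f := by
  symm
  refine GammaHom.wedge_ext ?_ (GammaHom.eq_of_zero ?_ ?_) (fun y hy => Or.inr (fun b => ?_))
  · rw [← GammaHom.comp_assoc, ← GammaHom.comp_assoc, GammaHom.inl_wedge, GammaHom.inl_fst,
      GammaHom.comp_assoc, GammaHom.inl_fst, GammaHom.id_comp, GammaHom.comp_id]
  · intro x
    induction x using Fin.cases with
    | zero => exact GammaHom.map_zero _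
    | succ b =>
      change f.toFun (fstFun n k (Fin.natAdd n b).succ) = 0
      rw [fstFun_right, f.map_zero]
  · intro x
    induction x using Fin.cases with
    | zero => exact GammaHom.map_zero _
    | succ b =>
      change fstFun m k (wedgeFun f.toFun k (Fin.natAdd n b).succ) = 0
      rw [wedgeFun_right, fstFun_right]
  · change f.toFun (fstFun n k (Fin.natAdd n b).succ) ≠ y
    rw [fstFun_right, f.map_zero]
    exact hy.symm

theorem GammaHom.wedge_snd {n m : ℕ} (f : GammaHom P n m) (k : ℕ) :
    (f.wedge k).comp (GammaHom.snd m k) = GammaHom.snd n k := by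
  symm
  refine GammaHom.wedge_ext (GammaHom.eq_of_zero ?_ ?_) ?_ (fun y hy => Or.inl (fun a => ?_))
  · intro x
    induction x using Fin.cases with
    | zero => exact GammaHom.map_zero _
    | succ a => exact sndFun_left n k a
  · intro x
    induction x using Fin.cases with
    | zero => exact GammaHom.map_zero _
    | succ a =>
      change sndFun m k (wedgeFun f.toFun k (Fin.castAdd k a).succ) = 0
      rw [wedgeFun_left]
      generalize f.toFun a.succ = z
      induction z using Fin.cases with
      | zero => rfl
      | succ c => exact sndFun_left m k c
  · rw [← GammaHom.comp_assoc, GammaHom.inr_wedge, GammaHom.inr_snd, GammaHom.inr_snd]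
  · change sndFun n k (Fin.castAdd k a).succ ≠ y
    rw [sndFun_left]
    exact hy.symm

/-- The functor `- ∨ X` on `Γ(P)`. -/
noncomputable def wedgeFunctor (X : Gamma P) : Gamma P ⥤ Gamma P where
  obj Y := Gamma.ob (Y.n + X.n)
  map f := GammaHom.wedge f X.n
  map_id Y := GammaHom.wedge_id Y.n X.n
  map_comp f g := GammaHom.wedge_comp f g X.n

end Wedge

/-! ### Cross-effects -/

/-- The structure used in the definition of cross-effects: an object `0` with natural morphisms
`X → 0`, functors `- ∨ X`, and natural morphisms `Y ∨ X → Y` and `Y ∨ X → X`. -/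
structure WedgeData (C : Type w) [Category.{u} C] where
  zero : C
  toZero : 𝟭 C ⟶ (Functor.const C).obj zero
  wedge : C → C ⥤ C
  fst : ∀ X, wedge X ⟶ 𝟭 C
  snd : ∀ X, wedge X ⟶ (Functor.const C).obj X

/-- `Γ(P)` with its null object `[0]`, the wedges `[n] ∨ [k] = [n + k]`, and the retractions
of a wedge onto its summands. -/
noncomputable def gammaWedge (P : UnitaryOperad.{u}) : WedgeData (Gamma P) where
  zero := Gamma.ob 0
  toZero :=
    { app := fun X => (GammaHom.zero X.n 0 : GammaHom P X.n 0)
      naturality := fun X Y f => by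
        change GammaHom.comp f (GammaHom.zero Y.n 0) =
          GammaHom.comp (GammaHom.zero X.n 0) (GammaHom.id 0)
        exact GammaHom.eq_of_zero (fun _ => rfl) (fun _ => rfl) }
  wedge := wedgeFunctor
  fst X :=
    { app := fun Y => (GammaHom.fst Y.n X.n : GammaHom P (Y.n + X.n) Y.n)
      naturality := fun Y Z f => GammaHom.wedge_fst f X.n }
  snd X :=
    { app := fun Y => (GammaHom.snd Y.n X.n : GammaHom P (Y.n + X.n) X.n)
      naturality := fun Y Z f => (GammaHom.wedge_snd f X.n).trans (GammaHom.comp_id _).symm }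

/-- `Γ(P)ᵒᵖ` with the object `[0]`, the wedges `[n] ∨ [k] = [n + k]`, and the morphisms of
`Γ(P)ᵒᵖ` given by the inclusions of the summands into a wedge. -/
noncomputable def gammaOpWedge (P : UnitaryOperad.{u}) : WedgeData (Gamma P)ᵒᵖ where
  zero := Opposite.op (Gamma.ob 0)
  toZero :=
    { app := fun X => Quiver.Hom.op (V := Gamma P) (X := Gamma.ob 0) (Y := X.unop)
        (GammaHom.zero 0 X.unop.n : GammaHom P 0 X.unop.n)
      naturality := fun X Y f => by
        apply Quiver.Hom.unop_inj
        change GammaHom.comp (GammaHom.zero 0 Y.unop.n) f.unop =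
          GammaHom.comp (GammaHom.id 0) (GammaHom.zero 0 X.unop.n)
        exact GammaHom.eq_of_zero (fun _ => GammaHom.map_zero f.unop) (fun _ => rfl) }
  wedge X := (wedgeFunctor X.unop).op
  fst X :=
    { app := fun Y => Quiver.Hom.op (V := Gamma P) (X := Y.unop)
        (Y := (wedgeFunctor X.unop).obj Y.unop)
        (GammaHom.inl Y.unop.n X.unop.n : GammaHom P Y.unop.n (Y.unop.n + X.unop.n))
      naturality := fun Y Z f => by
        apply Quiver.Hom.unop_inj
        exact GammaHom.inl_wedge f.unop X.unop.n }
  snd X :=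
    { app := fun Y => Quiver.Hom.op (V := Gamma P) (X := X.unop)
        (Y := (wedgeFunctor X.unop).obj Y.unop)
        (GammaHom.inr Y.unop.n X.unop.n : GammaHom P X.unop.n (Y.unop.n + X.unop.n))
      naturality := fun Y Z f => by
        apply Quiver.Hom.unop_inj
        exact (GammaHom.inr_wedge f.unop X.unop.n).trans (GammaHom.id_comp _).symm }

section CrossEffects

variable {C : Type w} [Category.{u} C]

/-- The subfunctor of `F` given by a family of subgroups `S X` of `F(X)`. -/
noncomputable def subFunctor (F : C ⥤ AddCommGrpCat.{v}) (S : ∀ X, AddSubgroup (F.obj X))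
    (hS : ∀ {X Y : C} (f : X ⟶ Y), ∀ x ∈ S X, (F.map f).hom x ∈ S Y) : C ⥤ AddCommGrpCat.{v} where
  obj X := AddCommGrpCat.of (S X)
  map {X Y} f := AddCommGrpCat.ofHom
    (((F.map f).hom.comp (S X).subtype).codRestrict (S Y) (fun x => hS f x.1 x.2))
  map_id X := by
    ext x
    exact congrArg (fun t => t.hom x.1) (F.map_id X)
  map_comp f g := by
    ext x
    exact congrArg (fun t => t.hom x.1) (F.map_comp f g)

namespace WedgeData

variable (D : WedgeData C) (F : C ⥤ AddCommGrpCat.{v})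

/-- `cr₁F(X) = Ker (F(X) → F(0))`. -/
noncomputable def cr₁ : C ⥤ AddCommGrpCat.{v} :=
  subFunctor F (fun X => (F.map (D.toZero.app X)).hom.ker) (by
    intro X Y f x hx
    rw [AddMonoidHom.mem_ker] at hx ⊢
    have h := congrArg (fun t => (F.map t).hom x) (D.toZero.naturality f)
    simp only [F.map_comp] at h
    refine h.trans ?_
    exact (congrArg (F.map (((Functor.const C).obj D.zero).map f)).hom hx).trans (map_zero _))

/-- `cr₂F(-, X) : Y ↦ Ker (F(Y ∨ X) → F(Y) ⊕ F(X))`. -/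
noncomputable def cr₂ (X : C) : C ⥤ AddCommGrpCat.{v} :=
  subFunctor (D.wedge X ⋙ F)
    (fun Y => ((F.map ((D.fst X).app Y)).hom.prod (F.map ((D.snd X).app Y)).hom).ker) (by
    intro Y Z f x hx
    rw [AddMonoidHom.mem_ker] at hx ⊢
    have h1 := congrArg (fun t => (F.map t).hom x) ((D.fst X).naturality f)
    have h2 := congrArg (fun t => (F.map t).hom x) ((D.snd X).naturality f)
    simp only [F.map_comp] at h1 h2
    refine Prod.ext (h1.trans ?_) (h2.trans ?_)
    · exact (congrArg (F.map f).hom (congrArg Prod.fst hx)).trans (map_zero _)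
    · exact (congrArg (F.map _).hom (congrArg Prod.snd hx)).trans (map_zero _))

/-- The functor `X₁ ↦ crₙF(X₁, X₂, …, Xₙ)`, for the list `X₂, …, Xₙ`. -/
noncomputable def crFunctor : List C → (C ⥤ AddCommGrpCat.{v})
  | [] => D.cr₁ F
  | [X] => D.cr₂ F X
  | X :: Y :: l => D.cr₂ (crFunctor (Y :: l)) X

/-- The cross-effect `crₙF(X₁, …, Xₙ)`; for `n = 0` it is `F(0)`. -/
noncomputable def crossEffect : List C → AddCommGrpCat.{v}
  | [] => F.obj D.zero
  | X :: l => (D.crFunctor F l).obj X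

/-- The wedge `(…(X₁ ∨ X₂) ∨ …) ∨ Xₙ`. -/
def wedgeList : List C → C
  | [] => D.zero
  | X :: l => l.foldl (fun Y Z => (D.wedge Z).obj Y) X

/-- The inclusion of `crₙF(X₁, …, Xₙ)` into `F(X₁ ∨ … ∨ Xₙ)`. -/
noncomputable def crFunctorι : ∀ (l : List C) (X : C),
    (D.crFunctor F l).obj X ⟶ F.obj (D.wedgeList (X :: l))
  | [], X => AddCommGrpCat.ofHom (F.map (D.toZero.app X)).hom.ker.subtype
  | [X], Y => AddCommGrpCat.ofHom
      ((F.map ((D.fst X).app Y)).hom.prod (F.map ((D.snd X).app Y)).hom).ker.subtype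
  | X :: Z :: l, Y => AddCommGrpCat.ofHom
      (((D.crFunctor F (Z :: l)).map ((D.fst X).app Y)).hom.prod
        ((D.crFunctor F (Z :: l)).map ((D.snd X).app Y)).hom).ker.subtype ≫
      crFunctorι (Z :: l) ((D.wedge X).obj Y)

/-- The inclusion of `crₙF(X₁, …, Xₙ)` into `F(X₁ ∨ … ∨ Xₙ)`. -/
noncomputable def crossEffectι : ∀ l : List C, D.crossEffect F l ⟶ F.obj (D.wedgeList l)
  | [] => 𝟙 _
  | X :: l => D.crFunctorι F l X

end WedgeData

end CrossEffects

theorem foldl_wedge {P : UnitaryOperad.{u}} (k : ℕ) (X : Gamma P) :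
    (List.replicate k (Gamma.ob 1)).foldl (fun Y Z => ((gammaWedge P).wedge Z).obj Y) X =
      Gamma.ob (X.n + k) := by
  induction k generalizing X with
  | zero => rfl
  | succ k ih =>
    rw [List.replicate_succ, List.foldl_cons, ih]
    change Gamma.ob (X.n + 1 + k) = _
    rw [Nat.add_right_comm]
    rfl

/-- The wedge of `n` copies of `[1]` is `[n]`. -/
theorem gammaWedge_list (P : UnitaryOperad.{u}) (n : ℕ) :
    (gammaWedge P).wedgeList (List.replicate n (Gamma.ob 1)) = Gamma.ob n := by
  cases n with
  | zero => rfl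
  | succ n =>
    rw [List.replicate_succ]
    refine (foldl_wedge n _).trans ?_
    change Gamma.ob (1 + n) = _
    rw [Nat.add_comm]

theorem foldl_op_wedge {P : UnitaryOperad.{u}} (k : ℕ) (X : (Gamma P)ᵒᵖ) :
    (List.replicate k (Opposite.op (Gamma.ob 1))).foldl
      (fun Y Z => ((gammaOpWedge P).wedge Z).obj Y) X = Opposite.op (Gamma.ob (X.unop.n + k)) := by
  induction k generalizing X with
  | zero => rfl
  | succ k ih =>
    rw [List.replicate_succ, List.foldl_cons, ih]
    change Opposite.op (Gamma.ob (X.unop.n + 1 + k)) = _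
    rw [Nat.add_right_comm]
    rfl

/-- The wedge of `n` copies of `[1]` is `[n]`. -/
theorem gammaOpWedge_list (P : UnitaryOperad.{u}) (n : ℕ) :
    (gammaOpWedge P).wedgeList (List.replicate n (Opposite.op (Gamma.ob 1))) =
      Opposite.op (Gamma.ob n) := by
  cases n with
  | zero => rfl
  | succ n =>
    rw [List.replicate_succ]
    refine (foldl_op_wedge n _).trans ?_
    change Opposite.op (Gamma.ob (1 + n)) = _
    rw [Nat.add_comm]

/-- The inclusion `crₙF([1],…,[1]) → F([n])` of the cross-effect of `F : Γ(P) ⥤ Ab`. -/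
noncomputable def crossInclusion {P : UnitaryOperad.{u}} (F : Gamma P ⥤ AddCommGrpCat.{v}) (n : ℕ) :
    (gammaWedge P).crossEffect F (List.replicate n (Gamma.ob 1)) ⟶ F.obj (Gamma.ob n) :=
  (gammaWedge P).crossEffectι F _ ≫ F.map (eqToHom (gammaWedge_list P n))

/-- The inclusion `c̃rₙG([1],…,[1]) → G([n])` of the cross-effect of `G : Γ(P)ᵒᵖ ⥤ Ab`. -/
noncomputable def crossOpInclusion {P : UnitaryOperad.{u}} (G : (Gamma P)ᵒᵖ ⥤ AddCommGrpCat.{v})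
    (n : ℕ) :
    (gammaOpWedge P).crossEffect G (List.replicate n (Opposite.op (Gamma.ob 1))) ⟶
      G.obj (Opposite.op (Gamma.ob n)) :=
  (gammaOpWedge P).crossEffectι G _ ≫ G.map (eqToHom (gammaOpWedge_list P n))

end DoldKan

open DoldKan

namespace DoldKan

/-! ### Morphisms of `Γ(P)` and idempotents -/

section Morphisms

variable {P : UnitaryOperad.{u}}

/-! A subset A of {1,…,n} gives an endomorphism e_A of [n], the identity on A and zero elsewhere,
and e_A e_B = e_{A ∩ B}. A functor F on Γ(P) therefore carries commuting idempotents F(e_A) on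
F([n]). By inclusion–exclusion over subsets, F([n]) splits into pieces indexed by the subsets μ; the
piece of μ comes from F([|μ|]) along the inclusion and dies as soon as one element of μ is sent to
0. It is thus a copy of the cross-effect at |μ|. The projector onto the piece of the full set is the
alternating sum `crProj`.

The splitting is compatible with a morphism g because only two things can happen to μ. Either g
sends an element of μ to 0, and then F(g) kills the piece of μ (`ev_eq_zero`); or g maps μ onto some
ν, and the inclusion of μ followed by g equals the extension of a morphism of Ω(P) followed by the
inclusion of ν (`restrict_spec`). These are the two clauses in the definition of i_!, whence i_!(cr
F) ≅ F (`crSum_iShriekMap`, `crSum_injective`, `crSum_surjective`). Conversely, i_!(G)(e_A) is the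
projection onto the summands with μ ⊂ A (`iShriekMap_idem`), so the cross-effect of i_!(G) at n is
the summand of the full set, which is G(n).

The contravariant case is dual, with one difference: G(f₊) need not preserve the cross-effect, but
it does preserve the complement R_n. The induced map is therefore taken on quotients, that is,
followed by `crOpProj`, and `crOpProj_plus` removes the inner projections.

In the recursive definition of cross-effects every structure map has a section, so its kernel is the
kernel of an idempotent. The recursion then unwinds to the equations F(e_A)x = 0 for the complements
A of single points (`WedgeData.IdemSystem.isCross_iff`), in one argument for Γ(P) and its opposite.
Naturality in the operad holds because all ingredients come from maps decorated by 1 and 0,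
extensions and restrictions, and a morphism of operads respects these. -/

theorem GammaHom.ofInj_congr {n m : ℕ} {p q : Fin (n + 1) → Fin (m + 1)} (h : ∀ x, p x = q x)
    (hp0 hp hq0 hq) : (GammaHom.ofInj p hp0 hp : GammaHom P n m) = GammaHom.ofInj q hq0 hq := by
  obtain rfl : p = q := funext h
  rfl

/-- A morphism whose image is contained in `A ∪ {0}` factors through the idempotent of `A`. -/
theorem GammaHom.comp_idem {n m : ℕ} (A : Finset (Fin m)) (f : GammaHom P n m)
    (hf : ∀ x a, f.toFun x = a.succ → a ∈ A) : f.comp (GammaHom.idem A) = f := by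
  have h0 : ∀ x, idemFun A (f.toFun x) = f.toFun x := by
    intro x
    have := hf x
    revert this
    generalize f.toFun x = z
    intro hz
    induction z using Fin.cases with
    | zero => rfl
    | succ a => exact if_pos (hz a rfl)
  refine GammaHom.ext' h0 (fun y hy e he => ?_)
  induction y using Fin.cases with
  | zero => exact absurd rfl hy
  | succ b =>
  by_cases hb : b ∈ A
  · have key := GammaHom.comp_ofInj_dec f (idemFun A) rfl (idemFun_fiber A) b.succ hy b.succ
      (if_pos hb) hy (Equiv.subtypeEquivRight (fun x => by rw [h0])) (fun _ => rfl)
    refine (congrArg (P.transport e) key).trans ?_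
    refine (P.transport_trans _ _ _).trans ?_
    exact P.transport_eq_self _ (fun a => Subtype.ext (he _)) _
  -- Over b both fibres are empty, so both decorations lie in the one-element set P(0).
  · have : IsEmpty {x // f.toFun x = b.succ} := ⟨fun x => hb (hf x.1 b x.2)⟩
    exact P.eq_of_isEmpty (X := {x // f.toFun x = b.succ}) _ _

/-- The form in which a killed element enters the alternating sums: such a morphism cannot tell A
from A without a. -/
theorem GammaHom.idem_erase_comp {n m : ℕ} (f : GammaHom P n m) (a : Fin n)
    (ha : f.toFun a.succ = 0) : (GammaHom.idem (Finset.univ.erase a)).comp f = f :=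
  f.idem_comp _ (fun b hb => by
    have : b = a := by simpa using hb
    rw [this, ha])

/-- Dual to `GammaHom.idem_erase_comp`, for an element missed by the image instead of one sent to 0.
-/
theorem GammaHom.comp_idem_erase {n m : ℕ} (f : GammaHom P n m) (b : Fin m)
    (hb : ∀ x, f.toFun x ≠ b.succ) : f.comp (GammaHom.idem (Finset.univ.erase b)) = f :=
  f.comp_idem _ (fun x a hx => by
    simp only [Finset.mem_erase, Finset.mem_univ, and_true]
    rintro rfl
    exact hb x hx)

theorem GammaHom.incl_comp_idem {n : ℕ} {μ A : Finset (Fin n)} (h : μ ⊆ A) :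
    (GammaHom.incl μ : GammaHom P μ.card n).comp (GammaHom.idem A) = GammaHom.incl μ := by
  refine GammaHom.comp_idem _ _ (fun x a hx => h ?_)
  induction x using Fin.cases with
  | zero => exact absurd hx.symm (Fin.succ_ne_zero _)
  | succ k =>
    have hk : (emb μ k).succ = a.succ := hx
    rw [← Fin.succ_injective _ hk]
    exact emb_mem μ k

/-- If `μ ⊄ ν`, the composite `[|μ|] → [n] → [|ν|]` sends a non-zero element to `0`. -/
theorem exists_retrFun_emb_eq_zero {n : ℕ} {μ ν : Finset (Fin n)} (h : ¬ μ ⊆ ν) :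
    ∃ k, retrFun ν (emb μ k).succ = 0 := by
  obtain ⟨a, ha, ha'⟩ := Finset.not_subset.1 h
  obtain ⟨k, rfl⟩ := exists_emb ha
  exact ⟨k, retrFun_notMem ha'⟩

/-- If `ν ⊄ μ`, the composite `[|μ|] → [n] → [|ν|]` misses a non-zero element. -/
theorem exists_retrFun_emb_ne {n : ℕ} {μ ν : Finset (Fin n)} (h : ¬ ν ⊆ μ) :
    ∃ l, ∀ x, retrFun ν (plusFun (emb μ) x) ≠ Fin.succ l := by
  obtain ⟨a, ha, ha'⟩ := Finset.not_subset.1 h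
  obtain ⟨l, rfl⟩ := exists_emb ha
  refine ⟨l, fun x hx => ha' ?_⟩
  induction x using Fin.cases with
  | zero => exact absurd hx.symm (Fin.succ_ne_zero _)
  | succ k =>
    have h1 := plusFun_retrFun ν (emb μ k)
    change retrFun ν (emb μ k).succ = l.succ at hx
    rw [hx] at h1
    split_ifs at h1 with h2
    · rw [show emb ν l = emb μ k from Fin.succ_injective _ h1]
      exact emb_mem μ k
    · exact absurd h1 (Fin.succ_ne_zero _)

/-- If `g(μ)` contains `0`, then some element of `μ` is sent to `0`. -/
theorem exists_eq_zero_of_not_isImage {n m : ℕ} {g : GammaHom P n m} {μ : Finset (Fin n)}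
    (h : ¬ ∃ ν, g.IsImage μ ν) : ∃ k, g.toFun (emb μ k).succ = 0 := by
  by_contra hk
  push Not at hk
  refine h (exists_isImage g μ (fun a ha => ?_))
  obtain ⟨k, rfl⟩ := exists_emb ha
  exact hk k

/-- The idempotent fixes the elements of A and sends all others to 0, so the image of μ avoids 0
exactly when μ ⊂ A. With `restrict_idem` this computes the idempotents on i_! and i_*. -/
theorem isImage_idem {n : ℕ} (A μ ν : Finset (Fin n)) :
    (GammaHom.idem A : GammaHom P n n).IsImage μ ν ↔ μ ⊆ A ∧ μ = ν := by
  have key : μ ⊆ A → (GammaHom.idem A : GammaHom P n n).IsImage μ μ := by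
    intro h
    rw [GammaHom.IsImage, Set.image_image]
    refine Set.image_congr (fun a ha => ?_)
    exact if_pos (h ha)
  constructor
  · intro h
    have hA : μ ⊆ A := by
      intro a ha
      by_contra ha'
      exact h.ne_zero a ha (if_neg ha')
    exact ⟨hA, (key hA).unique h⟩
  · rintro ⟨h, rfl⟩
    exact key h

theorem restrict_idem {n : ℕ} (A μ : Finset (Fin n)) (h) :
    (GammaHom.idem A : GammaHom P n n).restrict μ μ h = OmegaHom.id μ.card := by
  symm
  apply restrict_unique
  rw [OmegaHom.plus_id, GammaHom.id_comp, GammaHom.incl_comp_idem ((isImage_idem A μ μ).1 h).1]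

/-- The identification `{1,…,n} = {1,…,m}` for `n = m`. -/
noncomputable def OmegaHom.ofEq {n m : ℕ} (h : n = m) : OmegaHom P n m where
  toFun := Fin.cast h
  surj y := ⟨Fin.cast h.symm y, rfl⟩
  dec y :=
    haveI : Subsingleton {x // Fin.cast h x = y} :=
      ⟨fun a b => Subtype.ext (Fin.cast_injective h (a.2.trans b.2.symm))⟩
    P.pt {x // Fin.cast h x = y}

theorem OmegaHom.ofEq_rfl (n : ℕ) : (OmegaHom.ofEq rfl : OmegaHom P n n) = OmegaHom.id n := rfl

theorem OmegaHom.ofEq_comp {n m : ℕ} (h : n = m) (h' : m = n) :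
    (OmegaHom.ofEq h : OmegaHom P n m).comp (OmegaHom.ofEq h') = OmegaHom.id n := by
  subst h
  exact OmegaHom.id_comp _

theorem OmegaHom.ofEq_plus {n m : ℕ} (h : n = m) : (OmegaHom.ofEq h : OmegaHom P n m).plus =
    GammaHom.inj (Fin.cast h) (Fin.cast_injective h) := by
  subst h
  rw [OmegaHom.ofEq_rfl, OmegaHom.plus_id]
  refine GammaHom.ofInj_congr (fun x => ?_) _ _ _ _
  induction x using Fin.cases with
  | zero => rfl
  | succ a => rfl

/-- The summand of the full set is G(|univ|), and |univ| = n is not definitional. The morphisms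
`OmegaHom.ofEq` bridge this gap, and here the inclusion of the full set is recognised as one of
them. -/
theorem GammaHom.incl_univ (n : ℕ) :
    (GammaHom.incl (Finset.univ : Finset (Fin n)) : GammaHom P _ n) =
      (OmegaHom.ofEq (Finset.card_fin n)).plus := by
  rw [OmegaHom.ofEq_plus]
  -- A finite ordered set has only one increasing enumeration, and the cast is increasing.
  have h : emb (Finset.univ : Finset (Fin n)) = Fin.cast (Finset.card_fin n) :=
    (Finset.orderEmbOfFin_unique rfl (fun _ => Finset.mem_univ _)
      (fun _ _ hab => hab)).symm
  exact GammaHom.ofInj_congr (fun x => by rw [h]) _ _ _ _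

/-- This is where surjectivity of morphisms of Ω(P) matters: the top summand goes to the top
summand. -/
theorem OmegaHom.plus_isImage_univ {n m : ℕ} (f : OmegaHom P n m) :
    f.plus.IsImage Finset.univ Finset.univ := by
  rw [GammaHom.IsImage, Set.image_image, Finset.coe_univ, Finset.coe_univ]
  change (fun a => (f.toFun a).succ) '' Set.univ = _
  rw [← Set.image_image Fin.succ f.toFun, Set.image_univ_of_surjective f.surj]

/-- The right-hand side satisfies the equation of `restrict_spec`, which determines the restriction.
Hence i_!(G)(f₊) is G(f) on the top summand, up to the identifications. -/
theorem OmegaHom.restrict_plus_univ {n m : ℕ} (f : OmegaHom P n m) :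
    f.plus.restrict Finset.univ Finset.univ f.plus_isImage_univ =
      ((OmegaHom.ofEq (Finset.card_fin n)).comp f).comp
        (OmegaHom.ofEq (Finset.card_fin m).symm) := by
  symm
  apply restrict_unique
  rw [GammaHom.incl_univ, GammaHom.incl_univ, ← OmegaHom.plus_comp, OmegaHom.comp_assoc,
    OmegaHom.ofEq_comp, OmegaHom.comp_id, OmegaHom.plus_comp]

end Morphisms

/-! ### The equivalence between `cr` and `i_!` -/

section Covariant

variable {P : UnitaryOperad.{u}}

/-- The projection of `F([n])` onto the cross-effect. -/
noncomputable def crProj (F : Gamma P ⥤ AddCommGrpCat.{v}) (n : ℕ) :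
    F.obj (Gamma.ob n) →+ F.obj (Gamma.ob n) :=
  ∑ A : Finset (Fin n), (-1 : ℤ) ^ Aᶜ.card • ev F (GammaHom.idem A)

theorem crProj_apply (F : Gamma P ⥤ AddCommGrpCat.{v}) (n : ℕ) (x) :
    crProj F n x = ∑ A : Finset (Fin n), (-1 : ℤ) ^ Aᶜ.card • ev F (GammaHom.idem A) x := by
  rw [crProj, AddMonoidHom.finsetSum_apply]
  rfl

/-- After the retraction that kills k, the terms of A and of A without k agree and carry opposite
signs, so the alternating sum cancels in pairs. -/
theorem crProj_mem (F : Gamma P ⥤ AddCommGrpCat.{v}) (n : ℕ) (x) : crProj F n x ∈ crSub F n := by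
  rw [mem_crSub]
  intro k
  rw [crProj_apply, map_sum]
  simp only [map_zsmul]
  refine sum_compl_eq_zero k _ (fun A => ?_)
  rw [← ev_comp, ← ev_comp]
  -- The retraction absorbs the idempotent of the complement of k, so only B without k is seen.
  have h : ∀ B : Finset (Fin n), (GammaHom.idem B : GammaHom P n n).comp
      (GammaHom.retr (Finset.univ.erase k)) =
        (GammaHom.idem (B ∩ Finset.univ.erase k)).comp (GammaHom.retr (Finset.univ.erase k)) := by
    intro B
    rw [← GammaHom.idem_comp_idem, GammaHom.comp_assoc,
      GammaHom.idem_erase_comp _ k (retrFun_notMem (by simp))]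
  rw [h A, h (A.erase k)]
  congr 4
  ext b
  simp

/-- If A is not the full set, its idempotent sends some element to 0 and kills the cross-effect;
only the identity term survives. -/
theorem crProj_eq_self (F : Gamma P ⥤ AddCommGrpCat.{v}) {n : ℕ} {x} (hx : x ∈ crSub F n) :
    crProj F n x = x := by
  rw [crProj_apply, Finset.sum_eq_single Finset.univ]
  · rw [GammaHom.idem_univ, ev_id]
    simp
  · intro A _ hA
    obtain ⟨a, ha⟩ : ∃ a, a ∉ A := by
      by_contra h
      push Not at h
      exact hA (Finset.eq_univ_iff_forall.2 h)
    rw [ev_eq_zero hx _ a (if_neg ha), smul_zero]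
  · intro h
    exact absurd (Finset.mem_univ _) h

/-- A morphism which misses a non-zero element induces zero on the quotient of `F([m])` by the
kernel of the projection onto the cross-effect. -/
theorem crProj_ev_eq_zero (F : Gamma P ⥤ AddCommGrpCat.{v}) {n m : ℕ} (f : GammaHom P n m)
    (b : Fin m) (hb : ∀ x, f.toFun x ≠ b.succ) (x) : crProj F m (ev F f x) = 0 := by
  -- Since f misses b, it absorbs the idempotent of the complement of b; the terms of A and of A
  -- without b then coincide and cancel.
  rw [← f.comp_idem_erase b hb, crProj_apply]
  refine sum_compl_eq_zero b _ (fun A => ?_)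
  rw [ev_comp, ← ev_comp F (GammaHom.idem _), ← ev_comp F (GammaHom.idem _),
    GammaHom.idem_comp_idem, GammaHom.idem_comp_idem]
  congr 3
  ext c
  simp

/-- The natural map `⨁_{μ ⊂ {1,…,n}} cr(F)(|μ|) → F([n])`. -/
noncomputable def crSum (F : Gamma P ⥤ AddCommGrpCat.{v}) (n : ℕ) :
    IShriek ((cr P).obj F) n →+ F.obj (Gamma.ob n) :=
  DirectSum.toAddMonoid fun μ => (ev F (GammaHom.incl μ)).comp (crSub F μ.card).subtype

theorem crSum_ι (F : Gamma P ⥤ AddCommGrpCat.{v}) {n : ℕ} (μ : Finset (Fin n))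
    (x : crSub F μ.card) :
    crSum F n (IShriek.ι ((cr P).obj F) μ x) = ev F (GammaHom.incl μ) x.1 :=
  DirectSum.toAddMonoid_of _ _ _

/-- Naturality of `crSum`. If g(μ) = ν, the inclusion of μ followed by g is the extended restriction
followed by the inclusion of ν. If 0 ∈ g(μ), that composite kills a non-zero element, hence also the
cross-effect. -/
theorem crSum_iShriekMap (F : Gamma P ⥤ AddCommGrpCat.{v}) {n m : ℕ} (g : GammaHom P n m) (z) :
    crSum F m (iShriekMap ((cr P).obj F) g z) = ev F g (crSum F n z) := by
  refine DFunLike.congr_fun (f := (crSum F m).comp (iShriekMap ((cr P).obj F) g))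
    (g := (ev F g).comp (crSum F n)) ?_ z
  apply DirectSum.addHom_ext
  intro μ x
  change crSum F m (iShriekMap _ g (IShriek.ι ((cr P).obj F) μ x)) =
    ev F g (crSum F n (IShriek.ι ((cr P).obj F) μ x))
  rw [iShriekMap_ι]
  refine Eq.trans ?_ (congrArg (ev F g) (crSum_ι F μ x)).symm
  rw [← ev_comp]
  by_cases h : ∃ ν, g.IsImage μ ν
  · obtain ⟨ν, h⟩ := h
    rw [iShriekComp_of _ g h, ← restrict_spec h, ev_comp]
    exact crSum_ι F ν _
  · rw [iShriekComp_zero _ g h]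
    obtain ⟨k, hk⟩ := exists_eq_zero_of_not_isImage h
    exact (map_zero _).trans (ev_eq_zero x.2 _ k hk).symm

/-- The projection onto the summand `G(|μ|)`. -/
def IShriek.proj (G : Omega P ⥤ AddCommGrpCat.{v}) {n : ℕ} (μ : Finset (Fin n)) :
    IShriek G n →+ G.obj (Omega.ob μ.card) :=
  DFinsupp.evalAddMonoidHom μ

theorem IShriek.proj_ι (G : Omega P ⥤ AddCommGrpCat.{v}) {n : ℕ} (μ : Finset (Fin n)) (x) :
    IShriek.proj G μ (IShriek.ι G μ x) = x := DirectSum.of_eq_same _ _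

theorem IShriek.proj_ι_of_ne (G : Omega P ⥤ AddCommGrpCat.{v}) {n : ℕ} {μ ν : Finset (Fin n)}
    (h : μ ≠ ν) (x) : IShriek.proj G ν (IShriek.ι G μ x) = 0 :=
  DirectSum.of_eq_of_ne _ _ _ h.symm

theorem IShriek.ext {G : Omega P ⥤ AddCommGrpCat.{v}} {n : ℕ} {z z' : IShriek G n}
    (h : ∀ μ, IShriek.proj G μ z = IShriek.proj G μ z') : z = z' := DFinsupp.ext h

/-- The projection of `F([n])` onto `cr(F)(|μ|)`. -/
noncomputable def crComponent (F : Gamma P ⥤ AddCommGrpCat.{v}) {n : ℕ} (μ : Finset (Fin n)) :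
    F.obj (Gamma.ob n) →+ crSub F μ.card :=
  ((crProj F μ.card).comp (ev F (GammaHom.retr μ))).codRestrict _ (fun _ => crProj_mem F _ _)

/-- The matrix of components is diagonal. For ν = μ the composite [|ν|] → [n] → [|μ|] is the
identity. For ν strictly inside μ it misses an element and dies under the projection. For ν not
inside μ it sends an element to 0 and dies on the cross-effect. -/
theorem crComponent_crSum (F : Gamma P ⥤ AddCommGrpCat.{v}) {n : ℕ} (μ : Finset (Fin n)) (z) :
    crComponent F μ (crSum F n z) = IShriek.proj ((cr P).obj F) μ z := by
  refine DFunLike.congr_fun (f := (crComponent F μ).comp (crSum F n))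
    (g := IShriek.proj ((cr P).obj F) μ) ?_ z
  apply DirectSum.addHom_ext
  intro ν x
  refine (congrArg (crComponent F μ) (crSum_ι F ν x)).trans ?_
  apply Subtype.ext
  change crProj F _ (ev F (GammaHom.retr μ) (ev F (GammaHom.incl ν) x.1)) = _
  rw [← ev_comp]
  by_cases h : ν = μ
  · subst h
    rw [GammaHom.incl_comp_retr, ev_id, crProj_eq_self F x.2]
    exact congrArg Subtype.val (IShriek.proj_ι ((cr P).obj F) ν x).symm
  · refine Eq.trans ?_ (congrArg Subtype.val (IShriek.proj_ι_of_ne ((cr P).obj F) h x)).symm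
    by_cases h1 : ν ⊆ μ
    · obtain ⟨l, hl⟩ := exists_retrFun_emb_ne (fun h2 => h (h1.antisymm h2))
      exact crProj_ev_eq_zero F _ l hl _
    · obtain ⟨k, hk⟩ := exists_retrFun_emb_eq_zero h1
      rw [ev_eq_zero x.2 _ k hk, map_zero]
      rfl

theorem crSum_injective (F : Gamma P ⥤ AddCommGrpCat.{v}) (n : ℕ) :
    Function.Injective (crSum F n) := by
  intro z z' h
  refine IShriek.ext (fun μ => ?_)
  rw [← crComponent_crSum, h, crComponent_crSum]

/-- Induction on n: up to sign, x differs from its projection to the cross-effect by terms F(e_A)x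
with A proper, and these come from F([|A|]) with |A| < n. -/
theorem crSum_surjective (F : Gamma P ⥤ AddCommGrpCat.{v}) (n : ℕ) :
    Function.Surjective (crSum F n) := by
  induction n using Nat.strong_induction_on with
  | _ n ih =>
  suffices h : ∀ x, x ∈ (crSum F n).range from h
  intro x
  have h1 : crProj F n x ∈ (crSum F n).range := by
    -- The top summand is the cross-effect at |univ|, so the projection of x is first moved there
    -- along the isomorphism [n] → [|univ|].
    have h2 : ev F (GammaHom.retr Finset.univ) (crProj F n x) ∈
        crSub F (Finset.univ : Finset (Fin n)).card := by
      rw [mem_crSub]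
      intro k
      rw [← ev_comp]
      refine ev_eq_zero (crProj_mem F n x) _ (emb Finset.univ k) ?_
      change retrFun (Finset.univ.erase k) (retrFun Finset.univ (emb Finset.univ k).succ) = 0
      rw [retrFun_emb, retrFun_notMem (Finset.notMem_erase _ _)]
    refine ⟨IShriek.ι ((cr P).obj F) Finset.univ ⟨_, h2⟩, (crSum_ι F _ _).trans ?_⟩
    rw [← ev_comp, GammaHom.retr_comp_incl, GammaHom.idem_univ, ev_id]
  -- The term of the full set is x itself; it remains to see that all other terms lie in the range.
  rw [crProj_apply, ← Finset.sum_erase_add _ _ (Finset.mem_univ Finset.univ),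
    GammaHom.idem_univ, ev_id, Finset.compl_univ, Finset.card_empty, pow_zero, one_smul] at h1
  refine (AddSubgroup.add_mem_cancel_left _ (AddSubgroup.sum_mem _ (fun A hA => ?_))).1 h1
  refine AddSubgroup.zsmul_mem _ ?_ _
  have hA' : A.card < n := by
    simpa using (Finset.card_lt_univ_of_notMem
      (x := (by_contra (fun h => (Finset.mem_erase.1 hA).1
        (Finset.eq_univ_iff_forall.2 (not_exists_not.1 h))) : ∃ a, a ∉ A).choose)
      (Exists.choose_spec (p := fun a => a ∉ A) _))
  obtain ⟨z, hz⟩ := ih A.card hA' (ev F (GammaHom.retr A) x)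
  -- The idempotent of A is the retraction to [|A|] followed by the inclusion. Induction handles the
  -- retracted element, and naturality of `crSum` carries its preimage along the inclusion.
  refine ⟨iShriekMap ((cr P).obj F) (GammaHom.incl A) z, ?_⟩
  rw [crSum_iShriekMap, hz, ← ev_comp, GammaHom.retr_comp_incl]

/-- The isomorphism `i_!(cr(F)) ≅ F`. -/
noncomputable def iShriekCrIso (F : Gamma P ⥤ AddCommGrpCat.{v}) :
    (iShriek P).obj ((cr P).obj F) ≅ F :=
  NatIso.ofComponents
    (fun X => (AddEquiv.ofBijective (crSum F X.n)
      ⟨crSum_injective F X.n, crSum_surjective F X.n⟩).toAddCommGrpIso)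
    (fun {X Y} g => by
      ext z
      exact crSum_iShriekMap (n := X.n) (m := Y.n) F g z)

/-! ### The cross-effect of i_!(G) is its top summand -/

theorem iShriekMap_idem (G : Omega P ⥤ AddCommGrpCat.{v}) {n : ℕ} (A μ : Finset (Fin n)) (z) :
    IShriek.proj G μ (iShriekMap G (GammaHom.idem A) z) =
      if μ ⊆ A then IShriek.proj G μ z else 0 := by
  refine (DFunLike.congr_fun (f := (IShriek.proj G μ).comp (iShriekMap G (GammaHom.idem A)))
    (g := if μ ⊆ A then IShriek.proj G μ else 0) ?_ z).trans (by split_ifs <;> rfl)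
  apply DirectSum.addHom_ext
  intro ν x
  change IShriek.proj G μ (iShriekMap G _ (IShriek.ι G ν x)) = _
  rw [iShriekMap_ι]
  -- On a subset of A the idempotent restricts to the identity; any other subset contains an element
  -- sent to 0, and its summand is killed.
  by_cases h : ν ⊆ A
  · rw [iShriekComp_of G _ ((isImage_idem A ν ν).2 ⟨h, rfl⟩), restrict_idem]
    change IShriek.proj G μ (IShriek.ι G ν (evΩ G _ x)) = _
    rw [evΩ_id]
    by_cases h' : ν = μ
    · subst h'
      rw [if_pos h]
    · rw [IShriek.proj_ι_of_ne G h']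
      split_ifs
      · exact (IShriek.proj_ι_of_ne G h' x).symm
      · rfl
  · rw [iShriekComp_zero G _ (fun ⟨ρ, hρ⟩ => h ((isImage_idem A ν ρ).1 hρ).1)]
    refine (map_zero (IShriek.proj G μ)).trans ?_
    split_ifs with h'
    · refine (IShriek.proj_ι_of_ne G (fun hh => h ?_) x).symm
      rwa [hh]
    · rfl

/-- The retraction killing k and the idempotent of the complement of k each factor through the
other, so they have the same kernel. The idempotents have the advantage of staying on [n]. -/
theorem mem_crSub_iff_idem {F : Gamma P ⥤ AddCommGrpCat.{v}} {n : ℕ} {x : F.obj (Gamma.ob n)} :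
    x ∈ crSub F n ↔ ∀ k, ev F (GammaHom.idem (Finset.univ.erase k)) x = 0 := by
  rw [mem_crSub]
  refine forall_congr' (fun k => ⟨fun h => ?_, fun h => ?_⟩)
  · rw [← GammaHom.retr_comp_incl, ev_comp, h, map_zero]
  · rw [← GammaHom.idem_erase_comp (GammaHom.retr (Finset.univ.erase k)) k
      (retrFun_notMem (by simp)), ev_comp, h, map_zero]

/-- The equation for k says that all components at subsets missing k vanish; together they leave
only the full set. Membership is spelled out so that z is read as an element of the direct sum. -/
theorem mem_crSub_iShriek {G : Omega P ⥤ AddCommGrpCat.{v}} {n : ℕ} {z : IShriek G n} :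
    @Membership.mem (IShriek G n) (AddSubgroup (IShriek G n)) _
      (crSub ((iShriek P).obj G) n) z ↔
      z = IShriek.ι G Finset.univ (IShriek.proj G Finset.univ z) := by
  refine (mem_crSub_iff_idem (F := (iShriek P).obj G) (n := n) (x := z)).trans ?_
  change (∀ k, iShriekMap G (GammaHom.idem (Finset.univ.erase k)) z = 0) ↔ _
  constructor
  · intro h
    refine IShriek.ext (fun μ => ?_)
    by_cases hμ : μ = Finset.univ
    · subst hμ
      exact (IShriek.proj_ι G _ _).symm
    · rw [IShriek.proj_ι_of_ne G (Ne.symm hμ)]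
      obtain ⟨a, ha⟩ : ∃ a, a ∉ μ := by
        by_contra h
        push Not at h
        exact hμ (Finset.eq_univ_iff_forall.2 h)
      -- As μ lies in the complement of a, the idempotent keeps the component at μ, while by
      -- assumption it sends z to 0.
      have h1 := iShriekMap_idem G (Finset.univ.erase a) μ z
      rw [h a, if_pos (Finset.subset_erase.2 ⟨Finset.subset_univ _, ha⟩), map_zero] at h1
      exact h1.symm
  · intro h k
    rw [h, iShriekMap_ι, iShriekComp_zero]
    · rfl
    · rintro ⟨ν, hν⟩
      exact (Finset.subset_erase.1 ((isImage_idem _ _ ν).1 hν).1).2 (Finset.mem_univ k)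

theorem evΩ_ofEq_ofEq (G : Omega P ⥤ AddCommGrpCat.{v}) {n m : ℕ} (h : n = m) (h' : m = n) (x) :
    evΩ G (OmegaHom.ofEq h') (evΩ G (OmegaHom.ofEq h) x) = x := by
  rw [← evΩ_comp, OmegaHom.ofEq_comp, evΩ_id]

/-- The identification `G(n) = cr(i_!(G))(n)`. -/
noncomputable def crIShriekEquiv (G : Omega P ⥤ AddCommGrpCat.{v}) (n : ℕ) :
    G.obj (Omega.ob n) ≃+ crSub ((iShriek P).obj G) n where
  toFun x := ⟨IShriek.ι G Finset.univ (evΩ G (OmegaHom.ofEq (Finset.card_fin n).symm) x),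
    mem_crSub_iShriek.2 (congrArg (IShriek.ι G Finset.univ) (IShriek.proj_ι G _ _).symm)⟩
  invFun z := evΩ G (OmegaHom.ofEq (Finset.card_fin n)) (IShriek.proj G Finset.univ z.1)
  right_inv z := by
    apply Subtype.ext
    refine Eq.trans ?_ (mem_crSub_iShriek.1 z.2).symm
    refine congrArg (IShriek.ι G Finset.univ) ?_
    rw [evΩ_ofEq_ofEq]
  left_inv x := by
    refine (congrArg (evΩ G _) (IShriek.proj_ι G _ _)).trans ?_
    rw [evΩ_ofEq_ofEq]
  map_add' x x' := Subtype.ext ((congrArg (IShriek.ι G Finset.univ) (map_add _ x x')).trans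
    (map_add _ _ _))

/-- The isomorphism `G ≅ cr(i_!(G))`. -/
noncomputable def crIShriekIso (G : Omega P ⥤ AddCommGrpCat.{v}) :
    G ≅ (cr P).obj ((iShriek P).obj G) :=
  NatIso.ofComponents (fun X => (crIShriekEquiv G X.n).toAddCommGrpIso) (fun {X Y} f => by
    ext x
    apply Subtype.ext
    change IShriek.ι G Finset.univ (evΩ G (OmegaHom.ofEq (Finset.card_fin Y.n).symm)
        (evΩ (n := X.n) (m := Y.n) G f x)) =
      iShriekMap G (OmegaHom.plus f) (IShriek.ι G Finset.univ
        (evΩ G (OmegaHom.ofEq (Finset.card_fin X.n).symm) x))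
    -- On the full sets f₊ restricts to f conjugated by the identifications |univ| = n, which then
    -- cancel.
    rw [iShriekMap_ι, iShriekComp_of G _ (OmegaHom.plus_isImage_univ f),
      OmegaHom.restrict_plus_univ]
    refine congrArg (IShriek.ι G Finset.univ) ?_
    rw [evΩ_comp, evΩ_comp, evΩ_ofEq_ofEq])

/-- The functors `cr` and `i_!` are mutually inverse equivalences. -/
noncomputable def crEquivalence (P : UnitaryOperad.{u}) :
    (Gamma P ⥤ AddCommGrpCat.{v}) ≌ (Omega P ⥤ AddCommGrpCat.{v}) :=
  -- No triangle identity is required: this constructor corrects the unit and leaves both functors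
  -- as they are.
  CategoryTheory.Equivalence.mk (cr P) (iShriek P)
    (NatIso.ofComponents (fun F => iShriekCrIso F) (fun {F F'} τ => by
      apply NatTrans.ext
      funext X
      apply AddCommGrpCat.hom_ext
      apply DirectSum.addHom_ext
      intro μ x
      refine (congrArg (crSum F' X.n) (DirectSum.map_of _ _ _)).trans ?_
      refine (crSum_ι F' μ _).trans ?_
      refine Eq.trans ?_ (congrArg (τ.app X).hom (crSum_ι F μ x)).symm
      -- On the summand of μ, naturality in F is naturality of τ at the inclusion of μ.
      have := τ.naturality (X := Gamma.ob μ.card) (Y := Gamma.ob X.n) (GammaHom.incl μ)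
      exact (congrArg (fun t => t.hom x.1) this).symm)).symm
    (NatIso.ofComponents (fun G => crIShriekIso G) (fun {G G'} τ => by
      apply NatTrans.ext
      funext X
      ext x
      apply Subtype.ext
      refine Eq.trans ?_ (DirectSum.map_of _ _ _).symm
      have := τ.naturality (X := Omega.ob X.n) (Y := Omega.ob _)
        (OmegaHom.ofEq (Finset.card_fin X.n).symm)
      exact congrArg (IShriek.ι G' Finset.univ) (congrArg (fun t => t.hom x) this).symm)).symm

end Covariant

/-! ### The equivalence between `c̃r` and `i_*` -/

section Contravariant

variable {P : UnitaryOperad.{u}}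

open Opposite

/-- A morphism missing b factors through the inclusion that omits b, and the cross-effect is killed
by all such inclusions. -/
theorem evOp_eq_zero {G : (Gamma P)ᵒᵖ ⥤ AddCommGrpCat.{v}} {n m : ℕ}
    {x : G.obj (op (Gamma.ob m))} (hx : x ∈ crOpSub G m) (f : GammaHom P n m) (b : Fin m)
    (hb : ∀ a, f.toFun a ≠ b.succ) : evOp G f x = 0 := by
  rw [← f.comp_idem_erase b hb, ← GammaHom.retr_comp_incl, evOp_comp, evOp_comp,
    mem_crOpSub.1 hx b, map_zero, map_zero]

/-- A morphism which sends a non-zero element to `0` induces zero on the quotient of `G([n])` by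
the kernel of the projection onto the cross-effect. -/
theorem crOpProj_evOp_eq_zero (G : (Gamma P)ᵒᵖ ⥤ AddCommGrpCat.{v}) {n m : ℕ} (f : GammaHom P n m)
    (a : Fin n) (ha : f.toFun a.succ = 0) (x) : crOpProj G n (evOp G f x) = 0 := by
  rw [← f.idem_erase_comp a ha, evOp_comp, crOpProj_idem]

/-- In the alternating sum the full set contributes x. Every other A misses some a, so its
idempotent factors through the retraction killing a, and its term lies in the image of that
retraction. -/
theorem sub_crOpProj_mem (G : (Gamma P)ᵒᵖ ⥤ AddCommGrpCat.{v}) (n : ℕ) (x) :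
    x - crOpProj G n x ∈ crOpRel G n := by
  rw [crOpProj_apply, ← Finset.sum_erase_add _ _ (Finset.mem_univ Finset.univ),
    GammaHom.idem_univ, evOp_id, Finset.compl_univ, Finset.card_empty, pow_zero, one_smul,
    sub_add_cancel_right]
  refine AddSubgroup.neg_mem _ (AddSubgroup.sum_mem _ (fun A hA => ?_))
  refine AddSubgroup.zsmul_mem _ ?_ _
  obtain ⟨a, ha⟩ : ∃ a, a ∉ A := by
    by_contra h
    push Not at h
    exact (Finset.mem_erase.1 hA).1 (Finset.eq_univ_iff_forall.2 h)
  refine AddSubgroup.mem_iSup_of_mem a ?_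
  rw [← GammaHom.idem_erase_comp (GammaHom.idem A) a (if_neg ha), ← GammaHom.retr_comp_incl,
    evOp_comp, evOp_comp]
  exact ⟨_, rfl⟩

theorem crOpRel_le_ker (G : (Gamma P)ᵒᵖ ⥤ AddCommGrpCat.{v}) (n : ℕ) :
    crOpRel G n ≤ (crOpProj G n).ker := by
  refine iSup_le (fun k => ?_)
  rintro _ ⟨x, rfl⟩
  exact crOpProj_evOp_eq_zero G _ k (retrFun_notMem (Finset.notMem_erase _ _)) x

/-- `crOpProj` is a projector: its values lie in the cross-effect, where it is the identity; it
vanishes on R_n, and it changes elements only by R_n. -/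
theorem isCompl_crOpSub_crOpRel (G : (Gamma P)ᵒᵖ ⥤ AddCommGrpCat.{v}) (n : ℕ) :
    IsCompl (crOpSub G n) (crOpRel G n) := by
  constructor
  · rw [AddSubgroup.disjoint_def]
    intro x hx hx'
    rw [← crOpProj_eq_self G hx]
    exact crOpRel_le_ker G n hx'
  · rw [codisjoint_iff_le_sup]
    intro x _
    rw [← add_sub_cancel (crOpProj G n x) x]
    exact AddSubgroup.add_mem_sup (crOpProj_mem G n x) (sub_crOpProj_mem G n x)

/-- By `crOpProj_plus`, the projection of G(f₊)x depends only on the projection of x, which is 0 on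
R_m; and an element with zero projection lies in R_n. Surjectivity of f enters through
`crOpProj_plus`. -/
theorem evOp_plus_mem_crOpRel (G : (Gamma P)ᵒᵖ ⥤ AddCommGrpCat.{v}) {n m : ℕ} (f : OmegaHom P n m)
    {x} (hx : x ∈ crOpRel G m) : evOp G f.plus x ∈ crOpRel G n := by
  have h := sub_crOpProj_mem G n (evOp G f.plus x)
  have h1 : crOpProj G m x = 0 := crOpRel_le_ker G m hx
  rwa [← crOpProj_plus, h1, map_zero, map_zero, sub_zero] at h

/-- The projection onto the summand `G(|μ|)`. -/
def IStar.proj (G : (Omega P)ᵒᵖ ⥤ AddCommGrpCat.{v}) {n : ℕ} (μ : Finset (Fin n)) :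
    IStar G n →+ G.obj (op (Omega.ob μ.card)) :=
  DFinsupp.evalAddMonoidHom μ

theorem IStar.proj_ι (G : (Omega P)ᵒᵖ ⥤ AddCommGrpCat.{v}) {n : ℕ} (μ : Finset (Fin n)) (x) :
    IStar.proj G μ (IStar.ι G μ x) = x := DirectSum.of_eq_same _ _

theorem IStar.proj_ι_of_ne (G : (Omega P)ᵒᵖ ⥤ AddCommGrpCat.{v}) {n : ℕ} {μ ν : Finset (Fin n)}
    (h : μ ≠ ν) (x) : IStar.proj G ν (IStar.ι G μ x) = 0 :=
  DirectSum.of_eq_of_ne _ _ _ h.symm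

theorem IStar.ext {G : (Omega P)ᵒᵖ ⥤ AddCommGrpCat.{v}} {n : ℕ} {z z' : IStar G n}
    (h : ∀ μ, IStar.proj G μ z = IStar.proj G μ z') : z = z' := DFinsupp.ext h

theorem IStar.proj_sum_ι (G : (Omega P)ᵒᵖ ⥤ AddCommGrpCat.{v}) {n : ℕ}
    (x : ∀ μ : Finset (Fin n), G.obj (op (Omega.ob μ.card))) (μ : Finset (Fin n)) :
    IStar.proj G μ (∑ ν, IStar.ι G ν (x ν)) = x μ := by
  rw [map_sum, Finset.sum_eq_single μ, IStar.proj_ι]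
  · intro ν _ h
    exact IStar.proj_ι_of_ne G h _
  · intro h
    exact absurd (Finset.mem_univ _) h

theorem proj_iStarMap_ι (G : (Omega P)ᵒᵖ ⥤ AddCommGrpCat.{v}) {n m : ℕ} (h : GammaHom P n m)
    (μ : Finset (Fin m)) (ν : Finset (Fin n)) (x) :
    IStar.proj G ν (iStarMap G h (IStar.ι G μ x)) = iStarEntry G h μ ν x := by
  rw [iStarMap_ι]
  exact IStar.proj_sum_ι G (fun ν => iStarEntry G h μ ν x) ν

/-- The image of ν under h is unique, so row ν of the matrix of i_*(G)(h) has a single possibly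
non-zero entry, in the column h(ν). When h(ν) contains 0 the row is zero, which is
`proj_iStarMap_eq_zero`. -/
theorem proj_iStarMap (G : (Omega P)ᵒᵖ ⥤ AddCommGrpCat.{v}) {n m : ℕ} {h : GammaHom P n m}
    {μ : Finset (Fin m)} {ν : Finset (Fin n)} (H : h.IsImage ν μ) (z) :
    IStar.proj G ν (iStarMap G h z) = evΩOp G (h.restrict ν μ H) (IStar.proj G μ z) := by
  refine DFunLike.congr_fun (f := (IStar.proj G ν).comp (iStarMap G h))
    (g := (evΩOp G (h.restrict ν μ H)).comp (IStar.proj G μ)) ?_ z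
  apply DirectSum.addHom_ext
  intro ρ x
  refine (proj_iStarMap_ι G h ρ ν x).trans ?_
  by_cases hρ : ρ = μ
  · subst hρ
    rw [iStarEntry_of G H]
    exact congrArg _ (IStar.proj_ι G ρ x).symm
  · rw [iStarEntry_zero G (fun H' => hρ (H'.unique H))]
    exact (map_zero _).symm.trans
      (congrArg (evΩOp G (h.restrict ν μ H)) (IStar.proj_ι_of_ne G hρ x).symm)

theorem proj_iStarMap_eq_zero (G : (Omega P)ᵒᵖ ⥤ AddCommGrpCat.{v}) {n m : ℕ} {h : GammaHom P n m}
    {ν : Finset (Fin n)} (H : ¬ ∃ μ, h.IsImage ν μ) (z) :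
    IStar.proj G ν (iStarMap G h z) = 0 := by
  refine DFunLike.congr_fun (f := (IStar.proj G ν).comp (iStarMap G h)) (g := 0) ?_ z
  apply DirectSum.addHom_ext
  intro ρ x
  refine (proj_iStarMap_ι G h ρ ν x).trans ?_
  rw [iStarEntry_zero G (fun H' => H ⟨ρ, H'⟩)]
  rfl

/-- The projection of `G([n])` onto `c̃r(G)(|μ|)`. -/
noncomputable def crOpComponent (G : (Gamma P)ᵒᵖ ⥤ AddCommGrpCat.{v}) {n : ℕ}
    (μ : Finset (Fin n)) : G.obj (op (Gamma.ob n)) →+ crOpSub G μ.card :=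
  ((crOpProj G μ.card).comp (evOp G (GammaHom.incl μ))).codRestrict _
    (fun _ => crOpProj_mem G _ _)

/-- The natural map `G([n]) → ⨁_{μ ⊂ {1,…,n}} c̃r(G)(|μ|)`. -/
noncomputable def crOpSplit (G : (Gamma P)ᵒᵖ ⥤ AddCommGrpCat.{v}) (n : ℕ) :
    G.obj (op (Gamma.ob n)) →+ IStar ((crOp P).obj G) n :=
  ∑ μ : Finset (Fin n), (IStar.ι ((crOp P).obj G) μ).comp (crOpComponent G μ)

theorem proj_crOpSplit (G : (Gamma P)ᵒᵖ ⥤ AddCommGrpCat.{v}) {n : ℕ} (μ : Finset (Fin n)) (x) :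
    IStar.proj ((crOp P).obj G) μ (crOpSplit G n x) = crOpComponent G μ x := by
  rw [crOpSplit, AddMonoidHom.finsetSum_apply]
  exact IStar.proj_sum_ι ((crOp P).obj G) (fun μ => crOpComponent G μ x) μ

/-- Naturality of `crOpSplit`, checked on the component at ν. If h(ν) = μ, `restrict_spec` matches
the two sides up to an inner projection, which `crOpProj_plus` removes. Otherwise an element of ν
goes to 0, and the projection kills the component. -/
theorem crOpSplit_evOp (G : (Gamma P)ᵒᵖ ⥤ AddCommGrpCat.{v}) {n m : ℕ} (h : GammaHom P n m) (x) :
    crOpSplit G n (evOp G h x) = iStarMap ((crOp P).obj G) h (crOpSplit G m x) := by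
  refine IStar.ext (fun ν => ?_)
  rw [proj_crOpSplit]
  by_cases H : ∃ μ, h.IsImage ν μ
  · obtain ⟨μ, H⟩ := H
    rw [proj_iStarMap _ H, proj_crOpSplit]
    apply Subtype.ext
    change crOpProj G _ (evOp G (GammaHom.incl ν) (evOp G h x)) =
      crOpProj G _ (evOp G (h.restrict ν μ H).plus (crOpProj G _ (evOp G (GammaHom.incl μ) x)))
    rw [crOpProj_plus, ← evOp_comp, ← evOp_comp, restrict_spec]
  · rw [proj_iStarMap_eq_zero _ H]
    obtain ⟨k, hk⟩ := exists_eq_zero_of_not_isImage H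
    apply Subtype.ext
    change crOpProj G _ (evOp G (GammaHom.incl ν) (evOp G h x)) = 0
    rw [← evOp_comp]
    exact crOpProj_evOp_eq_zero G _ k hk x

/-- The retractions provide a section of `crOpSplit`. The components at ν ≠ μ vanish for the two
reasons of `crComponent_crSum` with roles exchanged: a missed element now kills the cross-effect,
and an element sent to 0 is killed by the projection. -/
theorem crOpSplit_evOp_retr (G : (Gamma P)ᵒᵖ ⥤ AddCommGrpCat.{v}) {n : ℕ} (μ : Finset (Fin n))
    (x : crOpSub G μ.card) :
    crOpSplit G n (evOp G (GammaHom.retr μ) x.1) = IStar.ι ((crOp P).obj G) μ x := by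
  refine IStar.ext (fun ν => ?_)
  rw [proj_crOpSplit]
  apply Subtype.ext
  change crOpProj G _ (evOp G (GammaHom.incl ν) (evOp G (GammaHom.retr μ) x.1)) = _
  rw [← evOp_comp]
  by_cases h : μ = ν
  · subst h
    rw [GammaHom.incl_comp_retr, evOp_id, crOpProj_eq_self G x.2]
    exact congrArg Subtype.val (IStar.proj_ι ((crOp P).obj G) μ x).symm
  · refine Eq.trans ?_ (congrArg Subtype.val (IStar.proj_ι_of_ne ((crOp P).obj G) h x)).symm
    by_cases h1 : ν ⊆ μ
    · obtain ⟨l, hl⟩ := exists_retrFun_emb_ne (fun h2 => h (h2.antisymm h1))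
      rw [evOp_eq_zero x.2 _ l hl, map_zero]
      rfl
    · obtain ⟨k, hk⟩ := exists_retrFun_emb_eq_zero h1
      exact crOpProj_evOp_eq_zero G _ k hk _

theorem crOpSplit_surjective (G : (Gamma P)ᵒᵖ ⥤ AddCommGrpCat.{v}) (n : ℕ) :
    Function.Surjective (crOpSplit G n) := by
  suffices h : (crOpSplit G n).comp (DirectSum.toAddMonoid fun μ =>
      (evOp G (GammaHom.retr μ)).comp (crOpSub G μ.card).subtype) = AddMonoidHom.id _ from
    fun z => ⟨_, DFunLike.congr_fun h z⟩
  apply DirectSum.addHom_ext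
  intro μ x
  refine Eq.trans ?_ (crOpSplit_evOp_retr G μ x)
  exact congrArg (crOpSplit G n) (DirectSum.toAddMonoid_of _ _ _)

/-- Induction on n. If all components of x vanish, naturality and induction make its restriction to
every proper subset vanish; so x lies in the cross-effect and is determined by its top component,
which is 0. -/
theorem crOpSplit_injective (G : (Gamma P)ᵒᵖ ⥤ AddCommGrpCat.{v}) (n : ℕ) :
    Function.Injective (crOpSplit G n) := by
  induction n using Nat.strong_induction_on with
  | _ n ih =>
  rw [injective_iff_map_eq_zero]
  intro x hx
  have h1 : crOpProj G n x = x := by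
    rw [crOpProj_apply, Finset.sum_eq_single Finset.univ]
    · rw [GammaHom.idem_univ, evOp_id]
      simp
    · intro A _ hA
      have hA' : A.card < n := by
        simpa using Finset.card_lt_univ_of_notMem
          (not_forall.1 (fun h => hA (Finset.eq_univ_iff_forall.2 h))).choose_spec
      have h2 : evOp G (GammaHom.incl A) x = 0 := by
        refine (injective_iff_map_eq_zero _).1 (ih _ hA') _ ?_
        rw [crOpSplit_evOp, hx, map_zero]
      rw [← GammaHom.retr_comp_incl, evOp_comp, h2, map_zero, smul_zero]
    · intro h
      exact absurd (Finset.mem_univ _) h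
  -- The top component is the projection of x transported along the bijection |univ| = n. It remains
  -- to remove the projection and the transport.
  have h3 := congrArg Subtype.val (proj_crOpSplit G Finset.univ x)
  rw [hx, map_zero] at h3
  have h4 : evOp G (GammaHom.incl Finset.univ) x ∈ crOpSub G (Finset.univ : Finset (Fin n)).card := by
    rw [mem_crOpSub]
    intro k
    rw [← evOp_comp, ← h1]
    -- Omitting the k-th point of [|univ|] amounts to missing the corresponding point of [n].
    refine evOp_eq_zero (crOpProj_mem G n x) _ (emb Finset.univ k) (fun a ha => ?_)
    induction a using Fin.cases with
    | zero => exact Fin.succ_ne_zero _ ha.symm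
    | succ j =>
      have h5 : emb (Finset.univ.erase k) j = k :=
        emb_injective _ (Fin.succ_injective _ ha)
      exact Finset.notMem_erase k _ (h5 ▸ emb_mem _ j)
  have h5 : evOp G (GammaHom.incl Finset.univ) x = 0 := by
    rw [← crOpProj_eq_self G h4]
    exact h3.symm
  -- The inclusion of the full set has the retraction as an inverse, so x itself vanishes.
  rw [← evOp_id G x, ← GammaHom.idem_univ, ← GammaHom.retr_comp_incl, evOp_comp, h5, map_zero]

/-- The isomorphism `G ≅ i_*(c̃r(G))`. -/
noncomputable def iStarCrOpIso (G : (Gamma P)ᵒᵖ ⥤ AddCommGrpCat.{v}) :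
    G ≅ (iStar P).obj ((crOp P).obj G) :=
  NatIso.ofComponents
    (fun X => (AddEquiv.ofBijective (crOpSplit G X.unop.n)
      ⟨crOpSplit_injective G X.unop.n, crOpSplit_surjective G X.unop.n⟩).toAddCommGrpIso)
    (fun {X Y} h => by
      ext z
      exact crOpSplit_evOp (n := Y.unop.n) (m := X.unop.n) G h.unop z)

/-! ### The cross-effect of i_*(G) is its top summand -/

theorem iStarMap_idem (G : (Omega P)ᵒᵖ ⥤ AddCommGrpCat.{v}) {n : ℕ} (A μ : Finset (Fin n)) (z) :
    IStar.proj G μ (iStarMap G (GammaHom.idem A) z) =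
      if μ ⊆ A then IStar.proj G μ z else 0 := by
  split_ifs with h
  · rw [proj_iStarMap G ((isImage_idem A μ μ).2 ⟨h, rfl⟩), restrict_idem, evΩOp_id]
  · exact proj_iStarMap_eq_zero G (fun ⟨ν, hν⟩ => h ((isImage_idem A μ ν).1 hν).1) z

theorem mem_crOpSub_iff_idem {G : (Gamma P)ᵒᵖ ⥤ AddCommGrpCat.{v}} {n : ℕ}
    {x : G.obj (op (Gamma.ob n))} :
    x ∈ crOpSub G n ↔ ∀ k, evOp G (GammaHom.idem (Finset.univ.erase k)) x = 0 := by
  rw [mem_crOpSub]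
  refine forall_congr' (fun k => ⟨fun h => ?_, fun h => ?_⟩)
  · rw [← GammaHom.retr_comp_incl, evOp_comp, h, map_zero]
  · rw [← GammaHom.incl_comp_idem (subset_refl (Finset.univ.erase k)), evOp_comp, h, map_zero]

theorem mem_crOpSub_iStar {G : (Omega P)ᵒᵖ ⥤ AddCommGrpCat.{v}} {n : ℕ} {z : IStar G n} :
    @Membership.mem (IStar G n) (AddSubgroup (IStar G n)) _
      (crOpSub ((iStar P).obj G) n) z ↔
      z = IStar.ι G Finset.univ (IStar.proj G Finset.univ z) := by
  refine (mem_crOpSub_iff_idem (G := (iStar P).obj G) (n := n) (x := z)).trans ?_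
  change (∀ k, iStarMap G (GammaHom.idem (Finset.univ.erase k)) z = 0) ↔ _
  constructor
  · intro h
    refine IStar.ext (fun μ => ?_)
    by_cases hμ : μ = Finset.univ
    · subst hμ
      exact (IStar.proj_ι G _ _).symm
    · rw [IStar.proj_ι_of_ne G (Ne.symm hμ)]
      obtain ⟨a, ha⟩ : ∃ a, a ∉ μ := by
        by_contra h
        push Not at h
        exact hμ (Finset.eq_univ_iff_forall.2 h)
      have h1 := iStarMap_idem G (Finset.univ.erase a) μ z
      rw [h a, if_pos (Finset.subset_erase.2 ⟨Finset.subset_univ _, ha⟩), map_zero] at h1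
      exact h1.symm
  · intro h k
    refine IStar.ext (fun μ => ?_)
    rw [iStarMap_idem, map_zero]
    split_ifs with hμ
    · rw [h]
      refine IStar.proj_ι_of_ne G ?_ _
      rintro rfl
      exact (Finset.subset_erase.1 hμ).2 (Finset.mem_univ k)
    · rfl

theorem evΩOp_ofEq_ofEq (G : (Omega P)ᵒᵖ ⥤ AddCommGrpCat.{v}) {n m : ℕ} (h : n = m) (h' : m = n)
    (x) : evΩOp G (OmegaHom.ofEq h) (evΩOp G (OmegaHom.ofEq h') x) = x := by
  rw [← evΩOp_comp, OmegaHom.ofEq_comp, evΩOp_id]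

/-- The identification `G(n) = c̃r(i_*(G))(n)`. -/
noncomputable def crOpIStarEquiv (G : (Omega P)ᵒᵖ ⥤ AddCommGrpCat.{v}) (n : ℕ) :
    G.obj (op (Omega.ob n)) ≃+ crOpSub ((iStar P).obj G) n where
  toFun x := ⟨IStar.ι G Finset.univ (evΩOp G (OmegaHom.ofEq (Finset.card_fin n)) x),
    mem_crOpSub_iStar.2 (congrArg (IStar.ι G Finset.univ) (IStar.proj_ι G _ _).symm)⟩
  invFun z := evΩOp G (OmegaHom.ofEq (Finset.card_fin n).symm) (IStar.proj G Finset.univ z.1)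
  right_inv z := by
    apply Subtype.ext
    refine Eq.trans ?_ (mem_crOpSub_iStar.1 z.2).symm
    refine congrArg (IStar.ι G Finset.univ) ?_
    rw [evΩOp_ofEq_ofEq]
  left_inv x := by
    refine (congrArg (evΩOp G _) (IStar.proj_ι G _ _)).trans ?_
    rw [evΩOp_ofEq_ofEq]
  map_add' x x' := Subtype.ext ((congrArg (IStar.ι G Finset.univ) (map_add _ x x')).trans
    (map_add _ _ _))

/-- The projection changes z only by images of the retractions r_k. As r_k sends k to 0, the full
set has no image under it, so the top component of such an image is 0. Thus the projection built
into c̃r is invisible on top components. -/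
theorem proj_univ_crOpProj (G : (Omega P)ᵒᵖ ⥤ AddCommGrpCat.{v}) {n : ℕ}
    (z : ((iStar P).obj G).obj (op (Gamma.ob n))) :
    IStar.proj G Finset.univ (crOpProj ((iStar P).obj G) n z) = IStar.proj G Finset.univ z := by
  have h : z - crOpProj ((iStar P).obj G) n z ∈
      (IStar.proj G (Finset.univ : Finset (Fin n))).ker := by
    refine (?_ : crOpRel ((iStar P).obj G) n ≤ _) (sub_crOpProj_mem ((iStar P).obj G) n z)
    refine iSup_le (fun k => ?_)
    rintro _ ⟨x, rfl⟩
    refine proj_iStarMap_eq_zero G (h := GammaHom.retr (Finset.univ.erase k)) ?_ x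
    rintro ⟨μ, hμ⟩
    exact hμ.ne_zero k (Finset.mem_univ k) (retrFun_notMem (Finset.notMem_erase _ _))
  exact (sub_eq_zero.1 ((map_sub (IStar.proj G Finset.univ) _ _).symm.trans
    (AddMonoidHom.mem_ker.1 h))).symm

/-- The isomorphism `G ≅ c̃r(i_*(G))`. -/
noncomputable def crOpIStarIso (G : (Omega P)ᵒᵖ ⥤ AddCommGrpCat.{v}) :
    G ≅ (crOp P).obj ((iStar P).obj G) :=
  NatIso.ofComponents (fun X => (crOpIStarEquiv G X.unop.n).toAddCommGrpIso) (fun {X Y} f => by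
    ext x
    -- The inverse reads off the top component, where the projection can be dropped and f₊ acts
    -- through f.
    apply (crOpIStarEquiv G Y.unop.n).symm.injective
    refine ((crOpIStarEquiv G Y.unop.n).symm_apply_apply _).trans ?_
    refine Eq.trans ?_ (congrArg (evΩOp G (OmegaHom.ofEq (Finset.card_fin Y.unop.n).symm))
      (proj_univ_crOpProj G (iStarMap G (OmegaHom.plus f.unop)
        (IStar.ι G Finset.univ (evΩOp G (OmegaHom.ofEq (Finset.card_fin X.unop.n)) x))))).symm
    rw [proj_iStarMap G (OmegaHom.plus_isImage_univ f.unop),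
      OmegaHom.restrict_plus_univ, IStar.proj_ι, evΩOp_comp, evΩOp_comp, evΩOp_ofEq_ofEq,
      evΩOp_ofEq_ofEq]
    rfl)

/-- The functors `c̃r` and `i_*` are mutually inverse equivalences. -/
noncomputable def crOpEquivalence (P : UnitaryOperad.{u}) :
    ((Gamma P)ᵒᵖ ⥤ AddCommGrpCat.{v}) ≌ ((Omega P)ᵒᵖ ⥤ AddCommGrpCat.{v}) :=
  CategoryTheory.Equivalence.mk (crOp P) (iStar P)
    (NatIso.ofComponents (fun G => iStarCrOpIso G) (fun {G G'} τ => by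
      apply NatTrans.ext
      funext X
      ext x
      refine IStar.ext (fun μ => ?_)
      refine (proj_crOpSplit G' μ _).trans ?_
      refine Eq.trans ?_ (DirectSum.map_apply (fun μ : Finset (Fin X.unop.n) =>
        (((crOp P).map τ).app (op (Omega.ob μ.card))).hom) μ (crOpSplit G X.unop.n x)).symm
      refine Eq.trans ?_ (congrArg (((crOp P).map τ).app (op (Omega.ob μ.card))).hom
        (proj_crOpSplit G μ x)).symm
      apply Subtype.ext
      change crOpProj G' _ (evOp G' _ ((τ.app (op (Gamma.ob X.unop.n))).hom x)) =
        (τ.app (op (Gamma.ob _))).hom (crOpProj G _ (evOp G (GammaHom.incl μ) x))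
      -- The component at μ is restriction to μ followed by an alternating sum of idempotents, and τ
      -- commutes with both.
      rw [natTrans_crOpProj, natTrans_evOp]))
    (NatIso.ofComponents (fun G => crOpIStarIso G) (fun {G G'} τ => by
      apply NatTrans.ext
      funext X
      ext x
      apply Subtype.ext
      refine Eq.trans ?_ (DirectSum.map_of _ _ _).symm
      have := τ.naturality (Quiver.Hom.op (V := Omega P) (X := Omega.ob _)
        (Y := Omega.ob X.unop.n) (OmegaHom.ofEq (Finset.card_fin X.unop.n)))
      exact congrArg (IStar.ι G' Finset.univ) (congrArg (fun t => t.hom x) this).symm)).symm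

end Contravariant

/-! ### Iterated cross-effects as intersections of kernels -/

namespace WedgeData

section

variable {C : Type w} [Category.{u} C] (D : WedgeData C) (F : C ⥤ AddCommGrpCat.{v})

theorem map_comp_apply {X Y Z : C} (f : X ⟶ Y) (g : Y ⟶ Z) (x : F.obj X) :
    (F.map (f ≫ g)).hom x = (F.map g).hom ((F.map f).hom x) :=
  congrArg (fun t => t.hom x) (F.map_comp f g)

/-- F(s) is injective because F(t) is a left inverse of it. Kernels of maps to various objects
become kernels of endomorphisms of one object, and so can be compared. -/
theorem map_eq_zero_iff_of_retract {X Y : C} {t : X ⟶ Y} {s : Y ⟶ X} (h : s ≫ t = 𝟙 Y)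
    (x : F.obj X) : (F.map t).hom x = 0 ↔ (F.map (t ≫ s)).hom x = 0 := by
  constructor
  · intro hx
    rw [map_comp_apply, hx, map_zero]
  · intro hx
    have h1 : t ≫ s ≫ t = t := by rw [h, Category.comp_id]
    rw [← h1, ← Category.assoc, map_comp_apply, hx, map_zero]

/-- The map `(…(Y ∨ X₂) ∨ …) ∨ Xₙ → (…(Z ∨ X₂) ∨ …) ∨ Xₙ` induced by `f : Y → Z`. -/
def wedgeListMap : ∀ (l : List C) {Y Z : C}, (Y ⟶ Z) →
    (D.wedgeList (Y :: l) ⟶ D.wedgeList (Z :: l))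
  | [], _, _, f => f
  | X :: l, _, _, f => wedgeListMap l ((D.wedge X).map f)

theorem wedgeListMap_id (l : List C) (Y : C) :
    D.wedgeListMap l (𝟙 Y) = 𝟙 (D.wedgeList (Y :: l)) := by
  induction l generalizing Y with
  | nil => rfl
  | cons X l ih =>
    change D.wedgeListMap l ((D.wedge X).map (𝟙 Y)) = _
    rw [(D.wedge X).map_id]
    exact ih _

theorem wedgeListMap_comp (l : List C) {Y Z W : C} (f : Y ⟶ Z) (g : Z ⟶ W) :
    D.wedgeListMap l (f ≫ g) = D.wedgeListMap l f ≫ D.wedgeListMap l g := by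
  induction l generalizing Y Z W with
  | nil => rfl
  | cons X l ih =>
    change D.wedgeListMap l ((D.wedge X).map (f ≫ g)) = _
    rw [(D.wedge X).map_comp]
    exact ih _ _

/-- Each cross-effect restricts the action of F on the iterated wedge, one wedge at a time; the
recursion on the list follows this construction. -/
theorem crFunctorι_naturality : ∀ (l : List C) {Y Z : C} (f : Y ⟶ Z)
    (x : (D.crFunctor F l).obj Y),
    (D.crFunctorι F l Z).hom (((D.crFunctor F l).map f).hom x) =
      (F.map (D.wedgeListMap l f)).hom ((D.crFunctorι F l Y).hom x)
  | [], _, _, _, _ => rfl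
  | [_], _, _, _, _ => rfl
  | X :: V :: l, _, _, f, x =>
    crFunctorι_naturality (V :: l) ((D.wedge X).map f) (Subtype.val x)

theorem crFunctorι_injective : ∀ (l : List C) (Y : C),
    Function.Injective (D.crFunctorι F l Y).hom
  | [], _ => Subtype.val_injective
  | [_], _ => Subtype.val_injective
  | X :: V :: l, Y => fun _ _ h =>
    Subtype.val_injective (crFunctorι_injective (V :: l) ((D.wedge X).obj Y) h)

/-- The equations which define the cross-effect `crₙF(X₁, …, Xₙ)` in `F(X₁ ∨ … ∨ Xₙ)`. -/
def IsCross : ∀ (l : List C) (Y : C), F.obj (D.wedgeList (Y :: l)) → Prop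
  | [], Y, x => (F.map (D.toZero.app Y)).hom x = 0
  | [X], Y, x => (F.map ((D.fst X).app Y)).hom x = 0 ∧ (F.map ((D.snd X).app Y)).hom x = 0
  | X :: Z :: l, Y, x => IsCross (Z :: l) ((D.wedge X).obj Y) x ∧
      (F.map (D.wedgeListMap (Z :: l) ((D.fst X).app Y))).hom x = 0 ∧
      (F.map (D.wedgeListMap (Z :: l) ((D.snd X).app Y))).hom x = 0

/-- The kernel conditions are imposed on the previous cross-effect, a subfunctor of F. Its inclusion
is natural and injective, so vanishing there can be tested in F of the full wedge. -/
theorem mem_range_crFunctorι : ∀ (l : List C) (Y : C) (x : F.obj (D.wedgeList (Y :: l))),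
    x ∈ (D.crFunctorι F l Y).hom.range ↔ D.IsCross F l Y x
  | [], Y, x => by
    constructor
    · rintro ⟨y, rfl⟩
      exact y.2
    · intro h
      exact ⟨⟨x, h⟩, rfl⟩
  | [X], Y, x => by
    constructor
    · rintro ⟨y, rfl⟩
      exact Prod.ext_iff.1 (AddMonoidHom.mem_ker.1 y.2)
    · intro h
      exact ⟨⟨x, AddMonoidHom.mem_ker.2 (Prod.ext h.1 h.2)⟩, rfl⟩
  | X :: Z :: l, Y, x => by
    have key : ∀ {V : C} (f : (D.wedge X).obj Y ⟶ V)
        (y : (D.crFunctor F (Z :: l)).obj ((D.wedge X).obj Y)),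
        ((D.crFunctor F (Z :: l)).map f).hom y = 0 ↔ (F.map (D.wedgeListMap (Z :: l) f)).hom
          ((D.crFunctorι F (Z :: l) ((D.wedge X).obj Y)).hom y) = 0 := by
      intro V f y
      rw [← crFunctorι_naturality]
      exact (map_eq_zero_iff _ (crFunctorι_injective D F (Z :: l) V)).symm
    constructor
    · rintro ⟨y, rfl⟩
      have h := Prod.ext_iff.1 (AddMonoidHom.mem_ker.1 y.2)
      exact ⟨(mem_range_crFunctorι (Z :: l) _ _).1 ⟨y.1, rfl⟩, (key _ y.1).1 h.1,
        (key _ y.1).1 h.2⟩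
    · rintro ⟨h1, h2, h3⟩
      obtain ⟨y, rfl⟩ := (mem_range_crFunctorι (Z :: l) _ _).2 h1
      exact ⟨⟨y, AddMonoidHom.mem_ker.2 (Prod.ext ((key _ y).2 h2) ((key _ y).2 h3))⟩, rfl⟩

/-- Idempotent endomorphisms, indexed by sets of natural numbers, which are compatible with wedges
and which describe the retractions of `Y ∨ X₁` onto its summands. -/
structure IdemSystem (X₁ : C) where
  size : C → ℕ
  idem : ∀ Y : C, (ℕ → Prop) → (Y ⟶ Y)
  idem_congr : ∀ (Y : C) {p q : ℕ → Prop}, (∀ a < size Y, p a ↔ q a) → idem Y p = idem Y q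
  idem_comp : ∀ (Y : C) (p q : ℕ → Prop), idem Y p ≫ idem Y q = idem Y (fun a => p a ∧ q a)
  size_zero : size D.zero = 0
  size_one : size X₁ = 1
  size_wedge : ∀ Y, size ((D.wedge X₁).obj Y) = size Y + 1
  wedge_idem : ∀ (Y : C) (p : ℕ → Prop),
    (D.wedge X₁).map (idem Y p) = idem _ (fun a => a < size Y → p a)
  toZero_retract : ∀ Y, ∃ s : D.zero ⟶ Y, s ≫ D.toZero.app Y = 𝟙 _ ∧
    D.toZero.app Y ≫ s = idem Y (fun _ => False)
  fst_retract : ∀ Y, ∃ s : Y ⟶ (D.wedge X₁).obj Y, s ≫ (D.fst X₁).app Y = 𝟙 _ ∧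
    (D.fst X₁).app Y ≫ s = idem _ (fun a => a < size Y)
  snd_retract : ∀ Y, ∃ s : X₁ ⟶ (D.wedge X₁).obj Y, s ≫ (D.snd X₁).app Y = 𝟙 _ ∧
    (D.snd X₁).app Y ≫ s = idem _ (fun a => size Y ≤ a)

/-! ### Cross-effects at copies of one object as kernels of idempotents -/

namespace IdemSystem

variable {D} {X₁ : C} (S : D.IdemSystem X₁)

/-- Since the idempotents are indexed by predicates on ℕ, regrouping the size as (size Y + 1) + k or
size Y + (k + 1) requires no transport of subsets. -/
theorem size_wedgeList (k : ℕ) (Y : C) :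
    S.size (D.wedgeList (Y :: List.replicate k X₁)) = S.size Y + k := by
  induction k generalizing Y with
  | zero => rfl
  | succ k ih =>
    refine (ih ((D.wedge X₁).obj Y)).trans ?_
    rw [S.size_wedge]
    omega

/-- The summands adjoined by the wedges are left fixed, so the condition p is imposed only on the
indices of Y. -/
theorem wedgeListMap_idem (k : ℕ) (Y : C) (p : ℕ → Prop) :
    D.wedgeListMap (List.replicate k X₁) (S.idem Y p) =
      S.idem (D.wedgeList (Y :: List.replicate k X₁)) (fun a => a < S.size Y → p a) := by
  induction k generalizing Y p with
  | zero => exact S.idem_congr _ (fun a ha => ⟨fun h _ => h, fun h => h ha⟩)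
  | succ k ih =>
    change D.wedgeListMap (List.replicate k X₁) ((D.wedge X₁).map (S.idem Y p)) = _
    rw [S.wedge_idem]
    refine (ih ((D.wedge X₁).obj Y) _).trans (S.idem_congr _ (fun a _ => ?_))
    rw [S.size_wedge]
    exact ⟨fun h h' => h (by omega) h', fun h _ h' => h h'⟩

theorem map_wedgeListMap_eq_zero_iff (k : ℕ) {Y Z : C} {t : Y ⟶ Z}
    {p : ℕ → Prop} (h : ∃ s : Z ⟶ Y, s ≫ t = 𝟙 Z ∧ t ≫ s = S.idem Y p)
    (x : F.obj (D.wedgeList (Y :: List.replicate k X₁))) :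
    (F.map (D.wedgeListMap (List.replicate k X₁) t)).hom x = 0 ↔
      (F.map (S.idem _ (fun a => a < S.size Y → p a))).hom x = 0 := by
  obtain ⟨s, hs, hs'⟩ := h
  have h1 : D.wedgeListMap (List.replicate k X₁) s ≫ D.wedgeListMap (List.replicate k X₁) t =
      𝟙 _ := by
    rw [← wedgeListMap_comp, hs, wedgeListMap_id]
  rw [map_eq_zero_iff_of_retract F h1, ← wedgeListMap_comp, hs', wedgeListMap_idem]

/-- The leading object Y may have any size, as the induction replaces it by Y ∨ X₁. It is killed as
one block, by the idempotent of the indices outside Y, whereas each of the k further copies of X₁ is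
killed by itself. -/
theorem isCross_iff (k : ℕ) (Y : C) (x : F.obj (D.wedgeList (Y :: List.replicate k X₁))) :
    D.IsCross F (List.replicate k X₁) Y x ↔
      (F.map (S.idem _ (fun a => S.size Y ≤ a))).hom x = 0 ∧
      ∀ b, S.size Y ≤ b → b < S.size Y + k → (F.map (S.idem _ (fun a => a ≠ b))).hom x = 0 := by
  induction k generalizing Y with
  | zero =>
    obtain ⟨s, hs, hs'⟩ := S.toZero_retract Y
    refine (map_eq_zero_iff_of_retract F hs x).trans ?_
    rw [hs']
    rw [S.idem_congr Y (q := fun a => S.size Y ≤ a)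
      (fun a ha => ⟨False.elim, fun h => absurd ha (not_lt.2 h)⟩)]
    exact ⟨fun h => ⟨h, fun b h1 h2 => absurd h2 (not_lt.2 h1)⟩, fun h => h.1⟩
  | succ k ih =>
    have hf := S.map_wedgeListMap_eq_zero_iff F k (S.fst_retract Y) x
    have hs := S.map_wedgeListMap_eq_zero_iff F k (S.snd_retract Y) x
    rw [S.size_wedge] at hf hs
    have hsize := S.size_wedgeList k ((D.wedge X₁).obj Y)
    rw [S.size_wedge] at hsize
    -- The retraction Y ∨ X₁ → Y kills only the new index `S.size Y`; the one onto X₁ kills exactly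
    -- the block of Y.
    rw [S.idem_congr _ (q := fun a => a ≠ S.size Y) (fun a ha => by omega)] at hf
    rw [S.idem_congr _ (q := fun a => S.size Y ≤ a) (fun a ha => by omega)] at hs
    cases k with
    | zero =>
      refine (and_congr hf hs).trans ?_
      constructor
      · rintro ⟨h1, h2⟩
        refine ⟨h2, fun b hb hb' => ?_⟩
        obtain rfl : b = S.size Y := by omega
        exact h1
      · rintro ⟨h1, h2⟩
        exact ⟨h2 _ le_rfl (by omega), h1⟩
    | succ k =>
      refine (and_congr (ih ((D.wedge X₁).obj Y) x) (and_congr hf hs)).trans ?_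
      rw [S.size_wedge]
      constructor
      · rintro ⟨⟨-, h1⟩, h2, h3⟩
        refine ⟨h3, fun b hb hb' => ?_⟩
        rcases hb.eq_or_lt with rfl | hb
        · exact h2
        · exact h1 b hb (by omega)
      · rintro ⟨h1, h2⟩
        refine ⟨⟨?_, fun b hb hb' => h2 b (by omega) (by omega)⟩, h2 _ le_rfl (by omega), h1⟩
        -- The recursive condition for the block Y ∨ X₁ is redundant: its idempotent factors through
        -- the one killing only the block Y.
        have h3 := S.idem_comp (D.wedgeList ((D.wedge X₁).obj Y :: List.replicate (k + 1) X₁))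
          (fun a => S.size Y ≤ a) (fun a => S.size Y + 1 ≤ a)
        rw [S.idem_congr _ (p := fun a => S.size Y ≤ a ∧ S.size Y + 1 ≤ a)
          (q := fun a => S.size Y + 1 ≤ a) (fun a ha => by omega)] at h3
        refine (congrArg (fun t => (F.map t).hom x) h3.symm).trans ?_
        refine (map_comp_apply F _ _ _).trans ?_
        exact (congrArg _ h1).trans (map_zero _)

theorem crossEffectι_injective (l : List C) : Function.Injective (D.crossEffectι F l).hom := by
  cases l with
  | nil => exact fun _ _ h => h
  | cons X l => exact crFunctorι_injective D F l X

/-- For n = 0 there is no equation, in agreement with cr₀F = F(0). For n > 0 the leading block is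
one copy of X₁, so killing it gives the equation of the index 0. -/
theorem mem_range_crossEffectι (n : ℕ) (x : F.obj (D.wedgeList (List.replicate n X₁))) :
    x ∈ (D.crossEffectι F (List.replicate n X₁)).hom.range ↔
      ∀ b < n, (F.map (S.idem _ (fun a => a ≠ b))).hom x = 0 := by
  cases n with
  | zero => exact ⟨fun _ b hb => absurd hb (Nat.not_lt_zero b), fun _ => ⟨x, rfl⟩⟩
  | succ k =>
    refine (mem_range_crFunctorι D F _ X₁ x).trans ((S.isCross_iff F k X₁ x).trans ?_)
    rw [S.size_one, S.idem_congr _ (q := fun a => a ≠ 0) (fun a ha => by omega)]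
    constructor
    · rintro ⟨h1, h2⟩ b hb
      rcases Nat.eq_zero_or_pos b with rfl | hb'
      · exact h1
      · exact h2 b hb' (by omega)
    · intro h
      exact ⟨h 0 (by omega), fun b _ hb => h b (by omega)⟩

/-- The wedge of n copies of [1] is only propositionally [n]; a variable W in place of [n] lets the
equality be eliminated. -/
theorem mem_range_crossEffectι_eqToHom (n : ℕ) {W : C}
    (hW : D.wedgeList (List.replicate n X₁) = W) (x : F.obj W) :
    x ∈ (D.crossEffectι F (List.replicate n X₁) ≫ F.map (eqToHom hW)).hom.range ↔
      ∀ b < n, (F.map (S.idem W (fun a => a ≠ b))).hom x = 0 := by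
  subst hW
  rw [eqToHom_refl, F.map_id, Category.comp_id]
  exact S.mem_range_crossEffectι F n x

theorem crossEffectι_eqToHom_injective (l : List C) {W : C} (hW : D.wedgeList l = W) :
    Function.Injective (D.crossEffectι F l ≫ F.map (eqToHom hW)).hom := by
  subst hW
  rw [eqToHom_refl, F.map_id, Category.comp_id]
  exact crossEffectι_injective F l

end IdemSystem

end

end WedgeData

/-- An injective homomorphism is, up to isomorphism, the inclusion of its range. -/
theorem exists_iso_of_injective {A B : AddCommGrpCat.{v}} (i : A ⟶ B)
    (hi : Function.Injective i.hom) (S : AddSubgroup B) (hS : ∀ x, x ∈ S ↔ x ∈ i.hom.range) :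
    ∃ e : AddCommGrpCat.of S ≅ A, e.hom ≫ i = AddCommGrpCat.ofHom S.subtype := by
  obtain rfl : S = i.hom.range := AddSubgroup.ext hS
  let e : A ≃+ i.hom.range := AddEquiv.ofBijective i.hom.rangeRestrict
    ⟨fun x y h => hi (congrArg Subtype.val h), i.hom.rangeRestrict_surjective⟩
  refine ⟨e.symm.toAddCommGrpIso, ?_⟩
  ext x
  exact congrArg Subtype.val (e.apply_symm_apply x)

/-! ### The idempotents of Γ(P) and of its opposite, and the comparison with cross-effects -/

section IdemSystems

variable {P : UnitaryOperad.{u}}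

/-- The fibres of the composite over non-zero elements again have at most one element, so its
decorations are forced, and only the underlying maps need to be compared. -/
theorem GammaHom.ofInj_comp_ofInj_eq {n m m' k : ℕ} {p : Fin (n + 1) → Fin (m + 1)} {hp0 hp}
    {q : Fin (m + 1) → Fin (k + 1)} {hq0 hq} {p' : Fin (n + 1) → Fin (m' + 1)} {hp0' hp'}
    {q' : Fin (m' + 1) → Fin (k + 1)} {hq0' hq'} (h : ∀ x, q (p x) = q' (p' x)) :
    (GammaHom.ofInj p hp0 hp : GammaHom P n m).comp (GammaHom.ofInj q hq0 hq) =
      (GammaHom.ofInj p' hp0' hp' : GammaHom P n m').comp (GammaHom.ofInj q' hq0' hq') := by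
  have hr0 : q (p 0) = 0 := by rw [hp0, hq0]
  have hr : ∀ y, y ≠ 0 → Subsingleton {x // q (p x) = y} := by
    refine fun y hy => ⟨fun a b => Subtype.ext ?_⟩
    have hab : p a.1 = p b.1 := congrArg Subtype.val ((hq y hy).elim ⟨p a.1, a.2⟩ ⟨p b.1, b.2⟩)
    have hb : p b.1 ≠ 0 := fun h0 => hy (by rw [← b.2, h0, hq0])
    have h1 := (hp _ hb).elim ⟨a.1, hab⟩ ⟨b.1, rfl⟩
    exact Subtype.mk.inj h1
  rw [GammaHom.ofInj_comp_ofInj p hp0 hp q hq0 hq (fun x => q (p x)) hr0 hr (fun _ => rfl),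
    GammaHom.ofInj_comp_ofInj p' hp0' hp' q' hq0' hq' (fun x => q (p x)) hr0 hr h]

open Classical in
/-- The idempotent of the set of the elements `a + 1` of `[n]` with `p a`. -/
noncomputable def GammaHom.idemOf (n : ℕ) (p : ℕ → Prop) : GammaHom P n n :=
  GammaHom.idem (Finset.univ.filter fun a : Fin n => p a)

theorem GammaHom.idemOf_congr {n : ℕ} {p q : ℕ → Prop} (h : ∀ a < n, p a ↔ q a) :
    (GammaHom.idemOf n p : GammaHom P n n) = GammaHom.idemOf n q := by
  rw [GammaHom.idemOf, GammaHom.idemOf]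
  congr 1
  ext a
  simp [h a a.2]

theorem GammaHom.idemOf_comp (n : ℕ) (p q : ℕ → Prop) :
    (GammaHom.idemOf n p : GammaHom P n n).comp (GammaHom.idemOf n q) =
      GammaHom.idemOf n (fun a => p a ∧ q a) := by
  rw [GammaHom.idemOf, GammaHom.idemOf, GammaHom.idem_comp_idem, GammaHom.idemOf]
  congr 1
  ext a
  simp

theorem GammaHom.idemOf_ne {n : ℕ} (k : Fin n) :
    (GammaHom.idemOf n (fun a => a ≠ k) : GammaHom P n n) =
      GammaHom.idem (Finset.univ.erase k) := by
  rw [GammaHom.idemOf]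
  congr 1
  ext a
  simp [Fin.ext_iff]

open Classical in
theorem idemFun_filter_succ {n : ℕ} (p : ℕ → Prop) (a : Fin n) :
    idemFun (Finset.univ.filter fun a : Fin n => p a) a.succ = if p a then a.succ else 0 := by
  change ite _ _ _ = _
  simp

/-- Checked on the two summands, which suffices by `GammaHom.wedge_unique`. On the second one the
condition is vacuous, its indices being at least n. -/
theorem GammaHom.idemOf_wedge (n k : ℕ) (p : ℕ → Prop) :
    (GammaHom.idemOf n p : GammaHom P n n).wedge k =
      GammaHom.idemOf (n + k) (fun a => a < n → p a) := by
  classical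
  refine GammaHom.wedge_unique _ ?_ ?_
  · refine GammaHom.ofInj_comp_ofInj_eq (fun x => ?_)
    induction x using Fin.cases with
    | zero => rfl
    | succ a =>
      rw [plusFun_succ, idemFun_filter_succ p, idemFun_filter_succ (fun a => a < n → p a)]
      by_cases h : p a
      · simp [h, plusFun_succ]
      · simp [h]
        rfl
  · refine GammaHom.comp_idem _ _ (fun x a hx => ?_)
    induction x using Fin.cases with
    | zero => exact absurd hx.symm (Fin.succ_ne_zero _)
    | succ b =>
      have hb : Fin.natAdd n b = a := Fin.succ_injective _ hx
      subst hb
      simp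

theorem GammaHom.fst_inl (n k : ℕ) :
    (GammaHom.fst n k : GammaHom P (n + k) n).comp (GammaHom.inl n k) =
      GammaHom.idemOf (n + k) (fun a => a < n) := by
  classical
  refine GammaHom.ofInj_comp_ofInj _ _ _ _ _ _ _ _ _ (fun x => ?_)
  induction x using wedge_cases with
  | h0 => rfl
  | hl a =>
    rw [fstFun_left, idemFun_filter_succ (fun a => a < n)]
    simp [plusFun_succ]
  | hr b =>
    rw [fstFun_right, idemFun_filter_succ (fun a => a < n)]
    simp
    rfl

theorem GammaHom.snd_inr (n k : ℕ) :
    (GammaHom.snd n k : GammaHom P (n + k) k).comp (GammaHom.inr n k) =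
      GammaHom.idemOf (n + k) (fun a => n ≤ a) := by
  classical
  refine GammaHom.ofInj_comp_ofInj _ _ _ _ _ _ _ _ _ (fun x => ?_)
  induction x using wedge_cases with
  | h0 => rfl
  | hl a =>
    rw [sndFun_left, idemFun_filter_succ (fun a => n ≤ a)]
    exact if_neg (by simp)
  | hr b =>
    rw [sndFun_right, idemFun_filter_succ (fun a => n ≤ a)]
    simp [plusFun_succ]

theorem GammaHom.zero_zero (n : ℕ) :
    (GammaHom.zero n 0 : GammaHom P n 0).comp (GammaHom.zero 0 n) =
      GammaHom.idemOf n (fun _ => False) := by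
  refine GammaHom.eq_of_zero (fun _ => rfl) (fun x => ?_)
  induction x using Fin.cases with
  | zero => rfl
  | succ a => exact if_neg (by simp)

theorem GammaHom.zero_zero' (n : ℕ) :
    (GammaHom.zero 0 n : GammaHom P 0 n).comp (GammaHom.zero n 0) = GammaHom.id 0 :=
  GammaHom.eq_of_zero (fun _ => rfl) (fun x => Subsingleton.elim (α := Fin 1) x 0)

/-- The idempotents of `Γ(P)`. -/
noncomputable def gammaIdem (P : UnitaryOperad.{u}) :
    (gammaWedge P).IdemSystem (Gamma.ob 1) where
  size Y := Y.n
  idem Y p := GammaHom.idemOf Y.n p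
  idem_congr _ _ _ h := GammaHom.idemOf_congr h
  idem_comp Y p q := GammaHom.idemOf_comp Y.n p q
  size_zero := rfl
  size_one := rfl
  size_wedge _ := rfl
  wedge_idem Y p := GammaHom.idemOf_wedge Y.n 1 p
  toZero_retract Y := ⟨GammaHom.zero 0 Y.n, GammaHom.zero_zero' Y.n, GammaHom.zero_zero Y.n⟩
  fst_retract Y := ⟨GammaHom.inl Y.n 1, GammaHom.inl_fst Y.n 1, GammaHom.fst_inl Y.n 1⟩
  snd_retract Y := ⟨GammaHom.inr Y.n 1, GammaHom.inr_snd Y.n 1, GammaHom.snd_inr Y.n 1⟩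

open Opposite

/-- The morphism of `Γ(P)ᵒᵖ` given by a morphism of `Γ(P)`. -/
noncomputable abbrev GammaHom.opHom {X Y : Gamma P} (f : GammaHom P X.n Y.n) : op Y ⟶ op X :=
  Quiver.Hom.op (V := Gamma P) f

/-- The idempotents of `Γ(P)ᵒᵖ`. -/
noncomputable def gammaOpIdem (P : UnitaryOperad.{u}) :
    (gammaOpWedge P).IdemSystem (op (Gamma.ob 1)) where
  size Y := Y.unop.n
  idem Y p := GammaHom.opHom (GammaHom.idemOf Y.unop.n p)
  idem_congr _ _ _ h := congrArg GammaHom.opHom (GammaHom.idemOf_congr h)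
  -- Composition is reversed in the opposite category; the idempotents commute, so the conjunction
  -- may be swapped.
  idem_comp Y p q := congrArg GammaHom.opHom ((GammaHom.idemOf_comp Y.unop.n q p).trans
    (GammaHom.idemOf_congr (fun _ _ => and_comm)))
  size_zero := rfl
  size_one := rfl
  size_wedge _ := rfl
  wedge_idem Y p := congrArg GammaHom.opHom (GammaHom.idemOf_wedge Y.unop.n 1 p)
  toZero_retract Y := ⟨GammaHom.opHom (X := Y.unop) (Y := Gamma.ob 0) (GammaHom.zero Y.unop.n 0),
    congrArg (GammaHom.opHom (X := Gamma.ob 0) (Y := Gamma.ob 0)) (GammaHom.zero_zero' Y.unop.n),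
    congrArg GammaHom.opHom (GammaHom.zero_zero Y.unop.n)⟩
  -- In the opposite category inclusions and retractions exchange roles: the structure maps are
  -- inclusions, and their sections are the retractions of Γ(P).
  fst_retract Y := ⟨GammaHom.opHom (X := Gamma.ob (Y.unop.n + 1)) (GammaHom.fst Y.unop.n 1),
    congrArg GammaHom.opHom (GammaHom.inl_fst Y.unop.n 1),
    congrArg (GammaHom.opHom (X := Gamma.ob (Y.unop.n + 1)) (Y := Gamma.ob (Y.unop.n + 1)))
      (GammaHom.fst_inl Y.unop.n 1)⟩
  snd_retract Y := ⟨GammaHom.opHom (X := Gamma.ob (Y.unop.n + 1)) (Y := Gamma.ob 1)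
      (GammaHom.snd Y.unop.n 1),
    congrArg (GammaHom.opHom (X := Gamma.ob 1) (Y := Gamma.ob 1)) (GammaHom.inr_snd Y.unop.n 1),
    congrArg (GammaHom.opHom (X := Gamma.ob (Y.unop.n + 1)) (Y := Gamma.ob (Y.unop.n + 1)))
      (GammaHom.snd_inr Y.unop.n 1)⟩

/-- Both sides embed in F([n]) with the same image, cut out by the equations of the idempotents of
the complements of single points. -/
theorem exists_cr_iso (F : Gamma P ⥤ AddCommGrpCat.{v}) (n : ℕ) :
    ∃ e : ((cr P).obj F).obj (Omega.ob n) ≅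
        (gammaWedge P).crossEffect F (List.replicate n (Gamma.ob 1)),
      e.hom ≫ crossInclusion F n = AddCommGrpCat.ofHom (crSub F n).subtype := by
  refine exists_iso_of_injective (crossInclusion F n)
    (WedgeData.IdemSystem.crossEffectι_eqToHom_injective F _ _) (crSub F n) (fun x => ?_)
  refine mem_crSub_iff_idem.trans (Iff.trans ?_
    ((gammaIdem P).mem_range_crossEffectι_eqToHom F n (gammaWedge_list P n) x).symm)
  refine Iff.trans (forall_congr' fun k => ?_) (Fin.forall_iff (p := fun k =>
    ev F (GammaHom.idemOf n (fun a => a ≠ k)) x = 0))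
  rw [← GammaHom.idemOf_ne]

theorem exists_crOp_iso (G : (Gamma P)ᵒᵖ ⥤ AddCommGrpCat.{v}) (n : ℕ) :
    ∃ e : ((crOp P).obj G).obj (op (Omega.ob n)) ≅
        (gammaOpWedge P).crossEffect G (List.replicate n (op (Gamma.ob 1))),
      e.hom ≫ crossOpInclusion G n = AddCommGrpCat.ofHom (crOpSub G n).subtype := by
  refine exists_iso_of_injective (crossOpInclusion G n)
    (WedgeData.IdemSystem.crossEffectι_eqToHom_injective G _ _) (crOpSub G n) (fun x => ?_)
  refine mem_crOpSub_iff_idem.trans (Iff.trans ?_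
    ((gammaOpIdem P).mem_range_crossEffectι_eqToHom G n (gammaOpWedge_list P n) x).symm)
  refine Iff.trans (forall_congr' fun k => ?_) (Fin.forall_iff (p := fun k =>
    evOp G (GammaHom.idemOf n (fun a => a ≠ k)) x = 0))
  rw [← GammaHom.idemOf_ne]

end IdemSystems

/-! ### Naturality in the operad -/

section Naturality

variable {P : UnitaryOperad.{u}} {Q : UnitaryOperad.{w}} (φ : OperadHom P Q)

/-- The map `Γ(P)([n], [m]) → Γ(Q)([n], [m])`. -/
noncomputable abbrev GammaHom.map {n m : ℕ} (f : GammaHom P n m) : GammaHom Q n m :=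
  (gammaMap φ).map (X := Gamma.ob n) (Y := Gamma.ob m) f

/-- The map `Ω(P)(n, m) → Ω(Q)(n, m)`. -/
noncomputable abbrev OmegaHom.map {n m : ℕ} (f : OmegaHom P n m) : OmegaHom Q n m :=
  (omegaMap φ).map (X := Omega.ob n) (Y := Omega.ob m) f

theorem GammaHom.map_comp {n m k : ℕ} (f : GammaHom P n m) (g : GammaHom P m k) :
    (f.comp g).map φ = (f.map φ).comp (g.map φ) :=
  (gammaMap φ).map_comp (X := Gamma.ob n) (Y := Gamma.ob m) (Z := Gamma.ob k) f g

/-- A morphism of operads preserves the unit and the unique nullary operation. Inclusions,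
retractions and idempotents are therefore unchanged. -/
theorem GammaHom.map_ofInj {n m : ℕ} (p : Fin (n + 1) → Fin (m + 1)) (h0 hp) :
    (GammaHom.ofInj p h0 hp : GammaHom P n m).map φ = GammaHom.ofInj p h0 hp := by
  change GammaHom.mk _ _ _ = GammaHom.mk _ _ _
  congr 1
  funext y hy
  have := hp y hy
  exact φ.app_pt {x // p x = y}

theorem OmegaHom.map_plus {n m : ℕ} (f : OmegaHom P n m) : f.plus.map φ = (f.map φ).plus := by
  change GammaHom.mk _ _ _ = GammaHom.mk _ _ _
  congr 1
  funext y hy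
  exact φ.app_transport (plusFiber f.toFun y hy) (f.dec (y.pred hy))

/-- The image of the equation of `restrict_spec` under the functor of φ is the same equation over Q,
and that equation has a unique solution. -/
theorem OmegaHom.map_restrict {n m : ℕ} {g : GammaHom P n m} {μ : Finset (Fin n)}
    {ν : Finset (Fin m)} (h : g.IsImage μ ν) :
    (g.restrict μ ν h).map φ = (g.map φ).restrict μ ν h := by
  apply restrict_unique
  have h1 := congrArg (GammaHom.map φ) (restrict_spec h)
  rw [GammaHom.map_comp, GammaHom.map_comp, OmegaHom.map_plus] at h1
  refine Eq.trans ?_ (h1.trans ?_)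
  · exact congrArg _ (GammaHom.map_ofInj φ _ _ _).symm
  · exact congrArg (fun t => GammaHom.comp t _) (GammaHom.map_ofInj φ _ _ _)

/-- The groups c r computed over P and over Q are equal subgroups of one group, but not
definitionally. Strict equality of the functors thus needs heterogeneous equality of maps, which
reduces to equality of values in the ambient group. -/
theorem heq_of_coe {A B : Type v} [AddCommGroup A] [AddCommGroup B] {S S' : AddSubgroup A}
    {R R' : AddSubgroup B} (hS : S = S') (hR : R = R') {g : AddCommGrpCat.of S ⟶ AddCommGrpCat.of R}
    {g' : AddCommGrpCat.of S' ⟶ AddCommGrpCat.of R'}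
    (h : ∀ x hx hx', (g.hom ⟨x, hx⟩ : R).1 = (g'.hom ⟨x, hx'⟩ : R').1) :
    HEq g g' := by
  subst hS hR
  exact heq_of_eq (AddCommGrpCat.hom_ext (AddMonoidHom.ext fun x => Subtype.ext (h x.1 x.2 x.2)))

theorem heq_natTrans {C : Type*} [Category* C] {D : Type*} [Category* D] {F F' G G' : C ⥤ D}
    (hF : F = F') (hG : G = G') {α : F ⟶ G} {β : F' ⟶ G'} (h : ∀ X, HEq (α.app X) (β.app X)) :
    HEq α β := by
  subst hF hG
  exact heq_of_eq (NatTrans.ext (funext fun X => eq_of_heq (h X)))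

/-- The defining equations involve only the retractions, which the functor of φ preserves. -/
theorem crSub_gammaMap (F : Gamma Q ⥤ AddCommGrpCat.{v}) (n : ℕ) :
    crSub (gammaMap φ ⋙ F) n = crSub F n := by
  refine AddSubgroup.ext fun x =>
    mem_crSub.trans (Iff.trans (forall_congr' (fun k => ?_)) mem_crSub.symm)
  exact iff_of_eq (congrArg (fun t : GammaHom Q n _ => ev F t x = 0) (GammaHom.map_ofInj φ _ _ _))

theorem crOpSub_gammaMap (G : (Gamma Q)ᵒᵖ ⥤ AddCommGrpCat.{v}) (n : ℕ) :
    crOpSub ((gammaMap φ).op ⋙ G) n = crOpSub G n := by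
  refine AddSubgroup.ext fun x =>
    mem_crOpSub.trans (Iff.trans (forall_congr' (fun k => ?_)) mem_crOpSub.symm)
  exact iff_of_eq (congrArg (fun t : GammaHom Q _ n => evOp G t x = 0) (GammaHom.map_ofInj φ _ _ _))

theorem crOpProj_gammaMap (G : (Gamma Q)ᵒᵖ ⥤ AddCommGrpCat.{v}) (n : ℕ) :
    crOpProj ((gammaMap φ).op ⋙ G) n = crOpProj G n := by
  refine Finset.sum_congr rfl (fun A _ => ?_)
  exact congrArg (fun t : GammaHom Q n n => (-1 : ℤ) ^ Aᶜ.card • evOp G t)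
    (GammaHom.map_ofInj φ _ _ _)

theorem cr_obj_gammaMap (F : Gamma Q ⥤ AddCommGrpCat.{v}) :
    (cr P).obj (gammaMap φ ⋙ F) = omegaMap φ ⋙ (cr Q).obj F := by
  refine CategoryTheory.Functor.hext (fun X =>
    congrArg (fun S : AddSubgroup (F.obj (Gamma.ob X.n)) => AddCommGrpCat.of S)
      (crSub_gammaMap φ F X.n)) (fun X Y f => ?_)
  refine heq_of_coe (crSub_gammaMap φ F X.n) (crSub_gammaMap φ F Y.n) (fun x hx hx' => ?_)
  exact congrArg (fun t : GammaHom Q X.n Y.n => ev F t x) (OmegaHom.map_plus φ f)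

theorem cr_map_app_coe {F F' : Gamma P ⥤ AddCommGrpCat.{v}} (τ : F ⟶ F') (X : Omega P)
    (x : crSub F X.n) : ((((cr P).map τ).app X).hom x : crSub F' X.n).1 =
      (τ.app (Gamma.ob X.n)).hom x.1 := rfl

theorem crOp_map_app_coe {F F' : (Gamma P)ᵒᵖ ⥤ AddCommGrpCat.{v}} (τ : F ⟶ F') (X : (Omega P)ᵒᵖ)
    (x : crOpSub F X.unop.n) : ((((crOp P).map τ).app X).hom x : crOpSub F' X.unop.n).1 =
      (τ.app (Opposite.op (Gamma.ob X.unop.n))).hom x.1 := rfl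

theorem cr_map_gammaMap {F F' : Gamma Q ⥤ AddCommGrpCat.{v}} (τ : F ⟶ F') (X : Omega P) :
    HEq (((cr P).map (Functor.whiskerLeft (gammaMap φ) τ)).app X)
      (((cr Q).map τ).app ((omegaMap φ).obj X)) :=
  heq_of_coe (crSub_gammaMap φ F X.n) (crSub_gammaMap φ F' X.n) (fun x hx hx' =>
    (cr_map_app_coe (Functor.whiskerLeft (gammaMap φ) τ) X ⟨x, hx⟩).trans
      (cr_map_app_coe τ ((omegaMap φ).obj X) ⟨x, hx'⟩).symm)

theorem cr_natural :
    (Functor.whiskeringLeft _ _ AddCommGrpCat.{v}).obj (gammaMap φ) ⋙ cr P =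
      cr Q ⋙ (Functor.whiskeringLeft _ _ _).obj (omegaMap φ) :=
  CategoryTheory.Functor.hext (cr_obj_gammaMap φ) (fun F F' τ =>
    heq_natTrans (cr_obj_gammaMap φ F) (cr_obj_gammaMap φ F') (cr_map_gammaMap φ τ))

theorem crOp_obj_gammaMap (G : (Gamma Q)ᵒᵖ ⥤ AddCommGrpCat.{v}) :
    (crOp P).obj ((gammaMap φ).op ⋙ G) = (omegaMap φ).op ⋙ (crOp Q).obj G := by
  refine CategoryTheory.Functor.hext (fun X =>
    congrArg (fun S : AddSubgroup (G.obj (Opposite.op (Gamma.ob X.unop.n))) => AddCommGrpCat.of S)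
      (crOpSub_gammaMap φ G X.unop.n)) (fun X Y f => ?_)
  refine heq_of_coe (crOpSub_gammaMap φ G X.unop.n) (crOpSub_gammaMap φ G Y.unop.n)
    (fun x hx hx' => ?_)
  refine (DFunLike.congr_fun (crOpProj_gammaMap φ G Y.unop.n) _).trans ?_
  exact congrArg (fun t : GammaHom Q Y.unop.n X.unop.n => crOpProj G Y.unop.n (evOp G t x))
    (OmegaHom.map_plus φ f.unop)

theorem crOp_map_gammaMap {G G' : (Gamma Q)ᵒᵖ ⥤ AddCommGrpCat.{v}} (τ : G ⟶ G')
    (X : (Omega P)ᵒᵖ) :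
    HEq (((crOp P).map (Functor.whiskerLeft (gammaMap φ).op τ)).app X)
      (((crOp Q).map τ).app ((omegaMap φ).op.obj X)) :=
  heq_of_coe (crOpSub_gammaMap φ G X.unop.n) (crOpSub_gammaMap φ G' X.unop.n) (fun x hx hx' =>
    (crOp_map_app_coe (Functor.whiskerLeft (gammaMap φ).op τ) X ⟨x, hx⟩).trans
      (crOp_map_app_coe τ ((omegaMap φ).op.obj X) ⟨x, hx'⟩).symm)

theorem crOp_natural :
    (Functor.whiskeringLeft _ _ AddCommGrpCat.{v}).obj (gammaMap φ).op ⋙ crOp P =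
      crOp Q ⋙ (Functor.whiskeringLeft _ _ _).obj (omegaMap φ).op :=
  CategoryTheory.Functor.hext (crOp_obj_gammaMap φ) (fun G G' τ =>
    heq_natTrans (crOp_obj_gammaMap φ G) (crOp_obj_gammaMap φ G') (crOp_map_gammaMap φ τ))

/-- The functor of φ leaves the underlying map unchanged, so g(μ) and the case distinction are the
same, and restrictions correspond by `OmegaHom.map_restrict`. -/
theorem iShriekMap_omegaMap (G : Omega Q ⥤ AddCommGrpCat.{v}) {n m : ℕ} (g : GammaHom P n m) :
    iShriekMap (omegaMap φ ⋙ G) g = iShriekMap G (g.map φ) := by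
  refine congrArg DirectSum.toAddMonoid (funext fun μ => ?_)
  by_cases h : ∃ ν, g.IsImage μ ν
  · obtain ⟨ν, h⟩ := h
    refine (iShriekComp_of _ g h).trans ?_
    refine Eq.trans ?_ (iShriekComp_of G (g.map φ) (μ := μ) (ν := ν) h).symm
    exact congrArg (fun t => (IShriek.ι G ν).comp (evΩ G t)) (OmegaHom.map_restrict φ h)
  · exact (iShriekComp_zero _ g h).trans (iShriekComp_zero G (g.map φ) (μ := μ) h).symm

theorem iStarMap_omegaMap (G : (Omega Q)ᵒᵖ ⥤ AddCommGrpCat.{v}) {n m : ℕ} (h : GammaHom P n m) :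
    iStarMap ((omegaMap φ).op ⋙ G) h = iStarMap G (h.map φ) := by
  refine congrArg DirectSum.toAddMonoid (funext fun μ => Finset.sum_congr rfl fun ν _ => ?_)
  refine congrArg (fun t => (IStar.ι G ν).comp t) ?_
  by_cases H : h.IsImage ν μ
  · refine (iStarEntry_of _ H).trans ?_
    refine Eq.trans ?_ (iStarEntry_of G (h := h.map φ) H).symm
    exact congrArg (fun t => evΩOp G t) (OmegaHom.map_restrict φ H)
  · exact (iStarEntry_zero _ H).trans (iStarEntry_zero G (h := h.map φ) H).symm

/-- Unlike for cr, the direct sums on the two sides agree definitionally, so ordinary equality of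
the maps is enough. -/
theorem iShriek_obj_omegaMap (G : Omega Q ⥤ AddCommGrpCat.{v}) :
    (iShriek P).obj (omegaMap φ ⋙ G) = gammaMap φ ⋙ (iShriek Q).obj G :=
  CategoryTheory.Functor.hext (fun _ => rfl) (fun X Y g => heq_of_eq
    (congrArg AddCommGrpCat.ofHom (iShriekMap_omegaMap (n := X.n) (m := Y.n) φ G g)))

theorem iShriek_natural :
    (Functor.whiskeringLeft _ _ AddCommGrpCat.{v}).obj (omegaMap φ) ⋙ iShriek P =
      iShriek Q ⋙ (Functor.whiskeringLeft _ _ _).obj (gammaMap φ) :=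
  CategoryTheory.Functor.hext (iShriek_obj_omegaMap φ) (fun G G' _ =>
    heq_natTrans (iShriek_obj_omegaMap φ G) (iShriek_obj_omegaMap φ G') (fun _ => HEq.rfl))

theorem iStar_obj_omegaMap (G : (Omega Q)ᵒᵖ ⥤ AddCommGrpCat.{v}) :
    (iStar P).obj ((omegaMap φ).op ⋙ G) = (gammaMap φ).op ⋙ (iStar Q).obj G :=
  CategoryTheory.Functor.hext (fun _ => rfl) (fun X Y g => heq_of_eq
    (congrArg AddCommGrpCat.ofHom (iStarMap_omegaMap (n := Y.unop.n) (m := X.unop.n) φ G g.unop)))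

theorem iStar_natural :
    (Functor.whiskeringLeft _ _ AddCommGrpCat.{v}).obj (omegaMap φ).op ⋙ iStar P =
      iStar Q ⋙ (Functor.whiskeringLeft _ _ _).obj (gammaMap φ).op :=
  CategoryTheory.Functor.hext (iStar_obj_omegaMap φ) (fun G G' _ =>
    heq_natTrans (iStar_obj_omegaMap φ G) (iStar_obj_omegaMap φ G') (fun _ => HEq.rfl))

end Naturality

end DoldKan

theorem mainTheorem4 :
    -- the equivalences for a fixed unitary set-operad
    (∀ P : UnitaryOperad.{u},
      -- `cr` and `i_!` are mutually inverse equivalences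
      (∃ e : (Gamma P ⥤ AddCommGrpCat.{v}) ≌ (Omega P ⥤ AddCommGrpCat.{v}),
        e.functor = cr P ∧ e.inverse = iShriek P) ∧
      -- `c̃r` and `i_*` are mutually inverse equivalences
      (∃ e : ((Gamma P)ᵒᵖ ⥤ AddCommGrpCat.{v}) ≌ ((Omega P)ᵒᵖ ⥤ AddCommGrpCat.{v}),
        e.functor = crOp P ∧ e.inverse = iStar P) ∧
      -- `cr(F)(n) = crₙF([1],…,[1])`, as subgroups of `F([n])`
      (∀ (F : Gamma P ⥤ AddCommGrpCat.{v}) (n : ℕ),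
        ∃ e : ((cr P).obj F).obj (Omega.ob n) ≅
            (gammaWedge P).crossEffect F (List.replicate n (Gamma.ob 1)),
          e.hom ≫ crossInclusion F n = AddCommGrpCat.ofHom (crSub F n).subtype) ∧
      -- `c̃r(G)(n) = c̃rₙG([1],…,[1])`, as subgroups of `G([n])`
      (∀ (G : (Gamma P)ᵒᵖ ⥤ AddCommGrpCat.{v}) (n : ℕ),
        ∃ e : ((crOp P).obj G).obj (Opposite.op (Omega.ob n)) ≅
            (gammaOpWedge P).crossEffect G (List.replicate n (Opposite.op (Gamma.ob 1))),
          e.hom ≫ crossOpInclusion G n = AddCommGrpCat.ofHom (crOpSub G n).subtype) ∧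
      -- `c̃r(G)(n)` is a complement of `∑_k Im G(r_k)` in `G([n])`, and `c̃r(G)(f)` is the map
      -- induced by `G(f₊)` on the quotients by the subgroups `∑_k Im G(r_k)`
      (∀ (G : (Gamma P)ᵒᵖ ⥤ AddCommGrpCat.{v}) (n : ℕ), IsCompl (crOpSub G n) (crOpRel G n)) ∧
      (∀ (G : (Gamma P)ᵒᵖ ⥤ AddCommGrpCat.{v}) (n m : ℕ) (f : OmegaHom P n m),
        (∀ x ∈ crOpRel G m, evOp G f.plus x ∈ crOpRel G n) ∧
        (∀ x : crOpSub G m, (crOpMap G f x).1 - evOp G f.plus x.1 ∈ crOpRel G n))) ∧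
    -- naturality in the operad
    (∀ (P : UnitaryOperad.{u}) (Q : UnitaryOperad.{w}) (φ : OperadHom P Q),
      (Functor.whiskeringLeft _ _ AddCommGrpCat.{v}).obj (gammaMap φ) ⋙ cr P =
        cr Q ⋙ (Functor.whiskeringLeft _ _ _).obj (omegaMap φ) ∧
      (Functor.whiskeringLeft _ _ AddCommGrpCat.{v}).obj (omegaMap φ) ⋙ iShriek P =
        iShriek Q ⋙ (Functor.whiskeringLeft _ _ _).obj (gammaMap φ) ∧
      (Functor.whiskeringLeft _ _ AddCommGrpCat.{v}).obj (gammaMap φ).op ⋙ crOp P =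
        crOp Q ⋙ (Functor.whiskeringLeft _ _ _).obj (omegaMap φ).op ∧
      (Functor.whiskeringLeft _ _ AddCommGrpCat.{v}).obj (omegaMap φ).op ⋙ iStar P =
        iStar Q ⋙ (Functor.whiskeringLeft _ _ _).obj (gammaMap φ).op) := by
  refine ⟨fun P => ⟨⟨crEquivalence P, rfl, rfl⟩, ⟨crOpEquivalence P, rfl, rfl⟩, exists_cr_iso,
    exists_crOp_iso, isCompl_crOpSub_crOpRel, fun G n m f =>
      ⟨fun x hx => evOp_plus_mem_crOpRel G f hx, fun x => ?_⟩⟩, fun P Q φ =>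
    ⟨cr_natural φ, iShriek_natural φ, crOp_natural φ, iStar_natural φ⟩⟩
  -- The induced map is G(f₊) followed by the projection, so the difference is minus the part of
  -- G(f₊)x removed by the projection.
  rw [← neg_sub]
  exact AddSubgroup.neg_mem _ (sub_crOpProj_mem G n _)
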